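/- **Setting.** Let $\mathbb F=\mathbb R,\mathbb C$ or $\mathbb H$ and let $U(n,n,\mathbb F)$ be the group of matrices in $\mathbb F^{2n\times 2n}$ preserving the form $b((x,y),(\xi,\eta))=\bar x^T\xi-\bar y^T\eta$ on $\mathbb F^n\times\mathbb F^n$. Write $O(n,n)=U(n,n,\mathbb R)$, with identity component $O_o(n,n)$, $U(n,n)=U(n,n,\mathbb C)$, $SU(n,n)=\{A\in U(n,n):\det A=1\}$ and $Sp(n,n)=U(n,n,\mathbb H)$. Let $G=O_o(n,n)$, $SU(n,n)$ or $Sp(n,n)$ act on $M=SO_n$, $U_n$ or $Sp_n$, respectively, by $$\begin{pmatrix}A&B\\C&D\end{pmatrix}*U=(AU+B)(CU+D)^{-1}.$$ Give $M\subset\mathbb F^{n\times n}$ the Riemannian metric induced by $\langle X,Y\rangle=\operatorname{Re}\operatorname{tr}(\overline X^TY)$, with Riemannian volume $\mu$. The kinetic energy metric on $G$ is $$\langle X,Y\rangle_g=\int_M\langle\widetilde X(q),\widetilde Y(q)\rangle\,d\mu(q),\qquad X,Y\in T_gG,$$ where $\widetilde X(q)=\frac{d}{dt}\big|_0\,\gamma(t)*q$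 for any smooth curve $\gamma$ in $G$ with $\gamma(0)=g$, $\gamma'(0)=X$. Geodesics are the smooth curves, defined on open intervals, that are on each compact subinterval critical points of the energy $\frac12\int\|\gamma'\|^2dt$ for smooth variations in $G$ with fixed end points. A submanifold $N\subset G$ is *totally geodesic* if the geodesics of $N$, with the induced metric, are geodesics of $G$, and every geodesic of $G$ that is tangent to $N$ at some instant remains in $N$ throughout its interval of definition. **Theorem.** Let $n\ge 1$. The following subgroups are (embedded) totally geodesic submanifolds of the ambient group endowed with its kinetic energy metric: a) $O_o(n,n)\subset SU(n,n)$; b) $U(n,n)\subset Sp(n,n)$; c) $O_o(n,n)\subset Sp(n,n)$; d) $U(n,n)\subset O_o(2n,2n)$, provided $2n>2$; e) $Sp(n,n)\subset O_o(4n,4n)$. The inclusions a)–c) are given by $\mathbb R\subset\mathbb C\subset\mathbb H$ entrywise ($\mathbb C=\mathbb R\oplus\mathbb Ri\subset\mathbb H$). The inclusions d) and e) regard a matrix over $\mathbb C$ or $\mathbb H$ as a real linear map on column vectors, through the real bases $1,i$ of $\mathbb C$ and $1,i,j,k$ of $\mathbb H$, that is, each entry is replaced by the real matrix of left multiplication by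 it. -/

import Mathlib

open scoped Matrix ContDiff Quaternion MeasureTheory
open MeasureTheory Set

attribute [local instance] Matrix.frobeniusNormedAddCommGroup Matrix.frobeniusNormedSpace

noncomputable section

/-! ### Submanifolds of a normed space, geodesics, totally geodesic submanifolds

A Riemannian metric on a submanifold `N` of a real normed space `E` is given by a function
`ρ : E → E → E → ℝ`, where `ρ x v w` is the inner product of `v, w ∈ T_x N` for `x ∈ N`; the values
of `ρ` at other arguments are irrelevant. With the same `ρ`, a submanifold contained in `N` carries
the induced metric. -/

section Geometry

variable {E : Type*} [NormedAddCommGroup E] [NormedSpace ℝ E]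

/-- `N` is a smooth embedded submanifold of `E`: around each of its points a diffeomorphism between
open subsets of `E` straightens `N` to a linear subspace. -/
def IsEmbeddedSubmanifold (N : Set E) : Prop :=
  ∀ x ∈ N, ∃ (W : Submodule ℝ E) (Φ : OpenPartialHomeomorph E E),
    x ∈ Φ.source ∧ ContDiffOn ℝ ∞ Φ Φ.source ∧ ContDiffOn ℝ ∞ Φ.symm Φ.target ∧
      ∀ y ∈ Φ.source, (y ∈ N ↔ Φ y ∈ W)

/-- The tangent vectors to `N` at `x`: the initial velocities of the smooth curves in `N` that
start at `x`. -/
def tangentVectors (N : Set E) (x : E) : Set E :=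
  {v | ∃ c : ℝ → E, ContDiff ℝ ∞ c ∧ (∀ t, c t ∈ N) ∧ c 0 = x ∧ deriv c 0 = v}

/-- The energy `½ ∫ₐᵇ ‖γ'(t)‖² dt` of a curve with respect to the metric `ρ`. -/
def curveEnergy (ρ : E → E → E → ℝ) (γ : ℝ → E) (a b : ℝ) : ℝ :=
  (1 / 2) * ∫ t in a..b, ρ (γ t) (deriv γ t) (deriv γ t)

/-- `γ` is a geodesic of `(N, ρ)` on the open interval `I`: it is a smooth curve in `N` which on
each compact subinterval `[a, b]` is a critical point of the energy with respect to the smooth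
variations through curves in `N` with fixed end points. -/
def IsGeodesicOn (ρ : E → E → E → ℝ) (N : Set E) (γ : ℝ → E) (I : Set ℝ) : Prop :=
  ContDiffOn ℝ ∞ γ I ∧ MapsTo γ I N ∧
    ∀ a b : ℝ, a < b → Icc a b ⊆ I →
      ∀ ε : ℝ, 0 < ε → ∀ Γ : ℝ × ℝ → E,
        ContDiffOn ℝ ∞ Γ (Ioo (-ε) ε ×ˢ I) →
        MapsTo Γ (Ioo (-ε) ε ×ˢ I) N →
        (∀ t ∈ I, Γ (0, t) = γ t) →
        (∀ s ∈ Ioo (-ε) ε, Γ (s, a) = γ a ∧ Γ (s, b) = γ b) →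
        HasDerivAt (fun s => curveEnergy ρ (fun t => Γ (s, t)) a b) 0 0

/-- `N` is a totally geodesic submanifold of `(G, ρ)`: it is a submanifold contained in `G`, the
geodesics of `N` for the induced metric are geodesics of `G`, and a geodesic of `G` that is at some
instant tangent to `N` remains in `N`. -/
structure IsTotallyGeodesic (ρ : E → E → E → ℝ) (N G : Set E) : Prop where
  subset : N ⊆ G
  submanifold : IsEmbeddedSubmanifold N
  geodesic_of_geodesic : ∀ (I : Set ℝ) (γ : ℝ → E), IsOpen I → I.OrdConnected →
    IsGeodesicOn ρ N γ I → IsGeodesicOn ρ G γ I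
  remains : ∀ (I : Set ℝ) (γ : ℝ → E), IsOpen I → I.OrdConnected → IsGeodesicOn ρ G γ I →
    ∀ t₀ ∈ I, γ t₀ ∈ N → deriv γ t₀ ∈ tangentVectors N (γ t₀) → ∀ t ∈ I, γ t ∈ N

/-- The Riemannian volume measure of a `d`-dimensional submanifold `M` of `E` (whose norm is
Euclidean): the `d`-dimensional Hausdorff measure, normalized to agree with Lebesgue measure on
`ℝᵈ`, restricted to `M`. -/
def submanifoldVolume (d : ℕ) (M : Set E) : @Measure E (borel E) :=
  letI : MeasurableSpace E := borel E
  haveI : BorelSpace E := ⟨rfl⟩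
  (μHE[d] : Measure E).restrict M

end Geometry

/-! ### The unitary groups over `ℝ`, `ℂ`, `ℍ`

The index type `ι` has `n` elements; `ι ⊕ ι` indexes the coordinates of `𝔽ⁿ × 𝔽ⁿ`. -/

section Groups

variable (ι : Type*) [Fintype ι] [DecidableEq ι]

/-- `U(n, n, 𝔽)`: the matrices that preserve `(x, y), (ξ, η) ↦ x̄ᵀ ξ - ȳᵀ η`. -/
def splitUnitary (𝔽 : Type*) [Ring 𝔽] [StarRing 𝔽] : Set (Matrix (ι ⊕ ι) (ι ⊕ ι) 𝔽) :=
  {A | Aᴴ * Matrix.fromBlocks 1 0 0 (-1) * A = Matrix.fromBlocks 1 0 0 (-1)}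

/-- `O_o(n, n)`: the identity component of `O(n, n)`. -/
def splitOrthogonalO : Set (Matrix (ι ⊕ ι) (ι ⊕ ι) ℝ) :=
  connectedComponentIn (splitUnitary ι ℝ) 1

/-- `SU(n, n)`. -/
def splitSpecialUnitary : Set (Matrix (ι ⊕ ι) (ι ⊕ ι) ℂ) :=
  {A | A ∈ splitUnitary ι ℂ ∧ A.det = 1}

/-- `SO_n`, as a set of matrices. -/
def compactSO : Set (Matrix ι ι ℝ) := (Matrix.specialOrthogonalGroup ι ℝ : Set (Matrix ι ι ℝ))

/-- `U_n` for `𝔽 = ℂ` and `Sp_n` for `𝔽 = ℍ`, as a set of matrices. -/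
def compactU (𝔽 : Type*) [Ring 𝔽] [StarRing 𝔽] : Set (Matrix ι ι 𝔽) :=
  (unitary (Matrix ι ι 𝔽) : Set (Matrix ι ι 𝔽))

end Groups

instance quaternionStarModule : StarModule ℝ ℍ[ℝ] := ⟨fun r q => by ext <;> simp⟩

/-! ### The Möbius action and the kinetic energy metric -/

section Kinetic

variable {ι : Type*} [Fintype ι] [DecidableEq ι]
  {𝔽 : Type*} [NormedDivisionRing 𝔽] [InnerProductSpace ℝ 𝔽] [StarRing 𝔽] [StarModule ℝ 𝔽]

/-- The Möbius action `(A B; C D) * U = (A U + B) (C U + D)⁻¹`. -/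
def mobius (g : Matrix (ι ⊕ ι) (ι ⊕ ι) 𝔽) (U : Matrix ι ι 𝔽) : Matrix ι ι 𝔽 :=
  (g.toBlocks₁₁ * U + g.toBlocks₁₂) * Ring.inverse (g.toBlocks₂₁ * U + g.toBlocks₂₂)

/-- The vector `X̃(q)`, the derivative at `0` of `γ(t) * q` for a curve `γ` with `γ(0) = g` and
`γ'(0) = X`. For `g ∈ U(n, n, 𝔽)` and `q` unitary, `C q + D` is invertible, so that `h ↦ h * q` is
a smooth function of the matrix `h` near `g`. -/
def mobiusVelocity (g X : Matrix (ι ⊕ ι) (ι ⊕ ι) 𝔽) (q : Matrix ι ι 𝔽) : Matrix ι ι 𝔽 :=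
  fderiv ℝ (fun h : Matrix (ι ⊕ ι) (ι ⊕ ι) 𝔽 => mobius h q) g X

/-- The real inner product `Re (tr (X̄ᵀ Y))` on matrices over `ℝ`, `ℂ` or `ℍ`. -/
def matrixInner (X Y : Matrix ι ι 𝔽) : ℝ := ∑ i, ∑ j, inner ℝ (X i j) (Y i j)

/-- The dimension of the unitary group of `𝔽ⁿ`, that is, of its Lie algebra, which consists of the
skew-Hermitian matrices. -/
def unitaryDim (ι : Type*) [Fintype ι] [DecidableEq ι]
    (𝔽 : Type*) [NormedDivisionRing 𝔽] [InnerProductSpace ℝ 𝔽] [StarRing 𝔽] [StarModule ℝ 𝔽] : ℕ :=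
  Module.finrank ℝ (skewAdjoint.submodule ℝ (Matrix ι ι 𝔽))

/-- The kinetic energy metric `⟨X, Y⟩ = ∫_M ⟨X̃(q), Ỹ(q)⟩ dμ(q)` at `g`, for the Möbius action on
`M = SO_n`, `U_n` or `Sp_n`, with the Riemannian volume `μ` of `M ⊆ 𝔽ⁿˣⁿ`. -/
def kineticMetric (M : Set (Matrix ι ι 𝔽)) (g X Y : Matrix (ι ⊕ ι) (ι ⊕ ι) 𝔽) : ℝ :=
  ∫ q, matrixInner (mobiusVelocity g X q) (mobiusVelocity g Y q)
    ∂(submanifoldVolume (unitaryDim ι 𝔽) M)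

end Kinetic

/-! ### Restriction of scalars -/

section Realify

variable {ι κ 𝔽 : Type*} [Fintype κ] [DecidableEq κ] [Ring 𝔽] [Algebra ℝ 𝔽]

/-- The real matrix of `A`, seen as a real linear map via the identification of `𝔽` with `ℝ^κ`
given by the basis `b`: each entry is replaced by the matrix of the left multiplication by it. The
coordinates of `𝔽ⁿ = ℝ^(ι × κ)` are indexed by `ι × κ`. -/
def realify (b : Module.Basis κ ℝ 𝔽) (A : Matrix (ι ⊕ ι) (ι ⊕ ι) 𝔽) :
    Matrix ((ι × κ) ⊕ (ι × κ)) ((ι × κ) ⊕ (ι × κ)) ℝ :=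
  Matrix.of fun p q =>
    Algebra.leftMulMatrix b (A (Sum.map Prod.fst Prod.fst p) (Sum.map Prod.fst Prod.fst q))
      (Sum.elim Prod.snd Prod.snd p) (Sum.elim Prod.snd Prod.snd q)

/-- The basis `1, i, j, k` of the quaternions. -/
def quaternionBasis : Module.Basis (Fin 4) ℝ ℍ[ℝ] :=
  Module.Basis.ofEquivFun
    { toFun := fun q => ![q.re, q.imI, q.imJ, q.imK]
      invFun := fun v => ⟨v 0, v 1, v 2, v 3⟩
      map_add' := fun p q => by ext i; fin_cases i <;> simp
      map_smul' := fun r q => by ext i; fin_cases i <;> simp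
      left_inv := fun q => rfl
      right_inv := fun v => by ext i; fin_cases i <;> rfl }

end Realify

end

/-! Each subgroup is, up to connected components, the fixed group of one isometric involution of the
ambient group or of two commuting ones. For a) it is entrywise complex conjugation, for b) entrywise
conjugation by the quaternion i, for c) the conjugations by i and by j. For d) and e), a real matrix
comes from ℂ or ℍ exactly when its blocks commute with right multiplication by i, respectively by i
and j, so the involutions are the conjugations by these skew orthogonal matrices.

Every such involution σ acts blockwise through an involution `t` of the algebra of the blocks that
respects conjugate transposition and the inner product and maps M to itself. Then σ(g) * t(q) = t(g
* q), and `t` preserves the volume of M, so the kinetic energy metric is σ-invariant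
(`IsMatrixInvolution.kineticMetric_map`).

Fixed groups of isometric involutions are totally geodesic for the classical reasons
(`isTotallyGeodesic_of_involution`). Along a curve of fixed points the first variation is
σ-invariant, so it only sees the symmetric part of a variation field, which is tangent to the fixed
group; hence geodesics of N are critical in G (`IsGeodesicOn.of_fixed`). If a geodesic γ of G is
tangent to N at an instant, then γ and σ ∘ γ are geodesics with the same initial data, so they
coincide (`IsGeodesicOn.eqOn`), and connectedness keeps γ in N. Two commuting involutions are
handled one after the other (`IsTotallyGeodesic.trans`).

Uniqueness of geodesics needs a definite metric of class C² (`isRiemannianOn_kineticMetric`), and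
definiteness means that no nonzero element of the Lie algebra acts trivially on M. Therefore SU(n,
n) replaces U(n, n), whose imaginary scalars act trivially, and 2n > 2 is required: SO₂ is
commutative, so two equal skew diagonal blocks act trivially on it.

In d) and e) the subgroup must moreover lie in the identity component. This follows from the
connectedness of U(n, n) and Sp(n, n): a component contains a unitary matrix, where the norm is
minimal, and among its unitary matrices the one of largest real trace is the identity
(`one_mem_component`). -/

noncomputable section

set_option maxSynthPendingDepth 3
set_option linter.unusedSectionVars false

/-! ### Integrals depending on a parameter -/

section ParametricIntegral

universe u

variable {X F : Type u} {Y : Type*} [NormedAddCommGroup X] [NormedSpace ℝ X]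
  [NormedAddCommGroup Y] [NormedSpace ℝ Y] [NormedAddCommGroup F] [NormedSpace ℝ F]
  [MeasurableSpace Y] [BorelSpace Y]

/-- Differentiation under the integral sign for a `C¹` integrand over a compact set. -/
theorem hasFDerivAt_setIntegral_of_contDiffOn {μ : Measure Y} {K : Set Y} (hK : IsCompact K)
    (hμ : μ K ≠ ⊤) {Ω : Set (X × Y)} (hΩ : IsOpen Ω) {f : X × Y → F} (hf : ContDiffOn ℝ 1 f Ω)
    {x₀ : X} (hx : ∀ y ∈ K, (x₀, y) ∈ Ω) :
    HasFDerivAt (fun x => ∫ y in K, f (x, y) ∂μ)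
      (∫ y in K, (fderiv ℝ f (x₀, y)).comp (ContinuousLinearMap.inl ℝ X Y) ∂μ) x₀ := by
  have hKm : MeasurableSet K := hK.isClosed.measurableSet
  have : IsFiniteMeasure (μ.restrict K) := ⟨by simpa using hμ.lt_top⟩
  have hdf : ContinuousOn (fderiv ℝ f) Ω := hf.continuousOn_fderiv_of_isOpen hΩ le_rfl
  have hpair : ContinuousOn (fun y : Y => ((x₀, y) : X × Y)) K := by fun_prop
  have hcomp : IsCompact ((fun y : Y => ((x₀, y) : X × Y)) '' K) := hK.image_of_continuousOn hpair
  obtain ⟨C, hC⟩ := hcomp.exists_bound_of_continuousOn (f := fderiv ℝ f)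
    (hdf.mono (by rintro _ ⟨y, hy, rfl⟩; exact hx y hy))
  -- Where the derivative is below `C + 1` the tube lemma yields a neighbourhood of `x₀` on which
  -- one constant dominates for all `y ∈ K`.
  let Ω' : Set (X × Y) := Ω ∩ {p | ‖fderiv ℝ f p‖ < C + 1}
  have hΩ' : IsOpen Ω' := by
    have := (hdf.norm).isOpen_inter_preimage hΩ (isOpen_Iio (a := C + 1))
    exact this
  have hsub : ({x₀} : Set X) ×ˢ K ⊆ Ω' := by
    rintro ⟨x, y⟩ ⟨h1, h2⟩
    simp only [mem_singleton_iff] at h1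
    subst h1
    exact ⟨hx y h2, lt_of_le_of_lt (hC _ ⟨y, h2, rfl⟩) (by linarith)⟩
  obtain ⟨s, v, hs, hv, hxs, hKv, hsv⟩ := generalized_tube_lemma isCompact_singleton hK hΩ' hsub
  have hmem : ∀ x ∈ s, ∀ y ∈ K, (x, y) ∈ Ω' := fun x hx y hy => hsv ⟨hx, hKv hy⟩
  have hs' : s ∈ nhds x₀ := hs.mem_nhds (hxs rfl)
  have hcont : ∀ x ∈ s, ContinuousOn (fun y => f (x, y)) K := fun x hx =>
    hf.continuousOn.comp (by fun_prop) fun y hy => (hmem x hx y hy).1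
  refine hasFDerivAt_integral_of_dominated_of_fderiv_le (μ := μ.restrict K) (s := s)
    (bound := fun _ => (C + 1) * ‖ContinuousLinearMap.inl ℝ X Y‖)
    (F := fun x y => f (x, y))
    (F' := fun x y => (fderiv ℝ f (x, y)).comp (ContinuousLinearMap.inl ℝ X Y)) hs' ?_ ?_ ?_ ?_ ?_ ?_
  · filter_upwards [hs'] with x hx
    exact (hcont x hx).aestronglyMeasurable_of_isCompact hK hKm
  · exact (hcont x₀ (hxs rfl)).integrableOn_of_subset_isCompact hK hKm Subset.rfl hμ
  · refine ContinuousOn.aestronglyMeasurable_of_isCompact ?_ hK hKm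
    refine ContinuousOn.clm_comp (hdf.comp hpair fun y hy => hx y hy) continuousOn_const
  · refine (ae_restrict_iff' hKm).2 (Filter.Eventually.of_forall fun y hy x hx => ?_)
    refine (ContinuousLinearMap.opNorm_comp_le _ _).trans ?_
    gcongr
    exact (hmem x hx y hy).2.le
  · exact integrable_const _
  · refine (ae_restrict_iff' hKm).2 (Filter.Eventually.of_forall fun y hy x hx => ?_)
    have h1 : HasFDerivAt f (fderiv ℝ f (x, y)) (x, y) :=
      ((hf.differentiableOn one_ne_zero).differentiableAt
        (hΩ.mem_nhds (hmem x hx y hy).1)).hasFDerivAt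
    have h2 : HasFDerivAt (fun x : X => ((x, y) : X × Y)) (ContinuousLinearMap.inl ℝ X Y) x :=
      hasFDerivAt_prodMk_left x y
    exact h1.comp x h2

/-- The derivative of the integral is again such an integral, of the partial derivative, with values
in continuous linear maps. The induction therefore lets the target space vary, which forces `X` and
`F` into one universe. -/
theorem contDiffOn_setIntegral {μ : Measure Y} {K : Set Y} (hK : IsCompact K)
    (hμ : μ K ≠ ⊤) {Ω : Set (X × Y)} (hΩ : IsOpen Ω) {O : Set X} (hO : IsOpen O)
    (hx : ∀ x ∈ O, ∀ y ∈ K, (x, y) ∈ Ω) (n : ℕ) :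
    ∀ {F : Type u} [NormedAddCommGroup F] [NormedSpace ℝ F] {f : X × Y → F},
      ContDiffOn ℝ n f Ω → ContDiffOn ℝ n (fun x => ∫ y in K, f (x, y) ∂μ) O := by
  induction n with
  | zero =>
    intro F _ _ f hf
    rw [Nat.cast_zero, contDiffOn_zero] at hf ⊢
    have : IsFiniteMeasure (μ.restrict K) := ⟨by simpa using hμ.lt_top⟩
    have hKm : MeasurableSet K := hK.isClosed.measurableSet
    intro x₀ hx₀
    refine ContinuousAt.continuousWithinAt ?_
    have hpair : ContinuousOn (fun y : Y => ((x₀, y) : X × Y)) K := by fun_prop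
    have hcomp : IsCompact ((fun y : Y => ((x₀, y) : X × Y)) '' K) :=
      hK.image_of_continuousOn hpair
    obtain ⟨C, hC⟩ := hcomp.exists_bound_of_continuousOn (f := f)
      (hf.mono (by rintro _ ⟨y, hy, rfl⟩; exact hx x₀ hx₀ y hy))
    have hΩ' : IsOpen (Ω ∩ {p | ‖f p‖ < C + 1}) :=
      (hf.norm).isOpen_inter_preimage hΩ (isOpen_Iio (a := C + 1))
    have hsub : ({x₀} : Set X) ×ˢ K ⊆ Ω ∩ {p | ‖f p‖ < C + 1} := by
      rintro ⟨x, y⟩ ⟨h1, h2⟩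
      simp only [mem_singleton_iff] at h1
      subst h1
      exact ⟨hx _ hx₀ y h2, lt_of_le_of_lt (hC _ ⟨y, h2, rfl⟩) (by linarith)⟩
    obtain ⟨s, v, hs, hv, hxs, hKv, hsv⟩ := generalized_tube_lemma isCompact_singleton hK hΩ' hsub
    have hmem : ∀ x ∈ s, ∀ y ∈ K, (x, y) ∈ Ω ∩ {p | ‖f p‖ < C + 1} :=
      fun x hx y hy => hsv ⟨hx, hKv hy⟩
    have hs' : s ∈ nhds x₀ := hs.mem_nhds (hxs rfl)
    refine continuousAt_of_dominated (bound := fun _ => C + 1) ?_ ?_ (integrable_const _) ?_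
    · filter_upwards [hs'] with x hx
      exact (hf.comp (by fun_prop) fun y hy =>
        (hmem x hx y hy).1).aestronglyMeasurable_of_isCompact hK hKm
    · filter_upwards [hs'] with x hx
      exact (ae_restrict_iff' hKm).2 (Filter.Eventually.of_forall fun y hy =>
        (hmem x hx y hy).2.le)
    · refine (ae_restrict_iff' hKm).2 (Filter.Eventually.of_forall fun y hy => ?_)
      exact ContinuousAt.comp (f := fun x : X => ((x, y) : X × Y))
        (hf.continuousAt (hΩ.mem_nhds (hx x₀ hx₀ y hy))) (by fun_prop)
  | succ n ih =>
    intro F _ _ f hf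
    have h1 : ContDiffOn ℝ 1 f Ω := hf.of_le (by exact_mod_cast Nat.le_add_left 1 n)
    have hd : ∀ x ∈ O, HasFDerivAt (fun x => ∫ y in K, f (x, y) ∂μ)
        (∫ y in K, (fderiv ℝ f (x, y)).comp (ContinuousLinearMap.inl ℝ X Y) ∂μ) x :=
      fun x hxO => hasFDerivAt_setIntegral_of_contDiffOn hK hμ hΩ h1 (hx x hxO)
    have h2 : ContDiffOn ℝ n (fderiv ℝ f) Ω :=
      hf.fderiv_of_isOpen hΩ (by exact_mod_cast le_rfl)
    have h3 : ContDiffOn ℝ n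
        (fun p => (fderiv ℝ f p).comp (ContinuousLinearMap.inl ℝ X Y)) Ω :=
      h2.clm_comp contDiffOn_const
    rw [Nat.cast_succ, contDiffOn_succ_iff_fderiv_of_isOpen hO]
    refine ⟨fun x hxO => (hd x hxO).differentiableAt.differentiableWithinAt, by simp, ?_⟩
    refine (ih h3).congr fun x hxO => ?_
    exact (hd x hxO).fderiv

end ParametricIntegral

/-! ### The first variation of the energy -/

section FirstVariation

universe u

variable {E : Type u} [NormedAddCommGroup E] [NormedSpace ℝ E]

theorem two_le_infty : (2 : WithTop ℕ∞) ≤ ∞ :=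
  WithTop.coe_le_coe.2 (le_top : (2 : ℕ∞) ≤ ⊤)

/-- The integrand of the first variation of the energy along `γ` in the direction `V`. -/
def variationDensity (B : E → E →L[ℝ] E →L[ℝ] ℝ) (γ V : ℝ → E) (t : ℝ) : ℝ :=
  fderiv ℝ B (γ t) (V t) (deriv γ t) (deriv γ t) + B (γ t) (deriv V t) (deriv γ t) +
    B (γ t) (deriv γ t) (deriv V t)

/-- Differentiation under the integral sign, followed by the exchange of the two partial derivatives
of `Γ`. The metric `ρ` is arbitrary off `O`, so the smooth form `B` replaces it there. -/
theorem hasDerivAt_curveEnergy {ρ : E → E → E → ℝ} {B : E → E →L[ℝ] E →L[ℝ] ℝ} {O : Set E}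
    (hO : IsOpen O) (hB : ContDiffOn ℝ 2 B O) (hρ : ∀ x ∈ O, ∀ v w, ρ x v w = B x v w)
    {I : Set ℝ} (hI : IsOpen I) {a b : ℝ} (hab : a < b) (habI : Icc a b ⊆ I) {ε : ℝ} (hε : 0 < ε)
    {Γ : ℝ × ℝ → E} (hΓ : ContDiffOn ℝ ∞ Γ (Ioo (-ε) ε ×ˢ I))
    (hΓO : MapsTo Γ (Ioo (-ε) ε ×ˢ I) O) :
    HasDerivAt (fun s => curveEnergy ρ (fun t => Γ (s, t)) a b)
      ((1 / 2) * ∫ t in a..b, variationDensity B (fun t => Γ (0, t))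
        (fun t => fderiv ℝ Γ (0, t) (1, 0)) t) 0 := by
  have hΩ : IsOpen (Ioo (-ε) ε ×ˢ I) := isOpen_Ioo.prod hI
  have h0 : (0 : ℝ) ∈ Ioo (-ε) ε := by constructor <;> linarith
  let T : ℝ × ℝ → E := fun p => fderiv ℝ Γ p (0, 1)
  have hdΓ : ContDiffOn ℝ ∞ (fderiv ℝ Γ) (Ioo (-ε) ε ×ˢ I) := hΓ.fderiv_of_isOpen hΩ (by simp)
  have hT : ContDiffOn ℝ ∞ T (Ioo (-ε) ε ×ˢ I) := hdΓ.clm_apply contDiffOn_const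
  have hBΓ : ContDiffOn ℝ 2 (fun p => B (Γ p)) (Ioo (-ε) ε ×ˢ I) :=
    hB.comp (hΓ.of_le two_le_infty) hΓO
  let f : ℝ × ℝ → ℝ := fun p => B (Γ p) (T p) (T p)
  have hf : ContDiffOn ℝ 1 f (Ioo (-ε) ε ×ˢ I) := by
    have hT1 : ContDiffOn ℝ 1 T (Ioo (-ε) ε ×ˢ I) := hT.of_le (by exact_mod_cast le_top)
    exact ((hBΓ.of_le (by norm_num)).clm_apply hT1).clm_apply hT1
  have hat : ∀ {n : WithTop ℕ∞} {F : Type u} [NormedAddCommGroup F] [NormedSpace ℝ F]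
      {g : ℝ × ℝ → F}, ContDiffOn ℝ n g (Ioo (-ε) ε ×ˢ I) → ∀ s ∈ Ioo (-ε) ε, ∀ t ∈ I,
      ContDiffAt ℝ n g (s, t) := fun hg s hs t ht => hg.contDiffAt (hΩ.mem_nhds ⟨hs, ht⟩)
  have hderiv_t : ∀ {F : Type u} [NormedAddCommGroup F] [NormedSpace ℝ F] {g : ℝ × ℝ → F} {s t : ℝ},
      DifferentiableAt ℝ g (s, t) → HasDerivAt (fun t => g (s, t)) (fderiv ℝ g (s, t) (0, 1)) t := by
    intro F _ _ g s t hg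
    have h2 : HasDerivAt (fun t : ℝ => ((s, t) : ℝ × ℝ)) (0, 1) t :=
      (hasDerivAt_const t s).prodMk (hasDerivAt_id t)
    exact hg.hasFDerivAt.comp_hasDerivAt t h2
  have hΓt : ∀ s ∈ Ioo (-ε) ε, ∀ t ∈ I, HasDerivAt (fun t => Γ (s, t)) (T (s, t)) t :=
    fun s hs t ht => hderiv_t ((hat hΓ s hs t ht).differentiableAt (by simp))
  -- the energy as an integral over `[a, b]`
  have hE : (fun s => curveEnergy ρ (fun t => Γ (s, t)) a b) =ᶠ[nhds 0]
      fun s => (1 / 2) * ∫ t in Icc a b, f (s, t) := by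
    filter_upwards [isOpen_Ioo.mem_nhds h0] with s hs
    unfold curveEnergy
    rw [intervalIntegral.integral_of_le hab.le, ← integral_Icc_eq_integral_Ioc]
    congr 1
    refine setIntegral_congr_fun measurableSet_Icc fun t ht => ?_
    simp only [f]
    rw [(hΓt s hs t (habI ht)).deriv, hρ _ (hΓO ⟨hs, habI ht⟩)]
  have hD := hasFDerivAt_setIntegral_of_contDiffOn (X := ℝ) (Y := ℝ) (μ := volume) (K := Icc a b)
    isCompact_Icc (by simp) hΩ hf (x₀ := 0) (fun t ht => ⟨h0, habI ht⟩)
  have hD' := hD.hasDerivAt.const_mul (1 / 2)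
  refine (hD'.congr_of_eventuallyEq hE).congr_deriv ?_
  congr 1
  rw [intervalIntegral.integral_of_le hab.le, ← integral_Icc_eq_integral_Ioc]
  rw [ContinuousLinearMap.integral_apply]
  · refine setIntegral_congr_fun measurableSet_Icc fun t ht => ?_
    have ht' := habI ht
    have hΓ0 := hat hΓ 0 h0 t ht'
    have hV : HasDerivAt (fun t => fderiv ℝ Γ (0, t) (1, 0))
        (fderiv ℝ (fderiv ℝ Γ) (0, t) (0, 1) (1, 0)) t := by
      have := hderiv_t ((hat hdΓ 0 h0 t ht').differentiableAt (by simp))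
      exact (this.clm_apply (hasDerivAt_const t ((1, 0) : ℝ × ℝ))).congr_deriv (by simp)
    -- The variation of the velocity is the velocity of the variation field.
    have hsymm : fderiv ℝ (fderiv ℝ Γ) (0, t) (0, 1) (1, 0) =
        fderiv ℝ (fderiv ℝ Γ) (0, t) (1, 0) (0, 1) :=
      (hΓ0.isSymmSndFDerivAt (by simpa using two_le_infty)).eq _ _
    have hTd : HasFDerivAt T ((fderiv ℝ (fderiv ℝ Γ) (0, t)).flip (0, 1)) (0, t) := by
      have h1 := ((hat hdΓ 0 h0 t ht').differentiableAt (by simp)).hasFDerivAt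
      have := h1.clm_apply (hasFDerivAt_const ((0, 1) : ℝ × ℝ) ((0, t) : ℝ × ℝ))
      exact this.congr_fderiv (by ext <;> simp)
    have hBd : HasFDerivAt (fun p => B (Γ p))
        ((fderiv ℝ B (Γ (0, t))).comp (fderiv ℝ Γ (0, t))) (0, t) := by
      have h1 : HasFDerivAt B (fderiv ℝ B (Γ (0, t))) (Γ (0, t)) :=
        ((hB.contDiffAt (hO.mem_nhds (hΓO ⟨h0, ht'⟩))).differentiableAt (by simp)).hasFDerivAt
      exact HasFDerivAt.comp (g := B) (f := Γ) (0, t) h1 (hΓ0.differentiableAt (by simp)).hasFDerivAt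
    have hfd := (hBd.clm_apply hTd).clm_apply hTd
    have : fderiv ℝ f (0, t) = _ := hfd.fderiv
    simp only [ContinuousLinearMap.comp_apply, ContinuousLinearMap.inl_apply, this]
    simp only [variationDensity, (hΓt 0 h0 t ht').deriv, hV.deriv, hsymm]
    simp [T]
    ring
  · have hc : ContinuousOn (fun y => (fderiv ℝ f (0, y)).comp (ContinuousLinearMap.inl ℝ ℝ ℝ))
        (Icc a b) := by
      refine ContinuousOn.clm_comp ?_ continuousOn_const
      refine (hf.continuousOn_fderiv_of_isOpen hΩ le_rfl).comp (by fun_prop) ?_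
      exact fun t ht => ⟨h0, habI ht⟩
    exact hc.integrableOn_compact isCompact_Icc

end FirstVariation

/-! ### Geodesics of matrix groups with a Riemannian metric -/

section LieSet

universe u

variable {E : Type u} [NormedRing E] [NormedAlgebra ℝ E]

/-- The properties of a Lie group `G` of invertible elements of an algebra, with Lie algebra `𝔤`,
that are used to study its geodesics. -/
structure IsLieSet (G : Set E) (𝔤 : Submodule ℝ E) : Prop where
  isUnit : ∀ g ∈ G, IsUnit g
  mul_exp : ∀ g ∈ G, ∀ X ∈ 𝔤, g * NormedSpace.exp X ∈ G
  velocity : ∀ (c : ℝ → E) (I : Set ℝ), IsOpen I → ContDiffOn ℝ ∞ c I → MapsTo c I G →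
    ∀ t ∈ I, Ring.inverse (c t) * deriv c t ∈ 𝔤

theorem variationDensity_congr {B : E → E →L[ℝ] E →L[ℝ] ℝ} {γ γ' V V' : ℝ → E} {t : ℝ}
    (h : γ =ᶠ[nhds t] γ') (hV : V =ᶠ[nhds t] V') :
    variationDensity B γ V t = variationDensity B γ' V' t := by
  simp only [variationDensity, h.eq_of_nhds, hV.eq_of_nhds, h.deriv_eq, hV.deriv_eq]

theorem hasDerivAt_comp_prodMk_left {Γ : ℝ × ℝ → E} {s t : ℝ} (h : DifferentiableAt ℝ Γ (s, t)) :
    HasDerivAt (fun s => Γ (s, t)) (fderiv ℝ Γ (s, t) (1, 0)) s := by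
  have h2 : HasDerivAt (fun s : ℝ => ((s, t) : ℝ × ℝ)) (1, 0) s :=
    (hasDerivAt_id s).prodMk (hasDerivAt_const s t)
  exact h.hasFDerivAt.comp_hasDerivAt s h2

theorem map_ringInverse_of_isUnit (σ : E →ₐ[ℝ] E) {g : E} (hg : IsUnit g) :
    σ (Ring.inverse g) = Ring.inverse (σ g) := by
  obtain ⟨u, rfl⟩ := hg
  have : σ (u : E) = ((Units.map (σ : E →* E) u : Eˣ) : E) := rfl
  rw [this, Ring.inverse_unit, Ring.inverse_unit]
  rfl

/-- For an isometric involution `σ` that fixes `γ`, the first variation along `γ` is invariant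
under `σ`. -/
theorem variationDensity_map [FiniteDimensional ℝ E] {ρ : E → E → E → ℝ}
    {B : E → E →L[ℝ] E →L[ℝ] ℝ} {O : Set E}
    (hO : IsOpen O) (hB : ContDiffOn ℝ 2 B O) (hρ : ∀ x ∈ O, ∀ v w, ρ x v w = B x v w)
    {σ : E →ₐ[ℝ] E} (hinv : ∀ x v w, ρ (σ x) (σ v) (σ w) = ρ x v w) {γ V : ℝ → E} {t : ℝ}
    (hγ : DifferentiableAt ℝ γ t) (hV : DifferentiableAt ℝ V t)
    (hfix : ∀ᶠ s in nhds t, σ (γ s) = γ s) (hγO : γ t ∈ O) :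
    variationDensity B γ (fun t => σ (V t)) t = variationDensity B γ V t := by
  let σL : E →L[ℝ] E := LinearMap.toContinuousLinearMap σ.toLinearMap
  have hγt : σ (γ t) = γ t := hfix.self_of_nhds
  have hdV : HasDerivAt (fun t => σ (V t)) (σ (deriv V t)) t :=
    σL.hasFDerivAt.comp_hasDerivAt t hV.hasDerivAt
  have hdγ : σ (deriv γ t) = deriv γ t := by
    have h : HasDerivAt (fun t => σ (γ t)) (σ (deriv γ t)) t :=
      σL.hasFDerivAt.comp_hasDerivAt t hγ.hasDerivAt
    rw [← h.deriv]
    exact Filter.EventuallyEq.deriv_eq hfix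
  have hBσ : ∀ v w, B (γ t) (σ v) (σ w) = B (γ t) v w := fun v w => by
    rw [← hρ _ hγO, ← hρ _ hγO, ← hinv (γ t) v w, hγt]
  have hBd : HasFDerivAt B (fderiv ℝ B (γ t)) (γ t) :=
    ((hB.contDiffAt (hO.mem_nhds hγO)).differentiableAt (by simp)).hasFDerivAt
  -- Invariance holds at all points near `γ t`, and `γ t` is fixed, so the identity can be
  -- differentiated there.
  have hDB : ∀ u v, fderiv ℝ B (γ t) (σ u) (σ v) (σ v) = fderiv ℝ B (γ t) u v v := by
    intro u v
    have h1 : HasFDerivAt (fun x => B x v v) _ (γ t) :=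
      (hBd.clm_apply (hasFDerivAt_const v (γ t))).clm_apply (hasFDerivAt_const v (γ t))
    have h2 : HasFDerivAt (fun x => B (σ x) (σ v) (σ v)) _ (γ t) :=
      ((HasFDerivAt.comp (g := B) (f := σL) (γ t)
        (by rw [show σL (γ t) = γ t from hγt]; exact hBd) σL.hasFDerivAt).clm_apply
        (hasFDerivAt_const (σ v) (γ t))).clm_apply (hasFDerivAt_const (σ v) (γ t))
    have heq : (fun x => B (σ x) (σ v) (σ v)) =ᶠ[nhds (γ t)] fun x => B x v v := by
      have hc : ContinuousAt (fun x => σ x) (γ t) := σL.continuous.continuousAt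
      have hm : ∀ᶠ x in nhds (γ t), σ x ∈ O :=
        hc.eventually (hO.mem_nhds (show σ (γ t) ∈ O by rwa [hγt]))
      filter_upwards [hm, hO.mem_nhds hγO] with x h1 h2
      rw [← hρ _ h1, ← hρ _ h2, hinv]
    have := (h2.congr_of_eventuallyEq heq.symm).unique h1
    have := congrArg (fun l => l u) this
    simpa [σL] using this
  simp only [variationDensity, hdV.deriv]
  congr 1
  · congr 1
    · conv_lhs => rw [← hdγ]
      exact hDB _ _
    · conv_lhs => rw [← hdγ]
      exact hBσ _ _
  · conv_lhs => rw [← hdγ]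
    exact hBσ _ _

variable [CompleteSpace E]

theorem contDiff_normedSpace_exp : ContDiff ℝ ∞ (NormedSpace.exp : E → E) :=
  contDiff_iff_contDiffAt.2 fun x => (NormedSpace.exp_analytic (𝕂 := ℝ) x).contDiffAt

theorem ContDiffOn.ringInverse {X : Type*} [NormedAddCommGroup X] [NormedSpace ℝ X] {γ : X → E}
    {I : Set X} (hγ : ContDiffOn ℝ ∞ γ I)
    (hu : ∀ t ∈ I, IsUnit (γ t)) : ContDiffOn ℝ ∞ (fun t => Ring.inverse (γ t)) I := by
  intro t ht
  obtain ⟨u, hu⟩ := hu t ht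
  have h := contDiffAt_ringInverse (n := ∞) ℝ u
  rw [hu] at h
  exact h.comp_contDiffWithinAt t (hγ t ht)

/-- The first variation vanishes along a geodesic, in the directions tangent to the group. -/
theorem IsGeodesicOn.integral_variationDensity_eq_zero {G : Set E} {𝔤 : Submodule ℝ E}
    (hG : IsLieSet G 𝔤) {ρ : E → E → E → ℝ} {B : E → E →L[ℝ] E →L[ℝ] ℝ} {O : Set E}
    (hO : IsOpen O) (hGO : G ⊆ O) (hB : ContDiffOn ℝ 2 B O)
    (hρ : ∀ x ∈ O, ∀ v w, ρ x v w = B x v w) {I : Set ℝ} (hI : IsOpen I) {γ : ℝ → E}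
    (hγ : IsGeodesicOn ρ G γ I) {a b : ℝ} (hab : a < b) (habI : Icc a b ⊆ I) {η : ℝ → E}
    (hη : ContDiffOn ℝ ∞ η I) (hη𝔤 : ∀ t ∈ I, η t ∈ 𝔤) (ha : η a = 0) (hb : η b = 0) :
    ∫ t in a..b, variationDensity B γ (fun t => γ t * η t) t = 0 := by
  -- The exponential realizes the field `γ η` by a variation inside the group, with fixed end points
  -- because `η` vanishes there.
  let Γ : ℝ × ℝ → E := fun p => γ p.2 * NormedSpace.exp (p.1 • η p.2)
  have hΓ : ContDiffOn ℝ ∞ Γ (Ioo (-1) 1 ×ˢ I) := by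
    have h1 : ContDiffOn ℝ ∞ (fun p : ℝ × ℝ => γ p.2) (Ioo (-1) 1 ×ˢ I) :=
      hγ.1.comp contDiffOn_snd fun p hp => hp.2
    have h2 : ContDiffOn ℝ ∞ (fun p : ℝ × ℝ => η p.2) (Ioo (-1) 1 ×ˢ I) :=
      hη.comp contDiffOn_snd fun p hp => hp.2
    exact h1.mul (contDiff_normedSpace_exp.comp_contDiffOn (contDiffOn_fst.smul h2))
  have hmaps : MapsTo Γ (Ioo (-1) 1 ×ˢ I) G := fun p hp =>
    hG.mul_exp _ (hγ.2.1 hp.2) _ (𝔤.smul_mem _ (hη𝔤 _ hp.2))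
  have hzero : ∀ t, Γ (0, t) = γ t := fun t => by simp [Γ, NormedSpace.exp_zero]
  have hcrit := hγ.2.2 a b hab habI 1 one_pos Γ hΓ hmaps (fun t _ => hzero t) fun s _ => by
    simp [Γ, ha, hb, NormedSpace.exp_zero]
  have hfv := hasDerivAt_curveEnergy hO hB hρ hI hab habI one_pos hΓ (fun p hp => hGO (hmaps hp))
  have h := hfv.unique hcrit
  have h' := (mul_eq_zero.1 h).resolve_left (by norm_num)
  rw [← h']
  refine intervalIntegral.integral_congr fun t ht => ?_
  rw [uIcc_of_le hab.le] at ht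
  refine variationDensity_congr (Filter.Eventually.of_forall fun t => (hzero t).symm) ?_
  filter_upwards [hI.mem_nhds (habI ht)] with t ht
  have hd : DifferentiableAt ℝ Γ (0, t) :=
    (hΓ.contDiffAt ((isOpen_Ioo.prod hI).mem_nhds ⟨by simp, ht⟩)).differentiableAt (by simp)
  have h1 : HasDerivAt (fun s : ℝ => Γ (s, t)) (fderiv ℝ Γ (0, t) (1, 0)) 0 :=
    hasDerivAt_comp_prodMk_left hd
  have h2 : HasDerivAt (fun s : ℝ => Γ (s, t)) (γ t * η t) 0 := by
    have := (hasDerivAt_exp_smul_const (𝕂 := ℝ) (η t) (0 : ℝ)).const_mul (γ t)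
    simpa [Γ, NormedSpace.exp_zero] using this
  exact h2.unique h1


/-- A geodesic of the fixed group of an isometric involution is a geodesic of the ambient group. -/
theorem IsGeodesicOn.of_fixed [FiniteDimensional ℝ E] {G N : Set E} {𝔤 𝔫 : Submodule ℝ E}
    (hG : IsLieSet G 𝔤) (hN : IsLieSet N 𝔫) (hNG : N ⊆ G)
    {ρ : E → E → E → ℝ} {B : E → E →L[ℝ] E →L[ℝ] ℝ} {O : Set E}
    (hO : IsOpen O) (hGO : G ⊆ O) (hB : ContDiffOn ℝ 2 B O)
    (hρ : ∀ x ∈ O, ∀ v w, ρ x v w = B x v w)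
    {σ : E →ₐ[ℝ] E} (hσ : ∀ x, σ (σ x) = x) (hinv : ∀ x v w, ρ (σ x) (σ v) (σ w) = ρ x v w)
    (hσN : ∀ x ∈ N, σ x = x) (hσ𝔤 : ∀ X ∈ 𝔤, σ X ∈ 𝔤) (h𝔫 : ∀ X ∈ 𝔤, σ X = X → X ∈ 𝔫)
    {I : Set ℝ} (hI : IsOpen I) {γ : ℝ → E} (hγ : IsGeodesicOn ρ N γ I) :
    IsGeodesicOn ρ G γ I := by
  refine ⟨hγ.1, fun t ht => hNG (hγ.2.1 ht), ?_⟩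
  intro a b hab habI ε hε Γ hΓ hmaps hΓ0 hend
  let σL : E →L[ℝ] E := LinearMap.toContinuousLinearMap σ.toLinearMap
  have hΩ : IsOpen (Ioo (-ε) ε ×ˢ I) := isOpen_Ioo.prod hI
  have h0 : (0 : ℝ) ∈ Ioo (-ε) ε := by constructor <;> linarith
  let V : ℝ → E := fun t => fderiv ℝ Γ (0, t) (1, 0)
  have hVs : ContDiffOn ℝ ∞ V I := by
    have h1 : ContDiffOn ℝ ∞ (fderiv ℝ Γ) (Ioo (-ε) ε ×ˢ I) := hΓ.fderiv_of_isOpen hΩ (by simp)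
    have h2 : ContDiffOn ℝ ∞ (fun t : ℝ => fderiv ℝ Γ (0, t)) I :=
      h1.comp (contDiffOn_const.prodMk contDiffOn_id) fun t ht => ⟨h0, ht⟩
    exact h2.clm_apply contDiffOn_const
  have hVd : ∀ t ∈ I, HasDerivAt (fun s => Γ (s, t)) (V t) 0 := fun t ht =>
    hasDerivAt_comp_prodMk_left
      ((hΓ.contDiffAt (hΩ.mem_nhds ⟨h0, ht⟩)).differentiableAt (by simp))
  have hV𝔤 : ∀ t ∈ I, Ring.inverse (γ t) * V t ∈ 𝔤 := fun t ht => by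
    have := hG.velocity (fun s => Γ (s, t)) (Ioo (-ε) ε) isOpen_Ioo
      (hΓ.comp (contDiffOn_id.prodMk contDiffOn_const) fun s hs => ⟨hs, ht⟩)
      (fun s hs => hmaps ⟨hs, ht⟩) 0 h0
    simpa only [(hVd t ht).deriv, hΓ0 t ht] using this
  have hVend : ∀ c ∈ I, (∀ s ∈ Ioo (-ε) ε, Γ (s, c) = γ c) → V c = 0 := fun c hc h => by
    have h1 : HasDerivAt (fun s => Γ (s, c)) 0 0 :=
      (hasDerivAt_const 0 (γ c)).congr_of_eventuallyEq
        (Filter.eventuallyEq_of_mem (isOpen_Ioo.mem_nhds h0) h)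
    exact (hVd c hc).unique h1
  have haI : a ∈ I := habI ⟨le_rfl, hab.le⟩
  have hbI : b ∈ I := habI ⟨hab.le, le_rfl⟩
  have hunit : ∀ t ∈ I, IsUnit (γ t) := fun t ht => hN.isUnit _ (hγ.2.1 ht)
  have hfix : ∀ t ∈ I, σ (γ t) = γ t := fun t ht => hσN _ (hγ.2.1 ht)
  -- The symmetric part of `V`. Its left translate is fixed by `σ`, hence lies in `𝔫`, so the
  -- criticality of `γ` in `N` applies to it; by linearity and invariance it has the same first
  -- variation as `V`.
  let W : ℝ → E := fun t => (1 / 2 : ℝ) • (V t + σ (V t))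
  have hσV : ContDiffOn ℝ ∞ (fun t => σ (V t)) I := σL.contDiff.comp_contDiffOn hVs
  have hW : ContDiffOn ℝ ∞ W I := (hVs.add hσV).const_smul (1 / 2 : ℝ)
  let η : ℝ → E := fun t => Ring.inverse (γ t) * W t
  have hη : ContDiffOn ℝ ∞ η I := (hγ.1.ringInverse hunit).mul hW
  have hη𝔫 : ∀ t ∈ I, η t ∈ 𝔫 := by
    intro t ht
    have e : η t = (1 / 2 : ℝ) • (Ring.inverse (γ t) * V t + σ (Ring.inverse (γ t) * V t)) := by
      simp only [η, W, map_mul, map_ringInverse_of_isUnit σ (hunit t ht), hfix t ht, mul_smul_comm,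
        mul_add]
    have hm : η t ∈ 𝔤 := by
      rw [e]
      exact 𝔤.smul_mem _ (𝔤.add_mem (hV𝔤 t ht) (hσ𝔤 _ (hV𝔤 t ht)))
    refine h𝔫 _ hm ?_
    rw [e, map_smul, map_add, hσ, add_comm]
  have hzero := hγ.integral_variationDensity_eq_zero hN hO (hNG.trans hGO) hB hρ hI hab habI hη hη𝔫
    (by simp [η, W, hVend a haI fun s hs => (hend s hs).1])
    (by simp [η, W, hVend b hbI fun s hs => (hend s hs).2])
  have hfv := hasDerivAt_curveEnergy hO hB hρ hI hab habI hε hΓ (fun p hp => hGO (hmaps hp))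
  refine hfv.congr_deriv ?_
  rw [show (∫ t in a..b, variationDensity B (fun t => Γ (0, t)) V t) = 0 from ?_, mul_zero]
  refine Eq.trans ?_ hzero
  refine intervalIntegral.integral_congr fun t ht => ?_
  rw [uIcc_of_le hab.le] at ht
  have htI := habI ht
  have hnI := hI.mem_nhds htI
  have hVt : DifferentiableAt ℝ V t := (hVs.contDiffAt hnI).differentiableAt (by simp)
  have hσVt : DifferentiableAt ℝ (fun t => σ (V t)) t :=
    (hσV.contDiffAt hnI).differentiableAt (by simp)
  have hγt : DifferentiableAt ℝ γ t := (hγ.1.contDiffAt hnI).differentiableAt (by simp)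
  have e1 : variationDensity B (fun t => Γ (0, t)) V t = variationDensity B γ V t :=
    variationDensity_congr (Filter.eventuallyEq_of_mem hnI hΓ0) Filter.EventuallyEq.rfl
  have e2 : variationDensity B γ (fun t => γ t * η t) t = variationDensity B γ W t := by
    refine variationDensity_congr Filter.EventuallyEq.rfl ?_
    filter_upwards [hnI] with s hs
    simp only [η]
    rw [← mul_assoc, Ring.mul_inverse_cancel _ (hunit s hs), one_mul]
  have e3 := variationDensity_map hO hB hρ hinv hγt hVt
    (Filter.eventually_of_mem hnI hfix) (hGO (hNG (hγ.2.1 htI)))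
  have e4 : variationDensity B γ W t =
      (1 / 2) * (variationDensity B γ V t + variationDensity B γ (fun t => σ (V t)) t) := by
    have hd : deriv W t = (1 / 2 : ℝ) • (deriv V t + deriv (fun t => σ (V t)) t) :=
      ((hVt.hasDerivAt.add hσVt.hasDerivAt).const_smul (1 / 2 : ℝ)).deriv
    simp only [variationDensity, hd]
    simp only [W, map_smul, map_add, smul_apply, add_apply,
      smul_eq_mul]
    ring
  simp only [e1, e2, e4, e3]
  ring

end LieSet

/-! ### The geodesic equation and uniqueness of geodesics -/

section GeodesicEquation

universe u

variable {E : Type u} [NormedRing E] [NormedAlgebra ℝ E]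

/-- The Euler–Lagrange equation of the energy, in the left trivialization. -/
theorem IsGeodesicOn.euler_lagrange [CompleteSpace E] {G : Set E} {𝔤 : Submodule ℝ E}
    (hG : IsLieSet G 𝔤) {ρ : E → E → E → ℝ} {B : E → E →L[ℝ] E →L[ℝ] ℝ} {O : Set E}
    (hO : IsOpen O) (hGO : G ⊆ O) (hB : ContDiffOn ℝ 2 B O)
    (hρ : ∀ x ∈ O, ∀ v w, ρ x v w = B x v w) (hsymm : ∀ x ∈ O, ∀ v w, B x v w = B x w v)
    {I : Set ℝ} (hI : IsOpen I) {γ : ℝ → E} (hγ : IsGeodesicOn ρ G γ I) {ζ : E} (hζ : ζ ∈ 𝔤)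
    {t : ℝ} (ht : t ∈ I) :
    HasDerivAt (fun t => B (γ t) (deriv γ t) (γ t * ζ))
      ((1 / 2) * fderiv ℝ B (γ t) (γ t * ζ) (deriv γ t) (deriv γ t) +
        B (γ t) (deriv γ t * ζ) (deriv γ t)) t := by
  have hγO : MapsTo γ I O := fun t ht => hGO (hγ.2.1 ht)
  have hγ' : ContDiffOn ℝ ∞ (deriv γ) I := hγ.1.deriv_of_isOpen hI (by simp)
  have h2 : ∀ {F : Type u} [NormedAddCommGroup F] [NormedSpace ℝ F] {f : ℝ → F},
      ContDiffOn ℝ ∞ f I → ContDiffOn ℝ 2 f I := fun hf => hf.of_le two_le_infty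
  have hBγ : ContDiffOn ℝ 2 (fun t => B (γ t)) I := hB.comp (h2 hγ.1) hγO
  have hγζ : ContDiffOn ℝ ∞ (fun t => γ t * ζ) I := hγ.1.mul contDiffOn_const
  let p : ℝ → ℝ := fun t => B (γ t) (deriv γ t) (γ t * ζ)
  have hp : ContDiffOn ℝ 2 p I := (hBγ.clm_apply (h2 hγ')).clm_apply (h2 hγζ)
  let f : ℝ → ℝ := fun t => (1 / 2) * fderiv ℝ B (γ t) (γ t * ζ) (deriv γ t) (deriv γ t) +
        B (γ t) (deriv γ t * ζ) (deriv γ t)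
  have hf : ContinuousOn f I := by
    have hDB : ContinuousOn (fun t => fderiv ℝ B (γ t)) I :=
      (hB.continuousOn_fderiv_of_isOpen hO (by norm_num)).comp hγ.1.continuousOn hγO
    have hc := hγ'.continuousOn
    exact (continuousOn_const.mul (((hDB.clm_apply hγζ.continuousOn).clm_apply hc).clm_apply
      hc)).add ((hBγ.continuousOn.clm_apply (hc.mul continuousOn_const)).clm_apply hc)
  have hdp : ContinuousOn (deriv p) I := hp.continuousOn_deriv_of_isOpen hI (by norm_num)
  obtain ⟨r, hr, hball⟩ := Metric.isOpen_iff.1 hI t ht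
  have habI : Icc (t - r / 2) (t + r / 2) ⊆ I := by
    refine Subset.trans (fun s hs => ?_) hball
    rw [Metric.mem_ball, Real.dist_eq, abs_lt]
    constructor <;> linarith [hs.1, hs.2]
  set a := t - r / 2 with ha
  set b := t + r / 2 with hb
  have hab : a < b := by linarith
  -- Fundamental lemma of the calculus of variations, tested on the fields `φ ζ` with `φ` compactly
  -- supported in the interval. Continuity then upgrades the equality to every point.
  have hae : ∀ᵐ s, s ∈ Ioo a b → f s - deriv p s = 0 := by
    refine isOpen_Ioo.ae_eq_zero_of_integral_contDiff_smul_eq_zero ?_ ?_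
    · exact ((hf.sub hdp).mono (Ioo_subset_Icc_self.trans habI)).locallyIntegrableOn
        measurableSet_Ioo
    intro φ hφ hφc hφs
    have hout : ∀ s, s ∉ Ioo a b → φ s = 0 := fun s hs => by
      by_contra h
      exact hs (hφs (subset_tsupport φ h))
    have hφ0 : φ a = 0 := hout a (by simp)
    have hφ1 : φ b = 0 := hout b (by simp)
    have hz := hγ.integral_variationDensity_eq_zero hG hO hGO hB hρ hI hab habI
      (η := fun s => φ s • ζ) (hφ.contDiffOn.smul contDiffOn_const)
      (fun s _ => 𝔤.smul_mem _ hζ) (by simp [hφ0]) (by simp [hφ1])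
    have hdφ : Continuous (deriv φ) := hφ.continuous_deriv (by simp)
    have hpart : ∫ s in a..b, (φ s * deriv p s + deriv φ s * p s) = 0 := by
      have := intervalIntegral.integral_deriv_mul_eq_sub (a := a) (b := b) (u := φ) (v := p)
        (u' := deriv φ) (v' := deriv p)
        (fun s _ => (hφ.differentiable (by simp) s).hasDerivAt)
        (fun s hs => by
          rw [uIcc_of_le hab.le] at hs
          exact ((hp.contDiffAt (hI.mem_nhds (habI hs))).differentiableAt (by simp)).hasDerivAt)
        (hdφ.intervalIntegrable _ _)
        (ContinuousOn.intervalIntegrable (by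
          rw [uIcc_of_le hab.le]; exact hdp.mono habI))
      rw [hφ0, hφ1] at this
      simpa [add_comm] using this
    -- The factor 2 comes from the two slots of the symmetric form `B`; the factor 1/2 in `f`
    -- compensates for it in the term with the derivative of `B`.
    have hvar : ∫ s in a..b, (2 * (φ s * f s + deriv φ s * p s)) = 0 := by
      rw [← hz]
      refine intervalIntegral.integral_congr fun s hs => ?_
      rw [uIcc_of_le hab.le] at hs
      have hs' := habI hs
      have hγd : HasDerivAt γ (deriv γ s) s :=
        ((hγ.1.contDiffAt (hI.mem_nhds hs')).differentiableAt (by simp)).hasDerivAt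
      have hφd : HasDerivAt φ (deriv φ s) s := (hφ.differentiable (by simp) s).hasDerivAt
      have hVd : HasDerivAt (fun s => γ s * φ s • ζ)
          (deriv γ s * φ s • ζ + γ s * deriv φ s • ζ) s := hγd.mul (hφd.smul_const ζ)
      simp only [variationDensity, hVd.deriv, f, p]
      rw [hsymm _ (hγO hs') (deriv γ s) (deriv γ s * φ s • ζ + γ s * deriv φ s • ζ)]
      simp only [mul_smul_comm, map_add, map_smul, smul_apply, add_apply, smul_eq_mul]
      rw [hsymm _ (hγO hs') (deriv γ s) (γ s * ζ)]
      ring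
    have hi1 : IntervalIntegrable (fun s => 2 * (φ s * f s + deriv φ s * p s)) volume a b := by
      refine ContinuousOn.intervalIntegrable ?_
      rw [uIcc_of_le hab.le]
      exact continuousOn_const.mul ((hφ.continuous.continuousOn.mul (hf.mono habI)).add
        (hdφ.continuousOn.mul (hp.continuousOn.mono habI)))
    have hi2 : IntervalIntegrable (fun s => 2 * (φ s * deriv p s + deriv φ s * p s))
        volume a b := by
      refine ContinuousOn.intervalIntegrable ?_
      rw [uIcc_of_le hab.le]
      exact continuousOn_const.mul ((hφ.continuous.continuousOn.mul (hdp.mono habI)).add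
        (hdφ.continuousOn.mul (hp.continuousOn.mono habI)))
    rw [← intervalIntegral.integral_eq_integral_of_support_subset (a := a) (b := b)]
    · have h3 : ∫ s in a..b, (2 * (φ s * f s + deriv φ s * p s) -
          2 * (φ s * deriv p s + deriv φ s * p s)) = 0 := by
        rw [intervalIntegral.integral_sub hi1 hi2, hvar, intervalIntegral.integral_const_mul, hpart]
        simp
      have h4 : ∫ s in a..b, 2 * (φ s • (f s - deriv p s)) = 0 := by
        rw [← h3]
        refine intervalIntegral.integral_congr fun s _ => ?_
        simp only [smul_eq_mul]
        ring
      rw [intervalIntegral.integral_const_mul] at h4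
      exact (mul_eq_zero.1 h4).resolve_left two_ne_zero
    · intro s hs
      by_contra h
      refine hs ?_
      simp [hout s fun h' => h (Ioo_subset_Ioc_self h')]
  have heq : EqOn f (deriv p) (Ioo a b) := by
    refine Measure.eqOn_open_of_ae_eq (μ := volume) ?_ isOpen_Ioo
      (hf.mono (Ioo_subset_Icc_self.trans habI)) (hdp.mono (Ioo_subset_Icc_self.trans habI))
    rw [Filter.EventuallyEq, ae_restrict_iff' measurableSet_Ioo]
    filter_upwards [hae] with s hs hs'
    exact sub_eq_zero.1 (hs hs')
  have hpd : HasDerivAt p (deriv p t) t :=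
    ((hp.contDiffAt (hI.mem_nhds ht)).differentiableAt (by simp)).hasDerivAt
  rw [← heq (show t ∈ Ioo a b by constructor <;> linarith)] at hpd
  exact hpd

variable (𝔤 : Submodule ℝ E)

/-- Left multiplication by an element of the algebra, restricted to `𝔤`. -/
def mulLeftOn : E →L[ℝ] 𝔤 →L[ℝ] E :=
  ((ContinuousLinearMap.compL ℝ 𝔤 E E).flip 𝔤.subtypeL).comp (ContinuousLinearMap.mul ℝ E)

@[simp]
theorem mulLeftOn_apply (x : E) (ζ : 𝔤) : mulLeftOn 𝔤 x ζ = x * (ζ : E) := rfl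

/-- The metric in the left trivialization. -/
def leftForm (B : E → E →L[ℝ] E →L[ℝ] ℝ) (x : E) : 𝔤 →L[ℝ] 𝔤 →L[ℝ] ℝ :=
  ((B x).comp (mulLeftOn 𝔤 x)).flip.comp (mulLeftOn 𝔤 x)

/-- The right-hand side of the Euler–Lagrange equation. -/
def geodesicForce (B : E → E →L[ℝ] E →L[ℝ] ℝ) (x v : E) : 𝔤 →L[ℝ] ℝ :=
  (1 / 2 : ℝ) • (((fderiv ℝ B x).flip v).flip v).comp (mulLeftOn 𝔤 x) +
    ((B x).flip v).comp (mulLeftOn 𝔤 v)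

/-- The momentum of a curve in the left trivialization. -/
def leftMomentum (B : E → E →L[ℝ] E →L[ℝ] ℝ) (γ : ℝ → E) (t : ℝ) : 𝔤 →L[ℝ] ℝ :=
  (B (γ t) (deriv γ t)).comp (mulLeftOn 𝔤 (γ t))

/-- The Hamiltonian vector field whose integral curves are the geodesics. -/
def geodesicField (B : E → E →L[ℝ] E →L[ℝ] ℝ) (q : E × (𝔤 →L[ℝ] ℝ)) : E × (𝔤 →L[ℝ] ℝ) :=
  (mulLeftOn 𝔤 q.1 ((leftForm 𝔤 B q.1).inverse q.2),
    geodesicForce 𝔤 B q.1 (mulLeftOn 𝔤 q.1 ((leftForm 𝔤 B q.1).inverse q.2)))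

theorem ContDiffAt.clm_flip {X F₁ F₂ F₃ : Type*} [NormedAddCommGroup X] [NormedSpace ℝ X]
    [NormedAddCommGroup F₁] [NormedSpace ℝ F₁] [NormedAddCommGroup F₂] [NormedSpace ℝ F₂]
    [NormedAddCommGroup F₃] [NormedSpace ℝ F₃] {n : WithTop ℕ∞} {f : X → F₁ →L[ℝ] F₂ →L[ℝ] F₃}
    {x : X} (hf : ContDiffAt ℝ n f x) : ContDiffAt ℝ n (fun x => (f x).flip) x :=
  (ContinuousLinearMap.flipₗᵢ ℝ F₁ F₂ F₃).contDiff.contDiffAt.comp x hf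

/-- The force contains one derivative of `B`, so class C² of `B` is what leaves a C¹, hence locally
Lipschitz, field. Inversion is smooth at an invertible form. -/
theorem contDiffAt_geodesicField [FiniteDimensional ℝ E] {B : E → E →L[ℝ] E →L[ℝ] ℝ}
    {q : E × (𝔤 →L[ℝ] ℝ)}
    (hB : ContDiffAt ℝ 2 B q.1) (hinv : (leftForm 𝔤 B q.1).IsInvertible) :
    ContDiffAt ℝ 1 (geodesicField 𝔤 B) q := by
  have hB1 : ContDiffAt ℝ 1 (fun q : E × (𝔤 →L[ℝ] ℝ) => B q.1) q :=
    ContDiffAt.comp q (hB.of_le (by norm_num)) contDiffAt_fst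
  have hDB : ContDiffAt ℝ 1 (fun q : E × (𝔤 →L[ℝ] ℝ) => fderiv ℝ B q.1) q :=
    ContDiffAt.comp (g := fderiv ℝ B) q (hB.fderiv_right (by norm_num)) contDiffAt_fst
  have hm : ContDiffAt ℝ 1 (fun q : E × (𝔤 →L[ℝ] ℝ) => mulLeftOn 𝔤 q.1) q :=
    (mulLeftOn 𝔤).contDiff.contDiffAt.comp q contDiffAt_fst
  have hL : ContDiffAt ℝ 1 (fun q : E × (𝔤 →L[ℝ] ℝ) => leftForm 𝔤 B q.1) q :=
    (hB1.clm_comp hm).clm_flip.clm_comp hm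
  have hLi : ContDiffAt ℝ 1 (fun q : E × (𝔤 →L[ℝ] ℝ) => (leftForm 𝔤 B q.1).inverse) q :=
    ContDiffAt.comp (g := ContinuousLinearMap.inverse) q hinv.contDiffAt_map_inverse hL
  have hv : ContDiffAt ℝ 1 (fun q : E × (𝔤 →L[ℝ] ℝ) =>
      mulLeftOn 𝔤 q.1 ((leftForm 𝔤 B q.1).inverse q.2)) q :=
    hm.clm_apply (hLi.clm_apply contDiffAt_snd)
  have hmv : ContDiffAt ℝ 1 (fun q : E × (𝔤 →L[ℝ] ℝ) =>
      mulLeftOn 𝔤 (mulLeftOn 𝔤 q.1 ((leftForm 𝔤 B q.1).inverse q.2))) q :=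
    (mulLeftOn 𝔤).contDiff.contDiffAt.comp q hv
  refine hv.prodMk (ContDiffAt.add (ContDiffAt.const_smul _ ?_) ?_)
  · exact ((hDB.clm_flip.clm_apply hv).clm_flip.clm_apply hv).clm_comp hm
  · exact (hB1.clm_flip.clm_apply hv).clm_comp hmv

/-- Definiteness makes the form injective as a map to the dual, which has the same dimension. -/
theorem isInvertible_leftForm [FiniteDimensional ℝ E] {B : E → E →L[ℝ] E →L[ℝ] ℝ} {x : E}
    (hB : ∀ ξ ∈ 𝔤, B x (x * ξ) (x * ξ) = 0 → ξ = 0) : (leftForm 𝔤 B x).IsInvertible := by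
  have hinj : Function.Injective (leftForm 𝔤 B x : 𝔤 →ₗ[ℝ] 𝔤 →L[ℝ] ℝ) := by
    refine (injective_iff_map_eq_zero _).2 fun ξ hξ => Subtype.ext (hB ξ ξ.2 ?_)
    have := congrArg (fun l : 𝔤 →L[ℝ] ℝ => l ξ) hξ
    simpa [leftForm] using this
  have hdim : Module.finrank ℝ 𝔤 = Module.finrank ℝ (𝔤 →L[ℝ] ℝ) := by
    rw [← (LinearMap.toContinuousLinearMap : (𝔤 →ₗ[ℝ] ℝ) ≃ₗ[ℝ] (𝔤 →L[ℝ] ℝ)).finrank_eq]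
    exact (Subspace.dual_finrank_eq (K := ℝ) (V := 𝔤)).symm
  refine ⟨(LinearEquiv.ofInjectiveOfFinrankEq _ hinj hdim).toContinuousLinearEquiv, ?_⟩
  ext
  rfl

/-- Legendre transform: the velocity is recovered from the momentum by inverting the form, and the
Euler–Lagrange equation gives the derivative of the momentum. In the left trivialization the state
space is the vector space `E × 𝔤*`, so no charts of the group are needed. -/
theorem IsGeodesicOn.hasDerivAt_geodesicField [CompleteSpace E] [FiniteDimensional ℝ E] {G : Set E}
    {𝔤 : Submodule ℝ E}
    (hG : IsLieSet G 𝔤) {ρ : E → E → E → ℝ} {B : E → E →L[ℝ] E →L[ℝ] ℝ} {O : Set E}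
    (hO : IsOpen O) (hGO : G ⊆ O) (hB : ContDiffOn ℝ 2 B O)
    (hρ : ∀ x ∈ O, ∀ v w, ρ x v w = B x v w) (hsymm : ∀ x ∈ O, ∀ v w, B x v w = B x w v)
    (hpos : ∀ g ∈ G, ∀ ξ ∈ 𝔤, B g (g * ξ) (g * ξ) = 0 → ξ = 0)
    {I : Set ℝ} (hI : IsOpen I) {γ : ℝ → E} (hγ : IsGeodesicOn ρ G γ I)
    {t : ℝ} (ht : t ∈ I) :
    HasDerivAt (fun t => (γ t, leftMomentum 𝔤 B γ t))
      (geodesicField 𝔤 B (γ t, leftMomentum 𝔤 B γ t)) t := by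
  have hγO : MapsTo γ I O := fun t ht => hGO (hγ.2.1 ht)
  have hγ' : ContDiffOn ℝ ∞ (deriv γ) I := hγ.1.deriv_of_isOpen hI (by simp)
  have hγt : HasDerivAt γ (deriv γ t) t :=
    ((hγ.1.contDiffAt (hI.mem_nhds ht)).differentiableAt (by simp)).hasDerivAt
  have hinvL := isInvertible_leftForm 𝔤 (hpos (γ t) (hγ.2.1 ht))
  let ξ : 𝔤 := ⟨Ring.inverse (γ t) * deriv γ t, hG.velocity γ I hI hγ.1 hγ.2.1 t ht⟩
  have hξ : γ t * (ξ : E) = deriv γ t := by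
    simp only [ξ]
    rw [← mul_assoc, Ring.mul_inverse_cancel _ (hG.isUnit _ (hγ.2.1 ht)), one_mul]
  have hmom : leftMomentum 𝔤 B γ t = leftForm 𝔤 B (γ t) ξ := by
    ext ζ
    simp only [leftMomentum, leftForm, ContinuousLinearMap.comp_apply, mulLeftOn_apply,
      ContinuousLinearMap.flip_apply, hξ]
    exact hsymm _ (hγO ht) _ _
  have hinv : (leftForm 𝔤 B (γ t)).inverse (leftMomentum 𝔤 B γ t) = ξ := by
    rw [hmom]
    obtain ⟨e, he⟩ := hinvL
    rw [← he, ContinuousLinearMap.inverse_equiv]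
    exact e.symm_apply_apply ξ
  have hfield : geodesicField 𝔤 B (γ t, leftMomentum 𝔤 B γ t) =
      (deriv γ t, geodesicForce 𝔤 B (γ t) (deriv γ t)) := by
    simp only [geodesicField, hinv, mulLeftOn_apply, hξ]
  rw [hfield]
  refine hγt.prodMk ?_
  have hmd : DifferentiableAt ℝ (leftMomentum 𝔤 B γ) t := by
    have h1 : ContDiffAt ℝ 2 (fun t => B (γ t)) t :=
      ContDiffAt.comp t (hB.contDiffAt (hO.mem_nhds (hγO ht)))
        ((hγ.1.contDiffAt (hI.mem_nhds ht)).of_le two_le_infty)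
    have h2 : ContDiffAt ℝ 2 (deriv γ) t := (hγ'.contDiffAt (hI.mem_nhds ht)).of_le two_le_infty
    have h3 : ContDiffAt ℝ 2 (fun t => mulLeftOn 𝔤 (γ t)) t :=
      (mulLeftOn 𝔤).contDiff.contDiffAt.comp t
        ((hγ.1.contDiffAt (hI.mem_nhds ht)).of_le two_le_infty)
    exact ((h1.clm_apply h2).clm_comp h3).differentiableAt (by simp)
  have hval : deriv (leftMomentum 𝔤 B γ) t = geodesicForce 𝔤 B (γ t) (deriv γ t) := by
    ext ζ
    have h1 : HasDerivAt (fun t => leftMomentum 𝔤 B γ t ζ) (deriv (leftMomentum 𝔤 B γ) t ζ) t := by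
      simpa using hmd.hasDerivAt.clm_apply (hasDerivAt_const t ζ)
    have h2 := hγ.euler_lagrange hG hO hGO hB hρ hsymm hI ζ.2 ht
    rw [h1.unique h2]
    simp [geodesicForce]
  rw [← hval]
  exact hmd.hasDerivAt

/-- Geodesics are determined by their position and velocity at an instant. -/
theorem IsGeodesicOn.eqOn [CompleteSpace E] [FiniteDimensional ℝ E] {G : Set E} {𝔤 : Submodule ℝ E}
    (hG : IsLieSet G 𝔤) {ρ : E → E → E → ℝ} {B : E → E →L[ℝ] E →L[ℝ] ℝ} {O : Set E}
    (hO : IsOpen O) (hGO : G ⊆ O) (hB : ContDiffOn ℝ 2 B O)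
    (hρ : ∀ x ∈ O, ∀ v w, ρ x v w = B x v w) (hsymm : ∀ x ∈ O, ∀ v w, B x v w = B x w v)
    (hpos : ∀ g ∈ G, ∀ ξ ∈ 𝔤, B g (g * ξ) (g * ξ) = 0 → ξ = 0)
    {I : Set ℝ} (hI : IsOpen I) (hIc : I.OrdConnected) {γ₁ γ₂ : ℝ → E}
    (h₁ : IsGeodesicOn ρ G γ₁ I) (h₂ : IsGeodesicOn ρ G γ₂ I) {t₀ : ℝ} (ht₀ : t₀ ∈ I)
    (hx : γ₁ t₀ = γ₂ t₀) (hv : deriv γ₁ t₀ = deriv γ₂ t₀) : EqOn γ₁ γ₂ I := by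
  let z : (ℝ → E) → ℝ → E × (𝔤 →L[ℝ] ℝ) := fun γ t => (γ t, leftMomentum 𝔤 B γ t)
  have hz₁ : ∀ t ∈ I, HasDerivAt (z γ₁) (geodesicField 𝔤 B (z γ₁ t)) t := fun t ht =>
    h₁.hasDerivAt_geodesicField hG hO hGO hB hρ hsymm hpos hI ht
  have hz₂ : ∀ t ∈ I, HasDerivAt (z γ₂) (geodesicField 𝔤 B (z γ₂ t)) t := fun t ht =>
    h₂.hasDerivAt_geodesicField hG hO hGO hB hρ hsymm hpos hI ht
  -- Local uniqueness for the C¹ field, at any time at which the two states agree.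
  have hloc : ∀ t ∈ I, z γ₁ t = z γ₂ t → z γ₁ =ᶠ[nhds t] z γ₂ := by
    intro t ht heq
    have hmem := h₁.2.1 ht
    have hC : ContDiffAt ℝ 1 (geodesicField 𝔤 B) (z γ₁ t) :=
      contDiffAt_geodesicField 𝔤 (hB.contDiffAt (hO.mem_nhds (hGO hmem)))
        (isInvertible_leftForm 𝔤 (hpos _ hmem))
    obtain ⟨K, s, hs, hLip⟩ := hC.exists_lipschitzOnWith
    refine ODE_solution_unique_of_eventually (v := fun _ => geodesicField 𝔤 B) (s := fun _ => s)
      (K := K) (Filter.Eventually.of_forall fun _ => hLip) ?_ ?_ heq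
    · filter_upwards [hI.mem_nhds ht, (hz₁ t ht).continuousAt.eventually hs] with u hu hu'
      exact ⟨hz₁ u hu, hu'⟩
    · filter_upwards [hI.mem_nhds ht,
        (hz₂ t ht).continuousAt.eventually (heq ▸ hs)] with u hu hu'
      exact ⟨hz₂ u hu, hu'⟩
  -- The times near which the states agree form an open set, also closed in `I`: at a limit point
  -- the states agree by continuity and `hloc` applies. As `I` is connected, the set contains it.
  let U : Set ℝ := {t | ∀ᶠ u in nhds t, z γ₁ u = z γ₂ u}
  have hU : IsOpen U := isOpen_iff_mem_nhds.2 fun t ht => eventually_eventually_nhds.2 ht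
  have hsub : I ⊆ U := by
    refine hIc.isPreconnected.subset_of_closure_inter_subset hU ⟨t₀, ht₀, ?_⟩ ?_
    · refine hloc t₀ ht₀ ?_
      simp only [z, leftMomentum, hx, hv]
    · rintro t ⟨htc, htI⟩
      refine hloc t htI ?_
      have hcl : ∃ᶠ u in nhds t, z γ₁ u = z γ₂ u :=
        (mem_closure_iff_frequently.1 htc).mono fun u hu => hu.self_of_nhds
      by_contra hne
      exact hcl (((hz₁ t htI).continuousAt.ne_iff_eventually_ne (hz₂ t htI).continuousAt).1 hne)
  intro t ht
  exact congrArg Prod.fst (hsub ht).self_of_nhds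

end GeodesicEquation

/-! ### Fixed groups of isometric involutions are totally geodesic -/

section Involution

universe u

variable {E : Type u} [NormedRing E] [NormedAlgebra ℝ E]

/-- A geodesic of `G` that stays in `N'` is a geodesic of `N'`, because variations in `N'` are
variations in `G`. This needs the same `ρ` throughout: the intermediate group carries the induced
metric. -/
theorem IsTotallyGeodesic.trans {ρ : E → E → E → ℝ} {N N' G : Set E}
    (h₁ : IsTotallyGeodesic ρ N N') (h₂ : IsTotallyGeodesic ρ N' G) : IsTotallyGeodesic ρ N G where
  subset := h₁.subset.trans h₂.subset
  submanifold := h₁.submanifold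
  geodesic_of_geodesic I γ hI hIc hγ :=
    h₂.geodesic_of_geodesic I γ hI hIc (h₁.geodesic_of_geodesic I γ hI hIc hγ)
  remains I γ hI hIc hγ t₀ ht₀ hx hv := by
    obtain ⟨c, hc, hcN, hc0, hcv⟩ := hv
    have hmem := h₂.remains I γ hI hIc hγ t₀ ht₀ (h₁.subset hx)
      ⟨c, hc, fun t => h₁.subset (hcN t), hc0, hcv⟩
    refine h₁.remains I γ hI hIc ⟨hγ.1, hmem, ?_⟩ t₀ ht₀ hx ⟨c, hc, hcN, hc0, hcv⟩
    intro a b hab habI ε hε Γ hΓ hΓN h0 hend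
    exact hγ.2.2 a b hab habI ε hε Γ hΓ (fun p hp => h₂.subset (hΓN hp)) h0 hend

/-- `ρ` is a Riemannian metric on the group `G` with Lie algebra `𝔤`, of class `C²` on a
neighbourhood of `G`. -/
structure IsRiemannianOn (ρ : E → E → E → ℝ) (G : Set E) (𝔤 : Submodule ℝ E) : Prop where
  exists_smooth : ∃ (O : Set E) (B : E → E →L[ℝ] E →L[ℝ] ℝ), IsOpen O ∧ G ⊆ O ∧
    ContDiffOn ℝ 2 B O ∧ ∀ x ∈ O, ∀ v w, ρ x v w = B x v w
  symm : ∀ x v w, ρ x v w = ρ x w v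
  definite : ∀ g ∈ G, ∀ ξ ∈ 𝔤, ρ g (g * ξ) (g * ξ) = 0 → ξ = 0

theorem IsRiemannianOn.mono {ρ : E → E → E → ℝ} {G N : Set E} {𝔤 𝔫 : Submodule ℝ E}
    (h : IsRiemannianOn ρ G 𝔤) (hN : N ⊆ G) (h𝔫 : 𝔫 ≤ 𝔤) : IsRiemannianOn ρ N 𝔫 where
  exists_smooth := by
    obtain ⟨O, B, h1, h2, h3⟩ := h.exists_smooth
    exact ⟨O, B, h1, hN.trans h2, h3⟩
  symm := h.symm
  definite g hg ξ hξ := h.definite g (hN hg) ξ (h𝔫 hξ)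

variable [FiniteDimensional ℝ E] {σ : E →ₐ[ℝ] E}

/-- No differentiability is needed: `σ` is invertible, so `σ ∘ f` fails to be differentiable when
`f` does, and both derivatives take the default value 0. The energies below are thus equal for all
curves. -/
theorem deriv_map_involution (hσ : ∀ x, σ (σ x) = x) (f : ℝ → E) (t : ℝ) :
    deriv (fun t => σ (f t)) t = σ (deriv f t) := by
  let σL : E →L[ℝ] E := LinearMap.toContinuousLinearMap σ.toLinearMap
  by_cases hf : DifferentiableAt ℝ f t
  · exact (σL.hasFDerivAt.comp_hasDerivAt t hf.hasDerivAt).deriv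
  · rw [deriv_zero_of_not_differentiableAt hf, map_zero, deriv_zero_of_not_differentiableAt]
    intro h
    refine hf ?_
    have : DifferentiableAt ℝ (fun t => σL (σ (f t))) t := σL.differentiableAt.comp t h
    simpa [σL, hσ] using this

/-- The involution turns variations of `σ ∘ γ` into variations of `γ` with the same energy. -/
theorem IsGeodesicOn.map_involution {ρ : E → E → E → ℝ} {G : Set E} (hσ : ∀ x, σ (σ x) = x)
    (hinv : ∀ x v w, ρ (σ x) (σ v) (σ w) = ρ x v w) (hσG : ∀ x ∈ G, σ x ∈ G)
    {γ : ℝ → E} {I : Set ℝ} (hγ : IsGeodesicOn ρ G γ I) :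
    IsGeodesicOn ρ G (fun t => σ (γ t)) I := by
  let σL : E →L[ℝ] E := LinearMap.toContinuousLinearMap σ.toLinearMap
  refine ⟨σL.contDiff.comp_contDiffOn hγ.1, fun t ht => hσG _ (hγ.2.1 ht), ?_⟩
  intro a b hab habI ε hε Γ hΓ hΓN h0 hend
  have h := hγ.2.2 a b hab habI ε hε (fun p => σ (Γ p)) (σL.contDiff.comp_contDiffOn hΓ)
    (fun p hp => hσG _ (hΓN hp)) (fun t ht => by simp only [h0 t ht, hσ])
    (fun s hs => by simp only [(hend s hs).1, (hend s hs).2, hσ, and_self])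
  have e : (fun s => curveEnergy ρ (fun t => σ (Γ (s, t))) a b) =
      fun s => curveEnergy ρ (fun t => Γ (s, t)) a b := by
    funext s
    simp only [curveEnergy, deriv_map_involution hσ, hinv]
  rwa [e] at h

/-- If an isometric involution `σ` of `G` fixes a group `N` which is a union of components of the
fixed group of `σ`, then `N` is totally geodesic. -/
theorem isTotallyGeodesic_of_involution [CompleteSpace E] {ρ : E → E → E → ℝ} {G N : Set E}
    {𝔤 𝔫 : Submodule ℝ E} (hG : IsLieSet G 𝔤) (hN : IsLieSet N 𝔫) (hNG : N ⊆ G)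
    (hNs : IsEmbeddedSubmanifold N) (hρ : IsRiemannianOn ρ G 𝔤)
    (hσ : ∀ x, σ (σ x) = x) (hinv : ∀ x v w, ρ (σ x) (σ v) (σ w) = ρ x v w)
    (hσG : ∀ x ∈ G, σ x ∈ G) (hσN : ∀ x ∈ N, σ x = x) (hσ𝔤 : ∀ X ∈ 𝔤, σ X ∈ 𝔤)
    (h𝔫 : ∀ X ∈ 𝔤, σ X = X → X ∈ 𝔫)
    (hcomp : ∀ T ⊆ G, (∀ x ∈ T, σ x = x) → IsPreconnected T → (T ∩ N).Nonempty → T ⊆ N) :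
    IsTotallyGeodesic ρ N G := by
  obtain ⟨O, B, hO, hGO, hB, hρB⟩ := hρ.exists_smooth
  refine ⟨hNG, hNs, fun I γ hI _ hγ =>
    hγ.of_fixed hG hN hNG hO hGO hB hρB hσ hinv hσN hσ𝔤 h𝔫 hI, ?_⟩
  intro I γ hI hIc hγ t₀ ht₀ hx ⟨c, hc, hcN, hc0, hcv⟩ t ht
  -- The velocity is also that of a curve `c` in `N`, on which `σ` is the identity.
  have hv : deriv (fun t => σ (γ t)) t₀ = deriv γ t₀ := by
    rw [deriv_map_involution hσ, ← hcv, ← deriv_map_involution hσ]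
    congr 1
    funext s
    exact hσN _ (hcN s)
  have heq : EqOn (fun t => σ (γ t)) γ I :=
    (hγ.map_involution hσ hinv hσG).eqOn hG hO hGO hB hρB
      (fun x hx v w => by rw [← hρB x hx, ← hρB x hx, hρ.symm])
      (fun g hg ξ hξ h => hρ.definite g hg ξ hξ (by rw [hρB g (hGO hg), h]))
      hI hIc hγ ht₀ (hσN _ hx) hv
  refine hcomp (γ '' I) ?_ ?_ ?_ ⟨γ t₀, ⟨t₀, ht₀, rfl⟩, hx⟩ ⟨t, ht, rfl⟩
  · rintro _ ⟨s, hs, rfl⟩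
    exact hγ.2.1 hs
  · rintro _ ⟨s, hs, rfl⟩
    exact heq hs
  · exact hIc.isPreconnected.image γ hγ.1.continuousOn

end Involution

/-! ### Groups defined by an anti-involution -/

section ComponentUnion

variable {X : Type*} [TopologicalSpace X]

/-- `N` is a union of connected components of `A`. -/
def IsComponentUnion (A N : Set X) : Prop :=
  N ⊆ A ∧ ∀ T ⊆ A, IsPreconnected T → (T ∩ N).Nonempty → T ⊆ N

theorem isComponentUnion_self (A : Set X) : IsComponentUnion A A :=
  ⟨Subset.rfl, fun _ h _ _ => h⟩

theorem isComponentUnion_connectedComponentIn (A : Set X) (x : X) :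
    IsComponentUnion A (connectedComponentIn A x) :=
  ⟨connectedComponentIn_subset A x, fun T hTA hT ⟨y, hyT, hy⟩ => by
    rw [connectedComponentIn_eq hy]
    exact hT.subset_connectedComponentIn hyT hTA⟩

theorem mem_of_path {A N : Set X} (h : IsComponentUnion A N) {k : ℝ → X} {a b : ℝ} (hab : a ≤ b)
    (hk : ContinuousOn k (Icc a b)) (hkA : ∀ t ∈ Icc a b, k t ∈ A) (h0 : k a ∈ N) : k b ∈ N :=
  h.2 (k '' Icc a b) (by rintro _ ⟨t, ht, rfl⟩; exact hkA t ht) (isPreconnected_Icc.image k hk)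
    ⟨k a, ⟨a, ⟨le_rfl, hab⟩, rfl⟩, h0⟩ ⟨b, ⟨hab, le_rfl⟩, rfl⟩

end ComponentUnion

/-! ### The group and the Lie algebra of an anti-involution -/

section AdjointGroup

universe u

variable {E : Type u} [NormedRing E] [NormedAlgebra ℝ E]

/-- A linear anti-involution of an algebra. -/
structure IsAntiInvolution (τ : E →ₗ[ℝ] E) : Prop where
  map_mul : ∀ a b, τ (a * b) = τ b * τ a
  involutive : ∀ a, τ (τ a) = a

theorem IsAntiInvolution.map_one {τ : E →ₗ[ℝ] E} (hτ : IsAntiInvolution τ) : τ 1 = 1 := by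
  have := hτ.map_mul (τ 1) 1
  rwa [mul_one, hτ.involutive, mul_one, eq_comm] at this

/-- The elements that are unitary for the anti-involution `τ` and fixed by `S`. -/
def adjointGroup (τ : E →ₗ[ℝ] E) (S : Set (E →ₐ[ℝ] E)) : Set E :=
  {a | τ a * a = 1 ∧ ∀ σ ∈ S, σ a = a}

/-- The elements that are skew for the anti-involution `τ` and fixed by `S`. -/
def adjointAlgebra (τ : E →ₗ[ℝ] E) (S : Set (E →ₐ[ℝ] E)) : Submodule ℝ E where
  carrier := {X | τ X = -X ∧ ∀ σ ∈ S, σ X = X}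
  add_mem' h h' := ⟨by rw [map_add, h.1, h'.1, neg_add], fun σ hσ => by
    rw [map_add, h.2 σ hσ, h'.2 σ hσ]⟩
  zero_mem' := by simp
  smul_mem' c X h := ⟨by rw [map_smul, h.1, smul_neg], fun σ hσ => by
    rw [map_smul, h.2 σ hσ]⟩

variable {τ : E →ₗ[ℝ] E} {S : Set (E →ₐ[ℝ] E)}

theorem mul_mem_adjointGroup (hτ : IsAntiInvolution τ) {a b : E} (ha : a ∈ adjointGroup τ S)
    (hb : b ∈ adjointGroup τ S) : a * b ∈ adjointGroup τ S := by
  refine ⟨?_, fun σ hσ => by rw [map_mul, ha.2 σ hσ, hb.2 σ hσ]⟩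
  rw [hτ.map_mul, mul_assoc, ← mul_assoc (τ a), ha.1, one_mul, hb.1]

variable [FiniteDimensional ℝ E]

theorem mul_map_of_mem_adjointGroup {a : E} (ha : a ∈ adjointGroup τ S) : a * τ a = 1 := by
  have : IsNoetherianRing E := IsNoetherianRing.of_finite ℝ E
  exact mul_eq_one_comm.1 ha.1

theorem isUnit_of_mem_adjointGroup {a : E} (ha : a ∈ adjointGroup τ S) : IsUnit a :=
  ⟨⟨a, τ a, mul_map_of_mem_adjointGroup ha, ha.1⟩, rfl⟩

theorem inverse_of_mem_adjointGroup {a : E} (ha : a ∈ adjointGroup τ S) :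
    Ring.inverse a = τ a :=
  Ring.inverse_unit ⟨a, τ a, mul_map_of_mem_adjointGroup ha, ha.1⟩

/-- No compatibility of `σ` with `τ` is assumed: on the group `τ a` is the inverse of `a`, and a
homomorphism that fixes `a` fixes its inverse. -/
theorem map_adjoint_of_mem_adjointGroup {a : E} (ha : a ∈ adjointGroup τ S) {σ : E →ₐ[ℝ] E}
    (hσ : σ ∈ S) : σ (τ a) = τ a := by
  have h : σ (τ a) * a = 1 := by
    conv_lhs => rw [← ha.2 σ hσ, ha.2 σ hσ]
    nth_rewrite 2 [← ha.2 σ hσ]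
    rw [← map_mul, ha.1, map_one]
  calc σ (τ a) = σ (τ a) * (a * τ a) := by rw [mul_map_of_mem_adjointGroup ha, mul_one]
    _ = τ a := by rw [← mul_assoc, h, one_mul]

theorem adjoint_mem_adjointGroup (hτ : IsAntiInvolution τ) {a : E} (ha : a ∈ adjointGroup τ S) :
    τ a ∈ adjointGroup τ S :=
  ⟨by rw [hτ.involutive, mul_map_of_mem_adjointGroup ha],
    fun _ hσ => map_adjoint_of_mem_adjointGroup ha hσ⟩

variable [CompleteSpace E]

theorem exp_mem_adjointGroup (hτ : IsAntiInvolution τ) {X : E} (hX : X ∈ adjointAlgebra τ S) :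
    NormedSpace.exp X ∈ adjointGroup τ S := by
  let : NormedAlgebra ℚ E := NormedAlgebra.restrictScalars ℚ ℝ E
  let τL : E →L[ℝ] E := LinearMap.toContinuousLinearMap τ
  have hpow : ∀ (n : ℕ) (x : E), τ (x ^ n) = τ x ^ n := by
    intro n x
    induction n with
    | zero => simp [hτ.map_one]
    | succ n ih => rw [pow_succ, hτ.map_mul, ih, pow_succ']
  have hexp : τ (NormedSpace.exp X) = NormedSpace.exp (τ X) := by
    rw [NormedSpace.exp_eq_tsum ℝ]
    have := τL.map_tsum (NormedSpace.expSeries_summable' (𝕂 := ℝ) X)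
    simp only [τL, LinearMap.coe_toContinuousLinearMap', map_smul, hpow] at this
    exact this
  refine ⟨?_, fun σ hσ => ?_⟩
  · rw [hexp, hX.1, ← NormedSpace.exp_add_of_commute (Commute.refl X).neg_left, neg_add_cancel,
      NormedSpace.exp_zero]
  · have hc : Continuous σ := (LinearMap.toContinuousLinearMap σ.toLinearMap).continuous
    rw [NormedSpace.map_exp σ hc, hX.2 σ hσ]

/-- A union of components of the unitary group of an anti-involution is a Lie group. -/
theorem isLieSet_of_isComponentUnion (hτ : IsAntiInvolution τ) {N : Set E}
    (hN : IsComponentUnion (adjointGroup τ S) N) : IsLieSet N (adjointAlgebra τ S) where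
  isUnit g hg := isUnit_of_mem_adjointGroup (hN.1 hg)
  mul_exp g hg X hX := by
    let : NormedAlgebra ℚ E := NormedAlgebra.restrictScalars ℚ ℝ E
    -- The path `g exp (tX)` joins `g` to the product inside the whole group, hence inside `N`.
    have := mem_of_path hN (k := fun t : ℝ => g * NormedSpace.exp (t • X)) zero_le_one
      (Continuous.continuousOn (continuous_const.mul
        (NormedSpace.exp_continuous.comp (continuous_id.smul continuous_const))))
      (fun t _ => mul_mem_adjointGroup hτ (hN.1 hg)
        (exp_mem_adjointGroup hτ (Submodule.smul_mem _ t hX)))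
      (by simpa [NormedSpace.exp_zero] using hg)
    simpa using this
  velocity c I hI hc hcN t ht := by
    let τL : E →L[ℝ] E := LinearMap.toContinuousLinearMap τ
    have hd : HasDerivAt c (deriv c t) t :=
      ((hc.contDiffAt (hI.mem_nhds ht)).differentiableAt (by simp)).hasDerivAt
    have hm := hN.1 (hcN ht)
    have hI' := hI.mem_nhds ht
    rw [inverse_of_mem_adjointGroup hm]
    constructor
    · have h1 : HasDerivAt (fun t => τ (c t) * c t) (τ (deriv c t) * c t + τ (c t) * deriv c t) t :=
        HasDerivAt.mul (τL.hasFDerivAt.comp_hasDerivAt t hd) hd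
      have h2 : HasDerivAt (fun t => τ (c t) * c t) 0 t :=
        (hasDerivAt_const t (1 : E)).congr_of_eventuallyEq
          (Filter.eventuallyEq_of_mem hI' fun s hs => (hN.1 (hcN hs)).1)
      rw [hτ.map_mul, hτ.involutive]
      exact eq_neg_of_add_eq_zero_left (h1.unique h2)
    · intro σ hσ
      have h1 : HasDerivAt (fun t => σ (c t)) (σ (deriv c t)) t :=
        (LinearMap.toContinuousLinearMap σ.toLinearMap).hasFDerivAt.comp_hasDerivAt t hd
      have h2 : HasDerivAt (fun t => σ (c t)) (deriv c t) t :=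
        hd.congr_of_eventuallyEq (Filter.eventuallyEq_of_mem hI' fun s hs => (hN.1 (hcN hs)).2 σ hσ)
      rw [map_mul, map_adjoint_of_mem_adjointGroup hm hσ, h1.unique h2]

end AdjointGroup

/-! ### The Cayley transform -/

section Cayley

universe u

variable {E : Type u} [NormedRing E] [NormedAlgebra ℝ E]

/-- The Cayley transform `a ↦ (a - 1) (a + 1)⁻¹`. -/
def cayley (a : E) : E := (a - 1) * Ring.inverse (a + 1)

/-- The inverse Cayley transform `X ↦ (1 + X) (1 - X)⁻¹`. -/
def cayleyInv (X : E) : E := (1 + X) * Ring.inverse (1 - X)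

theorem two_smul_cancel {x y : E} (h : (2 : ℝ) • x = (2 : ℝ) • y) : x = y :=
  smul_right_injective E (two_ne_zero (α := ℝ)) h

theorem one_sub_cayley {a : E} (ha : IsUnit (a + 1)) :
    1 - cayley a = (2 : ℝ) • Ring.inverse (a + 1) := by
  have h := Ring.mul_inverse_cancel _ ha
  rw [cayley]
  calc 1 - (a - 1) * Ring.inverse (a + 1)
      = (a + 1) * Ring.inverse (a + 1) - (a - 1) * Ring.inverse (a + 1) := by rw [h]
    _ = (2 : ℝ) • Ring.inverse (a + 1) := by rw [two_smul]; noncomm_ring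

theorem one_add_cayley {a : E} (ha : IsUnit (a + 1)) :
    1 + cayley a = (2 : ℝ) • (a * Ring.inverse (a + 1)) := by
  have h := Ring.mul_inverse_cancel _ ha
  rw [cayley]
  calc 1 + (a - 1) * Ring.inverse (a + 1)
      = (a + 1) * Ring.inverse (a + 1) + (a - 1) * Ring.inverse (a + 1) := by rw [h]
    _ = (2 : ℝ) • (a * Ring.inverse (a + 1)) := by rw [two_smul]; noncomm_ring

theorem one_sub_cayley_mul {a : E} (ha : IsUnit (a + 1)) :
    (1 - cayley a) * ((1 / 2 : ℝ) • (a + 1)) = 1 := by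
  rw [one_sub_cayley ha, smul_mul_smul_comm, Ring.inverse_mul_cancel _ ha]
  norm_num

theorem mul_one_sub_cayley {a : E} (ha : IsUnit (a + 1)) :
    ((1 / 2 : ℝ) • (a + 1)) * (1 - cayley a) = 1 := by
  rw [one_sub_cayley ha, smul_mul_smul_comm, Ring.mul_inverse_cancel _ ha]
  norm_num

theorem cayleyInv_cayley {a : E} (ha : IsUnit (a + 1)) : cayleyInv (cayley a) = a := by
  have hinv : Ring.inverse (1 - cayley a) = (1 / 2 : ℝ) • (a + 1) :=
    Ring.inverse_unit ⟨_, _, one_sub_cayley_mul ha, mul_one_sub_cayley ha⟩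
  rw [cayleyInv, hinv, one_add_cayley ha, smul_mul_smul_comm, mul_assoc,
    Ring.inverse_mul_cancel _ ha]
  norm_num

theorem cayleyInv_add_one {X : E} (hX : IsUnit (1 - X)) :
    cayleyInv X + 1 = (2 : ℝ) • Ring.inverse (1 - X) := by
  have h := Ring.mul_inverse_cancel _ hX
  rw [cayleyInv]
  calc (1 + X) * Ring.inverse (1 - X) + 1
      = (1 + X) * Ring.inverse (1 - X) + (1 - X) * Ring.inverse (1 - X) := by rw [h]
    _ = (2 : ℝ) • Ring.inverse (1 - X) := by rw [two_smul]; noncomm_ring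

theorem isUnit_cayleyInv_add_one {X : E} (hX : IsUnit (1 - X)) : IsUnit (cayleyInv X + 1) := by
  rw [cayleyInv_add_one hX]
  refine ⟨⟨_, (1 / 2 : ℝ) • (1 - X), ?_, ?_⟩, rfl⟩
  · rw [smul_mul_smul_comm, Ring.inverse_mul_cancel _ hX]; norm_num
  · rw [smul_mul_smul_comm, Ring.mul_inverse_cancel _ hX]; norm_num

theorem cayley_cayleyInv {X : E} (hX : IsUnit (1 - X)) : cayley (cayleyInv X) = X := by
  have h1 := one_sub_cayley (isUnit_cayleyInv_add_one hX)
  have h2 : Ring.inverse (cayleyInv X + 1) = (1 / 2 : ℝ) • (1 - X) := by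
    rw [cayleyInv_add_one hX]
    refine Ring.inverse_unit ⟨_, _, ?_, ?_⟩
    · rw [smul_mul_smul_comm, Ring.inverse_mul_cancel _ hX]; norm_num
    · rw [smul_mul_smul_comm, Ring.mul_inverse_cancel _ hX]; norm_num
  rw [h2, smul_smul] at h1
  norm_num at h1
  exact h1

variable {τ : E →ₗ[ℝ] E} {S : Set (E →ₐ[ℝ] E)}

theorem map_inverse_antiInvolution (hτ : IsAntiInvolution τ) {a : E} (ha : IsUnit a) :
    τ a * τ (Ring.inverse a) = 1 ∧ τ (Ring.inverse a) * τ a = 1 := by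
  rw [← hτ.map_mul, ← hτ.map_mul, Ring.inverse_mul_cancel _ ha, Ring.mul_inverse_cancel _ ha,
    hτ.map_one]
  exact ⟨rfl, rfl⟩

/-- With `X = cayley a`, one has `(τ a + 1) (τ X + X) (a + 1) = 2 (τ a a - 1)`, and the outer
factors are invertible. For the fixed points, endomorphisms commute with inverses of units. -/
theorem cayley_mem_adjointAlgebra_iff (hτ : IsAntiInvolution τ) {a : E} (ha : IsUnit (a + 1)) :
    cayley a ∈ adjointAlgebra τ S ↔ a ∈ adjointGroup τ S := by
  refine and_congr ?_ (forall₂_congr fun σ _ => ?_)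
  · have hr : τ (Ring.inverse (a + 1)) * (τ a + 1) = 1 := by
      have := (map_inverse_antiInvolution hτ ha).2
      rwa [map_add, hτ.map_one] at this
    have hr' : (τ a + 1) * τ (Ring.inverse (a + 1)) = 1 := by
      have := (map_inverse_antiInvolution hτ ha).1
      rwa [map_add, hτ.map_one] at this
    have hi := Ring.inverse_mul_cancel _ ha
    have hi' := Ring.mul_inverse_cancel _ ha
    have hτX : τ (cayley a) = τ (Ring.inverse (a + 1)) * (τ a - 1) := by
      rw [cayley, hτ.map_mul, map_sub, hτ.map_one]
    have key : (τ a - 1) * (a + 1) + (τ a + 1) * (a - 1) = (2 : ℝ) • (τ a * a) - (2 : ℝ) • 1 := by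
      rw [two_smul, two_smul]; noncomm_ring
    have hE : (τ a + 1) * (τ (cayley a) + cayley a) * (a + 1) =
        (2 : ℝ) • (τ a * a) - (2 : ℝ) • 1 := by
      rw [← key, hτX, cayley]
      calc _ = (τ a + 1) * τ (Ring.inverse (a + 1)) * (τ a - 1) * (a + 1) +
            (τ a + 1) * (a - 1) * (Ring.inverse (a + 1) * (a + 1)) := by noncomm_ring
        _ = _ := by rw [hr', hi, one_mul, mul_one]
    constructor
    · intro h
      rw [show τ (cayley a) + cayley a = 0 by rw [h, neg_add_cancel], mul_zero, zero_mul] at hE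
      exact two_smul_cancel (sub_eq_zero.1 hE.symm)
    · intro h
      rw [h, sub_self] at hE
      refine eq_neg_of_add_eq_zero_left ?_
      calc τ (cayley a) + cayley a
          = τ (Ring.inverse (a + 1)) * ((τ a + 1) * (τ (cayley a) + cayley a) * (a + 1)) *
            Ring.inverse (a + 1) := by
              rw [mul_assoc, mul_assoc _ (a + 1), hi', mul_one, ← mul_assoc, hr, one_mul]
        _ = 0 := by rw [hE, mul_zero, zero_mul]
  · constructor
    · intro h
      have hu : IsUnit (1 - cayley a) := ⟨⟨_, _, one_sub_cayley_mul ha, mul_one_sub_cayley ha⟩, rfl⟩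
      rw [← cayleyInv_cayley ha, cayleyInv, map_mul, map_ringInverse_of_isUnit σ hu]
      simp only [map_add, map_sub, map_one, h]
    · intro h
      rw [cayley, map_mul, map_ringInverse_of_isUnit σ ha]
      simp only [map_add, map_sub, map_one, h]

variable [FiniteDimensional ℝ E] [CompleteSpace E]

/-- Unions of components of the unitary group of an anti-involution have charts onto the space of
skew elements, given by the Cayley transform. -/
theorem exists_cayley_chart (hτ : IsAntiInvolution τ) {N : Set E}
    (hN : IsComponentUnion (adjointGroup τ S) N) {x : E} (hx : x ∈ N) :
    ∃ Φ : OpenPartialHomeomorph E E, x ∈ Φ.source ∧ ContDiffOn ℝ ∞ Φ Φ.source ∧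
      ContDiffOn ℝ ∞ Φ.symm Φ.target ∧
        ∀ y ∈ Φ.source, (y ∈ N ↔ Φ y ∈ adjointAlgebra τ S) := by
  have hxA := hN.1 hx
  have hxx := hxA.1
  have hxx' := mul_map_of_mem_adjointGroup hxA
  have hU : IsOpen {y : E | IsUnit (τ x * y + 1)} :=
    Units.isOpen.preimage (by fun_prop : Continuous fun y : E => τ x * y + 1)
  have hφ : ContDiffOn ℝ ∞ (fun y : E => cayley (τ x * y)) {y : E | IsUnit (τ x * y + 1)} := by
    have h1 : ContDiffOn ℝ ∞ (fun y : E => τ x * y) {y : E | IsUnit (τ x * y + 1)} :=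
      contDiffOn_const.mul contDiffOn_id
    exact (h1.sub contDiffOn_const).mul ((h1.add contDiffOn_const).ringInverse fun y hy => hy)
  have hψ : ContDiffOn ℝ ∞ (fun X : E => x * cayleyInv X) (Metric.ball 0 1) := by
    refine contDiffOn_const.mul ((contDiffOn_const.add contDiffOn_id).mul
      ((contDiffOn_const.sub contDiffOn_id).ringInverse fun X hX => ?_))
    exact ⟨Units.oneSub X (by simpa using hX), rfl⟩
  have hunit : ∀ X ∈ Metric.ball (0 : E) 1, IsUnit (1 - X) := fun X hX =>
    ⟨Units.oneSub X (by simpa using hX), rfl⟩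
  -- The Cayley transform translated to `x`. The target is the unit ball: `1 - X` is invertible on
  -- it, and it contains the segments from 0 needed below.
  let Φ : OpenPartialHomeomorph E E :=
    { toFun := fun y => cayley (τ x * y)
      invFun := fun X => x * cayleyInv X
      source := {y | IsUnit (τ x * y + 1)} ∩ (fun y => cayley (τ x * y)) ⁻¹' Metric.ball 0 1
      target := Metric.ball 0 1
      map_source' := fun y hy => hy.2
      map_target' := fun X hX => by
        have e : τ x * (x * cayleyInv X) = cayleyInv X := by rw [← mul_assoc, hxx, one_mul]
        constructor
        · simpa only [mem_ofPred_eq, e] using isUnit_cayleyInv_add_one (hunit X hX)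
        · simpa only [mem_preimage, e, cayley_cayleyInv (hunit X hX)] using hX
      left_inv' := fun y hy => by
        rw [cayleyInv_cayley hy.1, ← mul_assoc, hxx', one_mul]
      right_inv' := fun X hX => by
        rw [← mul_assoc, hxx, one_mul, cayley_cayleyInv (hunit X hX)]
      open_source := hφ.continuousOn.isOpen_inter_preimage hU Metric.isOpen_ball
      open_target := Metric.isOpen_ball
      continuousOn_toFun := hφ.continuousOn.mono inter_subset_left
      continuousOn_invFun := hψ.continuousOn }
  refine ⟨Φ, ⟨?_, ?_⟩, hφ.mono inter_subset_left, hψ, ?_⟩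
  · show IsUnit (τ x * x + 1)
    rw [hxx, one_add_one_eq_two]
    rw [← map_ofNat (algebraMap ℝ E) 2]
    exact (IsUnit.mk0 (2 : ℝ) two_ne_zero).map (algebraMap ℝ E)
  · simp [hxx, cayley]
  rintro y ⟨hy, hy1⟩
  have hyX : y = x * cayleyInv (cayley (τ x * y)) := by
    rw [cayleyInv_cayley hy, ← mul_assoc, hxx', one_mul]
  have hmem : y ∈ N → y ∈ adjointGroup τ S := fun h => hN.1 h
  show y ∈ N ↔ cayley (τ x * y) ∈ adjointAlgebra τ S
  rw [cayley_mem_adjointAlgebra_iff hτ hy]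
  constructor
  · exact fun h => mul_mem_adjointGroup hτ (adjoint_mem_adjointGroup hτ hxA) (hN.1 h)
  · intro h
    rw [← cayley_mem_adjointAlgebra_iff hτ hy] at h
    set X := cayley (τ x * y) with hX
    have hX1 : ‖X‖ < 1 := by simpa using hy1
    have hball : ∀ t ∈ Icc (0 : ℝ) 1, t • X ∈ Metric.ball (0 : E) 1 := by
      intro t ht
      rw [mem_ball_zero_iff, norm_smul, Real.norm_of_nonneg ht.1]
      nlinarith [norm_nonneg X, ht.1, ht.2]
    -- The Cayley transform only shows that `y` is in the full group; the image of the segment from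
    -- 0 to `X` joins `x` to `y` there, which puts `y` in `N`.
    have := mem_of_path hN (k := fun t : ℝ => x * cayleyInv (t • X)) zero_le_one
      (hψ.continuousOn.comp (by fun_prop) hball) (fun t ht => ?_) (by simpa [cayleyInv] using hx)
    · simpa [← hyX] using this
    · refine mul_mem_adjointGroup hτ hxA ?_
      have hu := hunit _ (hball t ht)
      rw [← cayley_mem_adjointAlgebra_iff hτ (isUnit_cayleyInv_add_one hu), cayley_cayleyInv hu]
      exact Submodule.smul_mem _ t h

theorem isEmbeddedSubmanifold_of_isComponentUnion (hτ : IsAntiInvolution τ) {N : Set E}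
    (hN : IsComponentUnion (adjointGroup τ S) N) : IsEmbeddedSubmanifold N := fun _ hx =>
  ⟨adjointAlgebra τ S, exists_cayley_chart hτ hN hx⟩

end Cayley

/-! ### The Riemannian volume of a compact submanifold -/

section Volume

variable {E : Type*} [NormedAddCommGroup E] [MeasurableSpace E] [BorelSpace E]

/-- Only finiteness on compact sets and positivity on open pieces are needed from the volume, so the
nonzero normalizing factor is immaterial. -/
theorem euclideanHausdorffMeasure_eq_smul (d : ℕ) : ∃ c : NNReal, c ≠ 0 ∧
    (μHE[d] : Measure E) = c • μH[(d : ℝ)] :=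
  ⟨_, Measure.addHaarScalarFactor_volume_hausdorffMeasure_ne_zero d,
    Measure.euclideanHausdorffMeasure_def d⟩

variable [NormedSpace ℝ E]

theorem hausdorffMeasure_coe_image (W : Submodule ℝ E) (s : Set W) :
    μH[(Module.finrank ℝ W : ℝ)] ((↑) '' s : Set E) = μH[(Module.finrank ℝ W : ℝ)] s :=
  isometry_subtype_coe.hausdorffMeasure_image (Or.inl (Nat.cast_nonneg _)) s

variable [FiniteDimensional ℝ E]

/-- By compactness the question is local. Near a point, `M` lies in the image of a ball of `W` under
the inverse chart, which is Lipschitz there, and the Hausdorff measure of dimension `dim W` is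
finite on balls of `W`. -/
theorem hausdorffMeasure_ne_top_of_chart {M : Set E} (hM : IsCompact M) {W : Submodule ℝ E}
    (hchart : ∀ x ∈ M, ∃ Φ : OpenPartialHomeomorph E E, x ∈ Φ.source ∧ ContDiffOn ℝ ∞ Φ Φ.source ∧
      ContDiffOn ℝ ∞ Φ.symm Φ.target ∧ ∀ y ∈ Φ.source, (y ∈ M ↔ Φ y ∈ W)) :
    μH[(Module.finrank ℝ W : ℝ)] M ≠ ⊤ := by
  refine (hM.measure_lt_top_of_nhdsWithin fun x hx => ?_).ne
  obtain ⟨Φ, hxs, -, hΨ, hiff⟩ := hchart x hx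
  have hp : Φ x ∈ Φ.target := Φ.map_source hxs
  have hpW : Φ x ∈ W := (hiff x hxs).1 hx
  obtain ⟨K, s, hs, hLip⟩ := ((hΨ.contDiffAt (Φ.open_target.mem_nhds hp)).of_le
    (by exact_mod_cast le_top)).exists_lipschitzOnWith (𝕂 := ℝ)
  obtain ⟨r, hr, hball⟩ := Metric.mem_nhds_iff.1 hs
  let D : Set W := Metric.ball ⟨Φ x, hpW⟩ r
  have hD : μH[(Module.finrank ℝ W : ℝ)] D ≠ ⊤ := measure_ball_lt_top.ne
  have hsub : (Φ.source ∩ Φ ⁻¹' Metric.ball (Φ x) r) ∩ M ⊆ Φ.symm '' ((↑) '' D) := by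
    rintro y ⟨⟨hys, hyb⟩, hyM⟩
    exact ⟨Φ y, ⟨⟨Φ y, (hiff y hys).1 hyM⟩, hyb, rfl⟩, Φ.left_inv hys⟩
  have hopen : IsOpen (Φ.source ∩ Φ ⁻¹' Metric.ball (Φ x) r) :=
    Φ.isOpen_inter_preimage Metric.isOpen_ball
  refine ⟨(Φ.source ∩ Φ ⁻¹' Metric.ball (Φ x) r) ∩ M, Filter.inter_mem
    (mem_nhdsWithin_of_mem_nhds (hopen.mem_nhds ⟨hxs, Metric.mem_ball_self hr⟩))
    self_mem_nhdsWithin, ?_⟩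
  refine lt_of_le_of_lt (measure_mono hsub) ?_
  have hle := (hLip.mono (show ((↑) '' D : Set E) ⊆ s by
    rintro _ ⟨w, hw, rfl⟩
    exact hball hw)).hausdorffMeasure_image_le (d := Module.finrank ℝ W) (Nat.cast_nonneg _)
  refine lt_of_le_of_lt hle ?_
  rw [hausdorffMeasure_coe_image]
  exact ENNReal.mul_lt_top (ENNReal.rpow_lt_top_of_nonneg (Nat.cast_nonneg _) (by simp)) hD.lt_top

/-- Here the chart itself is used as a Lipschitz map: it carries a piece of `O ∩ M` onto a ball of
`W`, whose measure is positive. -/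
theorem hausdorffMeasure_inter_ne_zero_of_chart {M : Set E} {W : Submodule ℝ E}
    (hchart : ∀ x ∈ M, ∃ Φ : OpenPartialHomeomorph E E, x ∈ Φ.source ∧ ContDiffOn ℝ ∞ Φ Φ.source ∧
      ContDiffOn ℝ ∞ Φ.symm Φ.target ∧ ∀ y ∈ Φ.source, (y ∈ M ↔ Φ y ∈ W))
    {O : Set E} (hO : IsOpen O) {x : E} (hx : x ∈ M) (hxO : x ∈ O) :
    μH[(Module.finrank ℝ W : ℝ)] (O ∩ M) ≠ 0 := by
  obtain ⟨Φ, hxs, hΦ, -, hiff⟩ := hchart x hx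
  have hp : Φ x ∈ Φ.target := Φ.map_source hxs
  have hpW : Φ x ∈ W := (hiff x hxs).1 hx
  obtain ⟨K, s, hs, hLip⟩ := ((hΦ.contDiffAt (Φ.open_source.mem_nhds hxs)).of_le
    (by exact_mod_cast le_top)).exists_lipschitzOnWith (𝕂 := ℝ)
  have hnb : Φ.target ∩ Φ.symm ⁻¹' (O ∩ s) ∈ nhds (Φ x) := by
    refine Filter.inter_mem (Φ.open_target.mem_nhds hp) ?_
    refine (Φ.continuousAt_symm hp).preimage_mem_nhds ?_
    rw [Φ.left_inv hxs]
    exact Filter.inter_mem (hO.mem_nhds hxO) hs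
  obtain ⟨r, hr, hball⟩ := Metric.mem_nhds_iff.1 hnb
  let D : Set W := Metric.ball ⟨Φ x, hpW⟩ r
  have hD : μH[(Module.finrank ℝ W : ℝ)] D ≠ 0 :=
    (Metric.measure_ball_pos _ _ hr).ne'
  have hDm : ∀ w ∈ D, (w : E) ∈ Φ.target ∩ Φ.symm ⁻¹' (O ∩ s) := fun w hw => hball hw
  have hsub : Φ.symm '' ((↑) '' D) ⊆ O ∩ M := by
    rintro _ ⟨_, ⟨w, hw, rfl⟩, rfl⟩
    refine ⟨(hDm w hw).2.1, (hiff _ (Φ.map_target (hDm w hw).1)).2 ?_⟩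
    rw [Φ.right_inv (hDm w hw).1]
    exact w.2
  have himg : Φ '' (Φ.symm '' ((↑) '' D)) = ((↑) '' D : Set E) := by
    rw [← image_comp]
    refine (image_congr fun y hy => ?_).trans (image_id _)
    obtain ⟨w, hw, rfl⟩ := hy
    exact Φ.right_inv (hDm w hw).1
  intro h0
  have hle := (hLip.mono (show Φ.symm '' ((↑) '' D) ⊆ s by
    rintro _ ⟨_, ⟨w, hw, rfl⟩, rfl⟩
    exact (hDm w hw).2.2)).hausdorffMeasure_image_le (d := Module.finrank ℝ W) (Nat.cast_nonneg _)
  rw [himg, hausdorffMeasure_coe_image, measure_mono_null hsub h0, mul_zero] at hle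
  exact hD (le_antisymm hle zero_le)

end Volume

/-! ### Matrices over `ℝ`, `ℂ`, `ℍ` -/

section MatrixAlgebra

variable {m : Type*} [Fintype m] {𝔽 : Type*} [NormedDivisionRing 𝔽]

/-- Passing to the norms of the entries reduces the inequality to real matrices, so it covers the
noncommutative case `ℍ`. -/
theorem frobenius_norm_mul_le (A B : Matrix m m 𝔽) : ‖A * B‖ ≤ ‖A‖ * ‖B‖ := by
  have h := Matrix.frobenius_norm_mul (α := ℝ) (A.map norm) (B.map norm)
  have e : ∀ C : Matrix m m 𝔽, ‖C.map norm‖ = ‖C‖ := fun C =>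
    Matrix.frobenius_norm_map_eq C norm fun a => by simp
  rw [e, e] at h
  refine le_trans ?_ h
  simp only [Matrix.frobenius_norm_def, Matrix.mul_apply, Matrix.map_apply]
  gcongr with i _ j _
  rw [Real.norm_of_nonneg (by positivity)]
  exact (norm_sum_le _ _).trans (by simp)

/-- The topology of the Frobenius norm. -/
@[reducible]
def matrixTopology : TopologicalSpace (Matrix m m 𝔽) :=
  (Matrix.frobeniusNormedAddCommGroup : NormedAddCommGroup
    (Matrix m m 𝔽)).toMetricSpace.toPseudoMetricSpace.toUniformSpace.toTopologicalSpace

attribute [local instance] matrixTopology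

variable [DecidableEq m]

/-- The Frobenius norm makes the matrices over a normed division ring a normed ring. -/
@[reducible]
def matrixNormedRing : NormedRing (Matrix m m 𝔽) :=
  { Matrix.frobeniusNormedAddCommGroup, Matrix.instRing with
    norm_mul_le := frobenius_norm_mul_le }

attribute [local instance] matrixNormedRing

/-- The matrices over a real normed division algebra form a normed algebra. -/
@[reducible]
def matrixNormedAlgebra [NormedSpace ℝ 𝔽] [IsScalarTower ℝ 𝔽 𝔽] [SMulCommClass ℝ 𝔽 𝔽] :
    NormedAlgebra ℝ (Matrix m m 𝔽) :=
  { Algebra.ofModule (R := ℝ) (A := Matrix m m 𝔽) (fun r x y => Matrix.smul_mul r x y)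
      (fun r x y => Matrix.mul_smul x r y), Matrix.frobeniusNormedSpace with }

attribute [local instance] matrixNormedAlgebra

end MatrixAlgebra

/-- The compatibility of the real inner product and the involution of `ℝ`, `ℂ` and `ℍ`. -/
class StarInner (𝔽 : Type*) [NormedDivisionRing 𝔽] [InnerProductSpace ℝ 𝔽] [StarRing 𝔽] :
    Prop where
  inner_mul_left : ∀ a b c : 𝔽, inner ℝ (a * b) c = inner ℝ b (star a * c)
  inner_mul_right : ∀ a b c : 𝔽, inner ℝ (b * a) c = inner ℝ b (c * star a)

instance : StarInner ℝ where
  inner_mul_left a b c := by simp; ring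
  inner_mul_right a b c := by simp; ring

instance : StarInner ℂ where
  inner_mul_left a b c := by simp [Complex.inner]; ring
  inner_mul_right a b c := by simp [Complex.inner]; ring

instance : StarInner ℍ[ℝ] where
  inner_mul_left a b c := by simp [Quaternion.inner_def]; ring
  inner_mul_right a b c := by simp [Quaternion.inner_def]; ring

attribute [local instance] matrixTopology matrixNormedRing matrixNormedAlgebra

/-! ### The real inner product of matrices -/

section MatrixInner

variable {ι : Type*} [Fintype ι] [DecidableEq ι]
  {𝔽 : Type*} [NormedDivisionRing 𝔽] [InnerProductSpace ℝ 𝔽]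

theorem matrixInner_self (X : Matrix ι ι 𝔽) : matrixInner X X = ‖X‖ ^ 2 := by
  rw [Matrix.frobenius_norm_def, ← Real.sqrt_eq_rpow, Real.sq_sqrt (by positivity)]
  simp [matrixInner]

theorem matrixInner_comm (X Y : Matrix ι ι 𝔽) : matrixInner X Y = matrixInner Y X := by
  simp only [matrixInner, real_inner_comm]

theorem matrixInner_add_left (X Y Z : Matrix ι ι 𝔽) :
    matrixInner (X + Y) Z = matrixInner X Z + matrixInner Y Z := by
  simp only [matrixInner, Matrix.add_apply, inner_add_left, Finset.sum_add_distrib]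

theorem matrixInner_smul_left (r : ℝ) (X Y : Matrix ι ι 𝔽) :
    matrixInner (r • X) Y = r * matrixInner X Y := by
  simp only [matrixInner, Matrix.smul_apply, real_inner_smul_left, Finset.mul_sum]

theorem matrixInner_add_right (X Y Z : Matrix ι ι 𝔽) :
    matrixInner X (Y + Z) = matrixInner X Y + matrixInner X Z := by
  rw [matrixInner_comm, matrixInner_add_left, matrixInner_comm, matrixInner_comm Z]

theorem matrixInner_smul_right (r : ℝ) (X Y : Matrix ι ι 𝔽) :
    matrixInner X (r • Y) = r * matrixInner X Y := by
  rw [matrixInner_comm, matrixInner_smul_left, matrixInner_comm]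

theorem matrixInner_self_eq_zero {X : Matrix ι ι 𝔽} : matrixInner X X = 0 ↔ X = 0 := by
  rw [matrixInner_self]
  simp

/-- The inner product of matrices as a continuous bilinear map. -/
def matrixInnerL [FiniteDimensional ℝ 𝔽] :
    Matrix ι ι 𝔽 →L[ℝ] Matrix ι ι 𝔽 →L[ℝ] ℝ :=
  LinearMap.toContinuousLinearMap
    (LinearMap.toContinuousLinearMap.toLinearMap ∘ₗ LinearMap.mk₂ ℝ matrixInner
      matrixInner_add_left matrixInner_smul_left matrixInner_add_right matrixInner_smul_right)

theorem matrixInnerL_apply [FiniteDimensional ℝ 𝔽] (X Y : Matrix ι ι 𝔽) :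
    matrixInnerL X Y = matrixInner X Y := rfl

variable [StarRing 𝔽] [StarInner 𝔽]

theorem matrixInner_mul_left (A X Y : Matrix ι ι 𝔽) :
    matrixInner (A * X) Y = matrixInner X (Aᴴ * Y) := by
  simp only [matrixInner, Matrix.mul_apply, sum_inner, inner_sum, StarInner.inner_mul_left,
    Matrix.conjTranspose_apply]
  calc _ = ∑ i, ∑ k, ∑ j, inner ℝ (X k j) (star (A i k) * Y i j) :=
        Finset.sum_congr rfl fun i _ => Finset.sum_comm
    _ = ∑ k, ∑ i, ∑ j, inner ℝ (X k j) (star (A i k) * Y i j) := Finset.sum_comm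
    _ = _ := Finset.sum_congr rfl fun i _ => Finset.sum_comm

theorem matrixInner_mul_right (A X Y : Matrix ι ι 𝔽) :
    matrixInner (X * A) Y = matrixInner X (Y * Aᴴ) := by
  simp only [matrixInner, Matrix.mul_apply, sum_inner, inner_sum, StarInner.inner_mul_right,
    Matrix.conjTranspose_apply]
  exact Finset.sum_congr rfl fun i _ => Finset.sum_comm

/-- Both sides equal the inner product of `1` and `X * Yᴴ`; cyclicity of the trace, which fails over
`ℍ`, is avoided. -/
theorem matrixInner_conjTranspose (X Y : Matrix ι ι 𝔽) :
    matrixInner Xᴴ Yᴴ = matrixInner X Y := by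
  have h1 := matrixInner_mul_left Xᴴ 1 Yᴴ
  have h2 := matrixInner_mul_right Y 1 X
  rw [mul_one, Matrix.conjTranspose_conjTranspose] at h1
  rw [one_mul] at h2
  rw [h1, ← h2, matrixInner_comm]

theorem eq_zero_of_conjTranspose_mul_self {X : Matrix ι ι 𝔽} (h : Xᴴ * X = 0) : X = 0 := by
  rw [← matrixInner_self_eq_zero]
  have := matrixInner_mul_right X 1 X
  rw [one_mul] at this
  have h2 := matrixInner_mul_left X 1 X
  rw [mul_one, h] at h2
  rw [h2]
  simp [matrixInner]

end MatrixInner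

/-! ### Unitary groups as groups of anti-involutions -/

section SplitUnitary

variable {ι : Type*} [Fintype ι] [DecidableEq ι]
  {𝔽 : Type*} [NormedDivisionRing 𝔽] [InnerProductSpace ℝ 𝔽] [StarRing 𝔽] [StarModule ℝ 𝔽]
  [IsScalarTower ℝ 𝔽 𝔽] [SMulCommClass ℝ 𝔽 𝔽]

variable (ι 𝔽) in
/-- The matrix of the form preserved by `U(n, n, 𝔽)`. -/
def splitForm : Matrix (ι ⊕ ι) (ι ⊕ ι) 𝔽 := Matrix.fromBlocks 1 0 0 (-1)

theorem splitForm_mul_self : splitForm ι 𝔽 * splitForm ι 𝔽 = 1 := by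
  simp [splitForm, Matrix.fromBlocks_multiply]

theorem splitForm_conjTranspose : (splitForm ι 𝔽)ᴴ = splitForm ι 𝔽 := by
  simp [splitForm, Matrix.fromBlocks_conjTranspose]

variable (ι 𝔽) in
/-- The conjugate transpose as a real linear map. -/
def conjTransposeL : Matrix ι ι 𝔽 →ₗ[ℝ] Matrix ι ι 𝔽 where
  toFun A := Aᴴ
  map_add' := Matrix.conjTranspose_add
  map_smul' r A := by simp [Matrix.conjTranspose_smul]

theorem conjTransposeL_apply (A : Matrix ι ι 𝔽) : conjTransposeL ι 𝔽 A = Aᴴ := rfl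

variable (ι 𝔽) in
/-- The adjoint with respect to the form preserved by `U(n, n, 𝔽)`. -/
def splitAdjoint : Matrix (ι ⊕ ι) (ι ⊕ ι) 𝔽 →ₗ[ℝ] Matrix (ι ⊕ ι) (ι ⊕ ι) 𝔽 where
  toFun A := splitForm ι 𝔽 * Aᴴ * splitForm ι 𝔽
  map_add' A B := by rw [Matrix.conjTranspose_add, mul_add, add_mul]
  map_smul' r A := by simp [Matrix.conjTranspose_smul]

theorem splitAdjoint_apply (A : Matrix (ι ⊕ ι) (ι ⊕ ι) 𝔽) :
    splitAdjoint ι 𝔽 A = splitForm ι 𝔽 * Aᴴ * splitForm ι 𝔽 := rfl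

theorem isAntiInvolution_conjTransposeL : IsAntiInvolution (conjTransposeL ι 𝔽) where
  map_mul := Matrix.conjTranspose_mul
  involutive := Matrix.conjTranspose_conjTranspose

theorem isAntiInvolution_splitAdjoint : IsAntiInvolution (splitAdjoint ι 𝔽) where
  map_mul A B := by
    simp only [splitAdjoint_apply, Matrix.conjTranspose_mul]
    rw [show splitForm ι 𝔽 * Bᴴ * splitForm ι 𝔽 * (splitForm ι 𝔽 * Aᴴ * splitForm ι 𝔽) =
      splitForm ι 𝔽 * Bᴴ * (splitForm ι 𝔽 * splitForm ι 𝔽) * Aᴴ * splitForm ι 𝔽 by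
        simp only [mul_assoc], splitForm_mul_self]
    simp only [mul_assoc, one_mul]
  involutive A := by
    simp only [splitAdjoint_apply, Matrix.conjTranspose_mul, splitForm_conjTranspose,
      Matrix.conjTranspose_conjTranspose]
    rw [show splitForm ι 𝔽 * (splitForm ι 𝔽 * (A * splitForm ι 𝔽)) * splitForm ι 𝔽 =
      (splitForm ι 𝔽 * splitForm ι 𝔽) * A * (splitForm ι 𝔽 * splitForm ι 𝔽) by
        simp only [mul_assoc], splitForm_mul_self, one_mul, mul_one]

theorem mem_splitUnitary_iff {A : Matrix (ι ⊕ ι) (ι ⊕ ι) 𝔽} :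
    A ∈ splitUnitary ι 𝔽 ↔ splitAdjoint ι 𝔽 A * A = 1 := by
  change Aᴴ * splitForm ι 𝔽 * A = splitForm ι 𝔽 ↔ _
  rw [splitAdjoint_apply]
  constructor
  · intro h
    rw [mul_assoc, mul_assoc, ← mul_assoc Aᴴ, h, splitForm_mul_self]
  · intro h
    calc Aᴴ * splitForm ι 𝔽 * A
        = splitForm ι 𝔽 * splitForm ι 𝔽 * (Aᴴ * splitForm ι 𝔽 * A) := by
          rw [splitForm_mul_self, one_mul]
      _ = splitForm ι 𝔽 * (splitForm ι 𝔽 * Aᴴ * splitForm ι 𝔽 * A) := by simp only [mul_assoc]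
      _ = splitForm ι 𝔽 := by rw [h, mul_one]

theorem splitUnitary_eq_adjointGroup :
    splitUnitary ι 𝔽 = adjointGroup (splitAdjoint ι 𝔽) ∅ := by
  ext A
  rw [mem_splitUnitary_iff]
  simp [adjointGroup]

theorem compactU_eq_adjointGroup [FiniteDimensional ℝ 𝔽] :
    compactU ι 𝔽 = adjointGroup (conjTransposeL ι 𝔽) ∅ := by
  ext A
  constructor
  · intro h
    exact ⟨h.1, by simp⟩
  · intro h
    exact ⟨h.1, mul_map_of_mem_adjointGroup h⟩

/-- The dimension in the definition of the volume is that of the model space of the Cayley charts.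
-/
theorem unitaryDim_eq :
    unitaryDim ι 𝔽 = Module.finrank ℝ (adjointAlgebra (conjTransposeL ι 𝔽) ∅) := by
  have : skewAdjoint.submodule ℝ (Matrix ι ι 𝔽) = adjointAlgebra (conjTransposeL ι 𝔽) ∅ := by
    ext A
    change star A = -A ↔ _
    simp [adjointAlgebra, conjTransposeL_apply, Matrix.star_eq_conjTranspose]
  rw [unitaryDim, this]

end SplitUnitary

/-! ### The Möbius action -/

section Mobius

universe u

variable {ι : Type u} [Fintype ι] [DecidableEq ι]
  {𝔽 : Type u} [NormedDivisionRing 𝔽] [InnerProductSpace ℝ 𝔽] [StarRing 𝔽] [StarModule ℝ 𝔽]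
  [IsScalarTower ℝ 𝔽 𝔽] [SMulCommClass ℝ 𝔽 𝔽] [FiniteDimensional ℝ 𝔽]

/-- The matrix with first block column `(u, w)` and second block column zero. -/
def blockCol (u w : Matrix ι ι 𝔽) : Matrix (ι ⊕ ι) (ι ⊕ ι) 𝔽 := Matrix.fromBlocks u 0 w 0

theorem mul_blockCol (g : Matrix (ι ⊕ ι) (ι ⊕ ι) 𝔽) (u w : Matrix ι ι 𝔽) :
    g * blockCol u w = blockCol (g.toBlocks₁₁ * u + g.toBlocks₁₂ * w)
      (g.toBlocks₂₁ * u + g.toBlocks₂₂ * w) := by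
  conv_lhs => rw [← Matrix.fromBlocks_toBlocks g]
  simp [blockCol, Matrix.fromBlocks_multiply]

theorem mul_blockCol_mul (g : Matrix (ι ⊕ ι) (ι ⊕ ι) 𝔽) (q s : Matrix ι ι 𝔽) :
    g * blockCol (q * s) s = blockCol ((g.toBlocks₁₁ * q + g.toBlocks₁₂) * s)
      ((g.toBlocks₂₁ * q + g.toBlocks₂₂) * s) := by
  rw [mul_blockCol, add_mul, add_mul, mul_assoc, mul_assoc]

theorem blockCol_inj {u w u' w' : Matrix ι ι 𝔽} (h : blockCol u w = blockCol u' w') :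
    u = u' ∧ w = w' := by
  have := Matrix.fromBlocks_inj.1 h
  exact ⟨this.1, this.2.2.1⟩

theorem splitUnitary_mul_left_cancel {g a b : Matrix (ι ⊕ ι) (ι ⊕ ι) 𝔽}
    (hg : g ∈ splitUnitary ι 𝔽) (h : g * a = g * b) : a = b := by
  have hg' := mem_splitUnitary_iff.1 hg
  rw [← one_mul a, ← one_mul b, ← hg', mul_assoc, h, mul_assoc]

theorem blockCol_form (u w : Matrix ι ι 𝔽) : (blockCol u w)ᴴ * splitForm ι 𝔽 * blockCol u w =
    blockCol (uᴴ * u - wᴴ * w) 0 := by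
  simp [blockCol, splitForm, Matrix.fromBlocks_conjTranspose, Matrix.fromBlocks_multiply,
    sub_eq_add_neg]

/-- Left multiplication by `r` is an injective real linear map in finite dimension, hence
surjective. This serves in place of a determinant over `ℍ`. -/
theorem isUnit_of_mul_eq_zero {r : Matrix ι ι 𝔽} (h : ∀ x, r * x = 0 → x = 0) : IsUnit r := by
  have hinj : Function.Injective (LinearMap.mulLeft ℝ r) :=
    (injective_iff_map_eq_zero _).2 fun x hx => h x hx
  obtain ⟨y, hy⟩ := (LinearMap.injective_iff_surjective.1 hinj) 1
  exact IsUnit.of_mul_eq_one y hy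

/-- The denominator of the Möbius action is invertible on `U(n, n, 𝔽)`. -/
theorem isUnit_mobius_denom [StarInner 𝔽] {g : Matrix (ι ⊕ ι) (ι ⊕ ι) 𝔽}
    (hg : g ∈ splitUnitary ι 𝔽) {q : Matrix ι ι 𝔽} (hq : q ∈ compactU ι 𝔽) :
    IsUnit (g.toBlocks₂₁ * q + g.toBlocks₂₂) := by
  refine isUnit_of_mul_eq_zero fun x hx => ?_
  have hqq : qᴴ * q = 1 := hq.1
  have hcol : g * blockCol (q * x) x =
      blockCol ((g.toBlocks₁₁ * q + g.toBlocks₁₂) * x) 0 := by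
    rw [mul_blockCol_mul, hx]
  -- The column `(q x, x)` is isotropic since `q` is unitary. Its image under `g` is isotropic with
  -- second entry zero, so the first entry vanishes by definiteness; `g` being injective, `x = 0`.
  have hform : (g * blockCol (q * x) x)ᴴ * splitForm ι 𝔽 * (g * blockCol (q * x) x) =
      (blockCol (q * x) x)ᴴ * splitForm ι 𝔽 * blockCol (q * x) x := by
    have hg' : gᴴ * splitForm ι 𝔽 * g = splitForm ι 𝔽 := hg
    rw [Matrix.conjTranspose_mul]
    calc _ = (blockCol (q * x) x)ᴴ * (gᴴ * splitForm ι 𝔽 * g) * blockCol (q * x) x := by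
          simp only [mul_assoc]
      _ = _ := by rw [hg']
  rw [hcol, blockCol_form, blockCol_form] at hform
  have h1 := (blockCol_inj hform).1
  have h2 : (q * x)ᴴ * (q * x) = xᴴ * x := by
    rw [Matrix.conjTranspose_mul, mul_assoc, ← mul_assoc qᴴ, hqq, one_mul]
  rw [h2, sub_self, mul_zero, sub_zero] at h1
  have h3 := eq_zero_of_conjTranspose_mul_self h1
  rw [h3] at hcol
  have h4 : blockCol (q * x) x = blockCol 0 0 := by
    refine splitUnitary_mul_left_cancel hg ?_
    rw [hcol, mul_blockCol]
    simp
  exact (blockCol_inj h4).2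

variable (ι 𝔽) in
/-- The pairs `(g, q)` for which the Möbius transform `g * q` is defined. -/
def mobiusDomain : Set (Matrix (ι ⊕ ι) (ι ⊕ ι) 𝔽 × Matrix ι ι 𝔽) :=
  {p | IsUnit (p.1.toBlocks₂₁ * p.2 + p.1.toBlocks₂₂)}

theorem contDiff_toBlocks₁₁ : ContDiff ℝ ∞
    (fun g : Matrix (ι ⊕ ι) (ι ⊕ ι) 𝔽 => g.toBlocks₁₁) :=
  (LinearMap.toContinuousLinearMap
    { toFun := fun g : Matrix (ι ⊕ ι) (ι ⊕ ι) 𝔽 => g.toBlocks₁₁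
      map_add' := fun _ _ => rfl
      map_smul' := fun _ _ => rfl } : _ →L[ℝ] Matrix ι ι 𝔽).contDiff

theorem contDiff_toBlocks₁₂ : ContDiff ℝ ∞
    (fun g : Matrix (ι ⊕ ι) (ι ⊕ ι) 𝔽 => g.toBlocks₁₂) :=
  (LinearMap.toContinuousLinearMap
    { toFun := fun g : Matrix (ι ⊕ ι) (ι ⊕ ι) 𝔽 => g.toBlocks₁₂
      map_add' := fun _ _ => rfl
      map_smul' := fun _ _ => rfl } : _ →L[ℝ] Matrix ι ι 𝔽).contDiff

theorem contDiff_toBlocks₂₁ : ContDiff ℝ ∞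
    (fun g : Matrix (ι ⊕ ι) (ι ⊕ ι) 𝔽 => g.toBlocks₂₁) :=
  (LinearMap.toContinuousLinearMap
    { toFun := fun g : Matrix (ι ⊕ ι) (ι ⊕ ι) 𝔽 => g.toBlocks₂₁
      map_add' := fun _ _ => rfl
      map_smul' := fun _ _ => rfl } : _ →L[ℝ] Matrix ι ι 𝔽).contDiff

theorem contDiff_toBlocks₂₂ : ContDiff ℝ ∞
    (fun g : Matrix (ι ⊕ ι) (ι ⊕ ι) 𝔽 => g.toBlocks₂₂) :=
  (LinearMap.toContinuousLinearMap
    { toFun := fun g : Matrix (ι ⊕ ι) (ι ⊕ ι) 𝔽 => g.toBlocks₂₂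
      map_add' := fun _ _ => rfl
      map_smul' := fun _ _ => rfl } : _ →L[ℝ] Matrix ι ι 𝔽).contDiff

theorem contDiff_mobius_denom : ContDiff ℝ ∞
    (fun p : Matrix (ι ⊕ ι) (ι ⊕ ι) 𝔽 × Matrix ι ι 𝔽 =>
      p.1.toBlocks₂₁ * p.2 + p.1.toBlocks₂₂) :=
  ((contDiff_toBlocks₂₁.comp contDiff_fst).mul contDiff_snd).add
    (contDiff_toBlocks₂₂.comp contDiff_fst)

theorem contDiff_mobius_num : ContDiff ℝ ∞
    (fun p : Matrix (ι ⊕ ι) (ι ⊕ ι) 𝔽 × Matrix ι ι 𝔽 =>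
      p.1.toBlocks₁₁ * p.2 + p.1.toBlocks₁₂) :=
  ((contDiff_toBlocks₁₁.comp contDiff_fst).mul contDiff_snd).add
    (contDiff_toBlocks₁₂.comp contDiff_fst)

theorem isOpen_mobiusDomain : IsOpen (mobiusDomain ι 𝔽) :=
  have h : IsOpen {x : Matrix ι ι 𝔽 | IsUnit x} := Units.isOpen
  h.preimage contDiff_mobius_denom.continuous

theorem contDiffOn_mobius : ContDiffOn ℝ ∞
    (fun p : Matrix (ι ⊕ ι) (ι ⊕ ι) 𝔽 × Matrix ι ι 𝔽 => mobius p.1 p.2) (mobiusDomain ι 𝔽) :=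
  contDiff_mobius_num.contDiffOn.mul
    (contDiff_mobius_denom.contDiffOn.ringInverse fun _ hp => hp)

theorem hasFDerivAt_mobius {g : Matrix (ι ⊕ ι) (ι ⊕ ι) 𝔽} {q : Matrix ι ι 𝔽}
    (h : (g, q) ∈ mobiusDomain ι 𝔽) :
    HasFDerivAt (fun h : Matrix (ι ⊕ ι) (ι ⊕ ι) 𝔽 => mobius h q)
      ((fderiv ℝ (fun p : Matrix (ι ⊕ ι) (ι ⊕ ι) 𝔽 × Matrix ι ι 𝔽 => mobius p.1 p.2) (g, q)).comp
        (ContinuousLinearMap.inl ℝ _ _)) g := by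
  have h1 := ((contDiffOn_mobius.contDiffAt
    (isOpen_mobiusDomain.mem_nhds h)).differentiableAt (by simp)).hasFDerivAt
  exact HasFDerivAt.comp (f := fun h : Matrix (ι ⊕ ι) (ι ⊕ ι) 𝔽 => (h, q)) g h1
    (hasFDerivAt_prodMk_left g q)

/-- The velocity of the Möbius action satisfies the differentiated equation
`(g * q) (C q + D) = A q + B`. -/
theorem mobiusVelocity_mul_denom {g : Matrix (ι ⊕ ι) (ι ⊕ ι) 𝔽} {q : Matrix ι ι 𝔽}
    (h : (g, q) ∈ mobiusDomain ι 𝔽) (X : Matrix (ι ⊕ ι) (ι ⊕ ι) 𝔽) :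
    mobius g q * (X.toBlocks₂₁ * q + X.toBlocks₂₂) +
      mobiusVelocity g X q * (g.toBlocks₂₁ * q + g.toBlocks₂₂) =
      X.toBlocks₁₁ * q + X.toBlocks₁₂ := by
  let den : Matrix (ι ⊕ ι) (ι ⊕ ι) 𝔽 →L[ℝ] Matrix ι ι 𝔽 := LinearMap.toContinuousLinearMap
    { toFun := fun g : Matrix (ι ⊕ ι) (ι ⊕ ι) 𝔽 => g.toBlocks₂₁ * q + g.toBlocks₂₂
      map_add' := fun x y => by
        change (x.toBlocks₂₁ + y.toBlocks₂₁) * q + (x.toBlocks₂₂ + y.toBlocks₂₂) = _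
        rw [add_mul]; abel
      map_smul' := fun r x => by
        change (r • x.toBlocks₂₁) * q + r • x.toBlocks₂₂ = _
        rw [smul_mul_assoc, ← smul_add]; rfl }
  let num : Matrix (ι ⊕ ι) (ι ⊕ ι) 𝔽 →L[ℝ] Matrix ι ι 𝔽 := LinearMap.toContinuousLinearMap
    { toFun := fun g : Matrix (ι ⊕ ι) (ι ⊕ ι) 𝔽 => g.toBlocks₁₁ * q + g.toBlocks₁₂
      map_add' := fun x y => by
        change (x.toBlocks₁₁ + y.toBlocks₁₁) * q + (x.toBlocks₁₂ + y.toBlocks₁₂) = _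
        rw [add_mul]; abel
      map_smul' := fun r x => by
        change (r • x.toBlocks₁₁) * q + r • x.toBlocks₁₂ = _
        rw [smul_mul_assoc, ← smul_add]; rfl }
  have hmob := (hasFDerivAt_mobius h).differentiableAt.hasFDerivAt
  have h1 : HasFDerivAt (fun h => mobius h q * den h) _ g := hmob.mul' den.hasFDerivAt
  have h2 : HasFDerivAt (fun h => mobius h q * den h) num g := by
    refine num.hasFDerivAt.congr_of_eventuallyEq ?_
    have hopen : IsOpen {h : Matrix (ι ⊕ ι) (ι ⊕ ι) 𝔽 | IsUnit (den h)} :=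
      Units.isOpen.preimage den.continuous
    filter_upwards [hopen.mem_nhds (show IsUnit (den g) from h)] with h hh
    change (h.toBlocks₁₁ * q + h.toBlocks₁₂) * Ring.inverse (den h) * den h = num h
    rw [mul_assoc, Ring.inverse_mul_cancel _ hh, mul_one]
    rfl
  have h3 := congrArg (fun l => l X) (h1.unique h2)
  exact h3

/-- A tangent vector `g ξ` whose velocity vanishes at `q` comes from a vector `ξ` whose
infinitesimal action vanishes at `q`. -/
theorem infinitesimal_eq_of_mobiusVelocity_eq_zero [StarInner 𝔽]
    {g ξ : Matrix (ι ⊕ ι) (ι ⊕ ι) 𝔽}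
    (hg : g ∈ splitUnitary ι 𝔽) {q : Matrix ι ι 𝔽} (hq : q ∈ compactU ι 𝔽)
    (h : mobiusVelocity g (g * ξ) q = 0) :
    ξ.toBlocks₁₁ * q + ξ.toBlocks₁₂ = q * (ξ.toBlocks₂₁ * q + ξ.toBlocks₂₂) := by
  have hd : IsUnit (g.toBlocks₂₁ * q + g.toBlocks₂₂) := isUnit_mobius_denom hg hq
  have hv := mobiusVelocity_mul_denom (g := g) (q := q) hd (g * ξ)
  rw [h, zero_mul, add_zero, mobius] at hv
  have hcols : g * blockCol (ξ.toBlocks₁₁ * q + ξ.toBlocks₁₂)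
      (ξ.toBlocks₂₁ * q + ξ.toBlocks₂₂) =
      blockCol ((g * ξ).toBlocks₁₁ * q + (g * ξ).toBlocks₁₂)
        ((g * ξ).toBlocks₂₁ * q + (g * ξ).toBlocks₂₂) := by
    have e1 : blockCol (ξ.toBlocks₁₁ * q + ξ.toBlocks₁₂) (ξ.toBlocks₂₁ * q + ξ.toBlocks₂₂) =
        ξ * blockCol q 1 := by rw [mul_blockCol, mul_one, mul_one]
    rw [e1, ← mul_assoc, mul_blockCol (g * ξ), mul_one, mul_one]
  set y := (g * ξ).toBlocks₂₁ * q + (g * ξ).toBlocks₂₂ with hy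
  -- Zero velocity means that `g ξ (q, 1)` is the multiple `g (q, 1) s` of the column `g (q, 1)`.
  -- Cancelling `g` leaves `ξ (q, 1) = (q s, s)`.
  set s := Ring.inverse (g.toBlocks₂₁ * q + g.toBlocks₂₂) * y with hs
  have hgs : g * blockCol (q * s) s = blockCol ((g * ξ).toBlocks₁₁ * q + (g * ξ).toBlocks₁₂) y := by
    rw [mul_blockCol_mul, ← hv, hs, ← mul_assoc, ← mul_assoc, Ring.mul_inverse_cancel _ hd, one_mul]
  have := splitUnitary_mul_left_cancel hg (hcols.trans hgs.symm)
  obtain ⟨h1, h2⟩ := blockCol_inj this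
  rw [h1, h2]

end Mobius

/-! ### The kinetic energy metric -/

section KineticMetric

universe u

variable {ι : Type u} [Fintype ι] [DecidableEq ι]
  {𝔽 : Type u} [NormedDivisionRing 𝔽] [InnerProductSpace ℝ 𝔽] [StarRing 𝔽] [StarModule ℝ 𝔽]
  [IsScalarTower ℝ 𝔽 𝔽] [SMulCommClass ℝ 𝔽 𝔽] [FiniteDimensional ℝ 𝔽] [StarInner 𝔽]
  {M : Set (Matrix ι ι 𝔽)}

theorem isCompact_of_subset_compactU (hM : IsClosed M) (h : M ⊆ compactU ι 𝔽) : IsCompact M := by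
  have : ProperSpace (Matrix ι ι 𝔽) := FiniteDimensional.proper_real _
  refine (isCompact_closedBall (0 : Matrix ι ι 𝔽) ‖(1 : Matrix ι ι 𝔽)‖).of_isClosed_subset hM ?_
  intro q hq
  rw [mem_closedBall_zero_iff]
  have h1 : qᴴ * q = 1 := (h hq).1
  have h2 := matrixInner_mul_left q 1 q
  rw [mul_one, h1, matrixInner_self, matrixInner_self] at h2
  exact (pow_le_pow_iff_left₀ (norm_nonneg _) (norm_nonneg _) two_ne_zero).1 h2.le

theorem euclideanHausdorffMeasure_ne_top [MeasurableSpace (Matrix ι ι 𝔽)] [BorelSpace (Matrix ι ι 𝔽)]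
    (hM : IsClosed M) (hMc : IsComponentUnion (adjointGroup (conjTransposeL ι 𝔽) ∅) M) :
    (μHE[unitaryDim ι 𝔽] : Measure (Matrix ι ι 𝔽)) M ≠ ⊤ := by
  obtain ⟨c, -, hc⟩ := euclideanHausdorffMeasure_eq_smul (E := Matrix ι ι 𝔽) (unitaryDim ι 𝔽)
  rw [hc, Measure.smul_apply, unitaryDim_eq]
  have h1 : μH[(Module.finrank ℝ (adjointAlgebra (conjTransposeL ι 𝔽) ∅) : ℝ)] M ≠ ⊤ :=
    hausdorffMeasure_ne_top_of_chart
      (isCompact_of_subset_compactU hM (compactU_eq_adjointGroup (ι := ι) (𝔽 := 𝔽) ▸ hMc.1))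
      fun x hx => exists_cayley_chart isAntiInvolution_conjTransposeL hMc hx
  exact ENNReal.mul_ne_top ENNReal.coe_ne_top h1

theorem euclideanHausdorffMeasure_inter_ne_zero [MeasurableSpace (Matrix ι ι 𝔽)]
    [BorelSpace (Matrix ι ι 𝔽)]
    (hMc : IsComponentUnion (adjointGroup (conjTransposeL ι 𝔽) ∅) M)
    {O : Set (Matrix ι ι 𝔽)} (hO : IsOpen O) {x : Matrix ι ι 𝔽} (hx : x ∈ M) (hxO : x ∈ O) :
    (μHE[unitaryDim ι 𝔽] : Measure (Matrix ι ι 𝔽)) (O ∩ M) ≠ 0 := by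
  obtain ⟨c, hc0, hc⟩ := euclideanHausdorffMeasure_eq_smul (E := Matrix ι ι 𝔽) (unitaryDim ι 𝔽)
  rw [hc, Measure.smul_apply, unitaryDim_eq]
  have h1 : μH[(Module.finrank ℝ (adjointAlgebra (conjTransposeL ι 𝔽) ∅) : ℝ)] (O ∩ M) ≠ 0 :=
    hausdorffMeasure_inter_ne_zero_of_chart
      (fun x hx => exists_cayley_chart isAntiInvolution_conjTransposeL hMc hx) hO hx hxO
  exact mul_ne_zero (by exact_mod_cast hc0) h1

/-- The derivative of the Möbius action in the direction of the group. -/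
def mobiusVelocityL (p : Matrix (ι ⊕ ι) (ι ⊕ ι) 𝔽 × Matrix ι ι 𝔽) :
    Matrix (ι ⊕ ι) (ι ⊕ ι) 𝔽 →L[ℝ] Matrix ι ι 𝔽 :=
  (fderiv ℝ (fun p : Matrix (ι ⊕ ι) (ι ⊕ ι) 𝔽 × Matrix ι ι 𝔽 => mobius p.1 p.2) p).comp
    (ContinuousLinearMap.inl ℝ _ _)

theorem mobiusVelocity_eq {g : Matrix (ι ⊕ ι) (ι ⊕ ι) 𝔽} {q : Matrix ι ι 𝔽}
    (h : (g, q) ∈ mobiusDomain ι 𝔽) (X : Matrix (ι ⊕ ι) (ι ⊕ ι) 𝔽) :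
    mobiusVelocity g X q = mobiusVelocityL (g, q) X :=
  congrArg (fun l => l X) (hasFDerivAt_mobius h).fderiv

theorem contDiffOn_mobiusVelocityL :
    ContDiffOn ℝ ∞ (mobiusVelocityL (ι := ι) (𝔽 := 𝔽)) (mobiusDomain ι 𝔽) :=
  (contDiffOn_mobius.fderiv_of_isOpen isOpen_mobiusDomain (by simp)).clm_comp contDiffOn_const

/-- The pull-back of the inner product of matrices by the derivative of the Möbius action. -/
def mobiusForm (p : Matrix (ι ⊕ ι) (ι ⊕ ι) 𝔽 × Matrix ι ι 𝔽) :
    Matrix (ι ⊕ ι) (ι ⊕ ι) 𝔽 →L[ℝ] Matrix (ι ⊕ ι) (ι ⊕ ι) 𝔽 →L[ℝ] ℝ :=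
  ((matrixInnerL.comp (mobiusVelocityL p)).flip.comp (mobiusVelocityL p)).flip

theorem mobiusForm_apply (p : Matrix (ι ⊕ ι) (ι ⊕ ι) 𝔽 × Matrix ι ι 𝔽)
    (X Y : Matrix (ι ⊕ ι) (ι ⊕ ι) 𝔽) :
    mobiusForm p X Y = matrixInner (mobiusVelocityL p X) (mobiusVelocityL p Y) := rfl

theorem contDiffOn_mobiusForm :
    ContDiffOn ℝ ∞ (mobiusForm (ι := ι) (𝔽 := 𝔽)) (mobiusDomain ι 𝔽) := by
  have h1 : ContDiffOn ℝ ∞ (fun p => (matrixInnerL.comp (mobiusVelocityL (ι := ι) (𝔽 := 𝔽) p)))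
      (mobiusDomain ι 𝔽) := contDiffOn_const.clm_comp contDiffOn_mobiusVelocityL
  have h2 := (ContinuousLinearMap.flipₗᵢ ℝ (Matrix (ι ⊕ ι) (ι ⊕ ι) 𝔽) (Matrix ι ι 𝔽)
    ℝ).toContinuousLinearEquiv.contDiff.comp_contDiffOn h1
  exact (ContinuousLinearMap.flipₗᵢ ℝ (Matrix (ι ⊕ ι) (ι ⊕ ι) 𝔽) (Matrix (ι ⊕ ι) (ι ⊕ ι) 𝔽)
    ℝ).toContinuousLinearEquiv.contDiff.comp_contDiffOn (h2.clm_comp contDiffOn_mobiusVelocityL)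

theorem isOpen_setOf_forall_mem_mobiusDomain (hM : IsCompact M) :
    IsOpen {g : Matrix (ι ⊕ ι) (ι ⊕ ι) 𝔽 | ∀ q ∈ M, (g, q) ∈ mobiusDomain ι 𝔽} := by
  rw [isOpen_iff_mem_nhds]
  intro g hg
  obtain ⟨u, v, hu, -, hgu, hMv, huv⟩ := generalized_tube_lemma (isCompact_singleton (x := g)) hM
    isOpen_mobiusDomain (by rintro ⟨a, b⟩ ⟨rfl, hb⟩; exact hg b hb)
  filter_upwards [hu.mem_nhds (hgu rfl)] with h hh q hq using huv ⟨hh, hMv hq⟩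

/-- The kinetic energy metric is a Riemannian metric on a subset `G` of `U(n, n, 𝔽)` with tangent
space `𝔤` at the identity if no vector of `𝔤` other than zero acts trivially. -/
theorem isRiemannianOn_kineticMetric (hM : IsClosed M)
    (hMc : IsComponentUnion (adjointGroup (conjTransposeL ι 𝔽) ∅) M)
    {G : Set (Matrix (ι ⊕ ι) (ι ⊕ ι) 𝔽)} {𝔤 : Submodule ℝ (Matrix (ι ⊕ ι) (ι ⊕ ι) 𝔽)}
    (hG : G ⊆ splitUnitary ι 𝔽)
    (h𝔤 : ∀ ξ ∈ 𝔤, (∀ q ∈ M, ξ.toBlocks₁₁ * q + ξ.toBlocks₁₂ =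
      q * (ξ.toBlocks₂₁ * q + ξ.toBlocks₂₂)) → ξ = 0) :
    IsRiemannianOn (kineticMetric M) G 𝔤 := by
  let _ : MeasurableSpace (Matrix ι ι 𝔽) := borel _
  have : BorelSpace (Matrix ι ι 𝔽) := ⟨rfl⟩
  have hMU : M ⊆ compactU ι 𝔽 := compactU_eq_adjointGroup (ι := ι) (𝔽 := 𝔽) ▸ hMc.1
  have hMk : IsCompact M := isCompact_of_subset_compactU hM hMU
  have hμ := euclideanHausdorffMeasure_ne_top hM hMc
  have hGO : ∀ g ∈ G, ∀ q ∈ M, (g, q) ∈ mobiusDomain ι 𝔽 := fun g hg q hq =>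
    isUnit_mobius_denom (hG hg) (hMU hq)
  have hcont : ∀ g, (∀ q ∈ M, (g, q) ∈ mobiusDomain ι 𝔽) →
      ContinuousOn (fun q => mobiusForm (g, q)) M := fun g hg =>
    (contDiffOn_mobiusForm (ι := ι) (𝔽 := 𝔽)).continuousOn.comp (by fun_prop) fun q hq => hg q hq
  have hval : ∀ g, (∀ q ∈ M, (g, q) ∈ mobiusDomain ι 𝔽) → ∀ v w, kineticMetric M g v w =
      ∫ q in M, mobiusForm (g, q) v w ∂μHE[unitaryDim ι 𝔽] := by
    intro g hg v w
    refine setIntegral_congr_fun hM.measurableSet fun q hq => ?_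
    rw [mobiusForm_apply, mobiusVelocity_eq (hg q hq), mobiusVelocity_eq (hg q hq)]
  refine ⟨⟨{g | ∀ q ∈ M, (g, q) ∈ mobiusDomain ι 𝔽},
    fun g => ∫ q in M, mobiusForm (g, q) ∂μHE[unitaryDim ι 𝔽],
    isOpen_setOf_forall_mem_mobiusDomain hMk, hGO, ?_, ?_⟩, ?_, ?_⟩
  · exact_mod_cast contDiffOn_setIntegral hMk hμ isOpen_mobiusDomain
      (isOpen_setOf_forall_mem_mobiusDomain hMk) (fun g hg q hq => hg q hq) 2
      (contDiffOn_mobiusForm.of_le two_le_infty)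
  · intro g hg v w
    have hi : IntegrableOn (fun q => mobiusForm (g, q)) M μHE[unitaryDim ι 𝔽] :=
      (hcont g hg).integrableOn_of_subset_isCompact hMk hM.measurableSet subset_rfl hμ
    rw [hval g hg, ContinuousLinearMap.integral_apply hi,
      ContinuousLinearMap.integral_apply (hi.apply_continuousLinearMap v)]
  · intro g v w
    simp only [kineticMetric, matrixInner_comm]
  · intro g hg ξ hξ h0
    refine h𝔤 ξ hξ fun q hq => infinitesimal_eq_of_mobiusVelocity_eq_zero (hG hg) (hMU hq) ?_
    rw [hval g (hGO g hg)] at h0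
    have hc : ContinuousOn (fun q => mobiusForm (g, q) (g * ξ) (g * ξ)) M :=
      ((hcont g (hGO g hg)).clm_apply continuousOn_const).clm_apply continuousOn_const
    have hi : IntegrableOn (fun q => mobiusForm (g, q) (g * ξ) (g * ξ)) M μHE[unitaryDim ι 𝔽] :=
      hc.integrableOn_of_subset_isCompact hMk hM.measurableSet subset_rfl hμ
    have hnn : ∀ q, 0 ≤ mobiusForm (g, q) (g * ξ) (g * ξ) := fun q => by
      rw [mobiusForm_apply, matrixInner_self]
      positivity
    rw [mobiusVelocity_eq (hGO g hg q hq), ← matrixInner_self_eq_zero, ← mobiusForm_apply]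
    -- A positive value at `q` persists on a relatively open part of `M`, which has positive volume;
    -- this contradicts the vanishing of the integral of a nonnegative function.
    by_contra hne
    have hpos : 0 < mobiusForm (g, q) (g * ξ) (g * ξ) := lt_of_le_of_ne (hnn q) (Ne.symm hne)
    have hnhds := (hc q hq).preimage_mem_nhdsWithin (isOpen_Ioi.mem_nhds hpos)
    obtain ⟨O, hO, hqO, hOM⟩ := mem_nhdsWithin.1 hnhds
    have hz := (integral_eq_zero_iff_of_nonneg hnn hi).1 h0
    rw [Filter.EventuallyEq, ae_restrict_iff' hM.measurableSet] at hz
    refine euclideanHausdorffMeasure_inter_ne_zero hMc hO hq hqO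
      (measure_mono_null (fun y hy => ?_) hz)
    intro hyz
    exact (hOM hy).ne' (hyz hy.2)

end KineticMetric

/-! ### Involutions and the invariance of the kinetic energy metric -/

section Invariance

universe u

variable {ι : Type u} [Fintype ι] [DecidableEq ι]
  {𝔽 : Type u} [NormedDivisionRing 𝔽] [InnerProductSpace ℝ 𝔽] [StarRing 𝔽] [StarModule ℝ 𝔽]
  [IsScalarTower ℝ 𝔽 𝔽] [SMulCommClass ℝ 𝔽 𝔽]

/-- An algebra endomorphism of the matrices that acts on each of the four blocks. -/
def blockHom (t : Matrix ι ι 𝔽 →ₐ[ℝ] Matrix ι ι 𝔽) :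
    Matrix (ι ⊕ ι) (ι ⊕ ι) 𝔽 →ₐ[ℝ] Matrix (ι ⊕ ι) (ι ⊕ ι) 𝔽 :=
  AlgHom.ofLinearMap
    { toFun := fun g => Matrix.fromBlocks (t g.toBlocks₁₁) (t g.toBlocks₁₂) (t g.toBlocks₂₁)
        (t g.toBlocks₂₂)
      map_add' := fun g h => by
        have e : (g + h).toBlocks₁₁ = g.toBlocks₁₁ + h.toBlocks₁₁ ∧
          (g + h).toBlocks₁₂ = g.toBlocks₁₂ + h.toBlocks₁₂ ∧
          (g + h).toBlocks₂₁ = g.toBlocks₂₁ + h.toBlocks₂₁ ∧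
          (g + h).toBlocks₂₂ = g.toBlocks₂₂ + h.toBlocks₂₂ := ⟨rfl, rfl, rfl, rfl⟩
        rw [e.1, e.2.1, e.2.2.1, e.2.2.2, map_add, map_add, map_add, map_add,
          Matrix.fromBlocks_add]
      map_smul' := fun r g => by
        have e : (r • g).toBlocks₁₁ = r • g.toBlocks₁₁ ∧ (r • g).toBlocks₁₂ = r • g.toBlocks₁₂ ∧
          (r • g).toBlocks₂₁ = r • g.toBlocks₂₁ ∧
          (r • g).toBlocks₂₂ = r • g.toBlocks₂₂ := ⟨rfl, rfl, rfl, rfl⟩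
        rw [e.1, e.2.1, e.2.2.1, e.2.2.2, map_smul, map_smul, map_smul, map_smul,
          ← Matrix.fromBlocks_smul, RingHom.id_apply] }
    (by
      change Matrix.fromBlocks _ _ _ _ = _
      rw [← Matrix.fromBlocks_one, Matrix.toBlocks_fromBlocks₁₁, Matrix.toBlocks_fromBlocks₁₂,
        Matrix.toBlocks_fromBlocks₂₁, Matrix.toBlocks_fromBlocks₂₂, map_one, map_zero])
    (fun g h => by
      change Matrix.fromBlocks _ _ _ _ = Matrix.fromBlocks _ _ _ _ * Matrix.fromBlocks _ _ _ _
      have e := Matrix.fromBlocks_multiply g.toBlocks₁₁ g.toBlocks₁₂ g.toBlocks₂₁ g.toBlocks₂₂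
        h.toBlocks₁₁ h.toBlocks₁₂ h.toBlocks₂₁ h.toBlocks₂₂
      rw [Matrix.fromBlocks_toBlocks, Matrix.fromBlocks_toBlocks] at e
      rw [Matrix.fromBlocks_multiply, e, Matrix.toBlocks_fromBlocks₁₁,
        Matrix.toBlocks_fromBlocks₁₂, Matrix.toBlocks_fromBlocks₂₁, Matrix.toBlocks_fromBlocks₂₂]
      simp only [map_add, map_mul])

theorem blockHom_apply (t : Matrix ι ι 𝔽 →ₐ[ℝ] Matrix ι ι 𝔽) (g : Matrix (ι ⊕ ι) (ι ⊕ ι) 𝔽) :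
    blockHom t g = Matrix.fromBlocks (t g.toBlocks₁₁) (t g.toBlocks₁₂) (t g.toBlocks₂₁)
      (t g.toBlocks₂₂) := rfl

/-- Involutive automorphisms of the algebra of matrices with involution and inner product. -/
structure IsMatrixInvolution (t : Matrix ι ι 𝔽 →ₐ[ℝ] Matrix ι ι 𝔽) : Prop where
  involutive : ∀ A, t (t A) = A
  map_conjTranspose : ∀ A, t Aᴴ = (t A)ᴴ
  inner_map : ∀ A B, matrixInner (t A) (t B) = matrixInner A B

namespace IsMatrixInvolution

variable {t : Matrix ι ι 𝔽 →ₐ[ℝ] Matrix ι ι 𝔽}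

theorem blockHom_involutive (ht : IsMatrixInvolution t) (g : Matrix (ι ⊕ ι) (ι ⊕ ι) 𝔽) :
    blockHom t (blockHom t g) = g := by
  simp [blockHom_apply, ht.involutive, Matrix.fromBlocks_toBlocks]

theorem splitAdjoint_blockHom (ht : IsMatrixInvolution t) (g : Matrix (ι ⊕ ι) (ι ⊕ ι) 𝔽) :
    splitAdjoint ι 𝔽 (blockHom t g) = blockHom t (splitAdjoint ι 𝔽 g) := by
  rw [splitAdjoint_apply, splitAdjoint_apply, map_mul, map_mul]
  have h1 : blockHom t (splitForm ι 𝔽) = splitForm ι 𝔽 := by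
    simp [blockHom_apply, splitForm]
  have h2 : blockHom t gᴴ = (blockHom t g)ᴴ := by
    rw [blockHom_apply, blockHom_apply, Matrix.fromBlocks_conjTranspose, ← ht.map_conjTranspose,
      ← ht.map_conjTranspose, ← ht.map_conjTranspose, ← ht.map_conjTranspose]
    rfl
  rw [h1, h2]

theorem blockHom_mem_splitUnitary (ht : IsMatrixInvolution t)
    {g : Matrix (ι ⊕ ι) (ι ⊕ ι) 𝔽} (hg : g ∈ splitUnitary ι 𝔽) :
    blockHom t g ∈ splitUnitary ι 𝔽 := by
  rw [mem_splitUnitary_iff] at hg ⊢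
  rw [ht.splitAdjoint_blockHom, ← map_mul, hg, map_one]

/-- Since `t` is bijective it preserves nonunits, at which both sides are 0. The equivariance of the
Möbius transform and the invariance of the metric thus hold at all matrices, as the argument on
energies requires. -/
theorem map_ringInverse (ht : IsMatrixInvolution t) (x : Matrix ι ι 𝔽) :
    t (Ring.inverse x) = Ring.inverse (t x) := by
  by_cases hx : IsUnit x
  · exact map_ringInverse_of_isUnit t hx
  · have hx' : ¬ IsUnit (t x) := fun h => hx (ht.involutive x ▸ h.map t)
    rw [Ring.inverse_non_unit _ hx, Ring.inverse_non_unit _ hx', map_zero]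

theorem mobius_map (ht : IsMatrixInvolution t) (g : Matrix (ι ⊕ ι) (ι ⊕ ι) 𝔽) (q : Matrix ι ι 𝔽) :
    mobius (blockHom t g) (t q) = t (mobius g q) := by
  simp only [mobius, blockHom_apply, Matrix.toBlocks_fromBlocks₁₁, Matrix.toBlocks_fromBlocks₁₂,
    Matrix.toBlocks_fromBlocks₂₁, Matrix.toBlocks_fromBlocks₂₂]
  rw [map_mul, ht.map_ringInverse, map_add, map_add, map_mul, map_mul]

variable [FiniteDimensional ℝ 𝔽]

/-- Derivatives commute with composition with linear equivalences, even where the function is not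
differentiable. -/
theorem mobiusVelocity_map (ht : IsMatrixInvolution t) (g X : Matrix (ι ⊕ ι) (ι ⊕ ι) 𝔽)
    (q : Matrix ι ι 𝔽) :
    mobiusVelocity (blockHom t g) (blockHom t X) (t q) = t (mobiusVelocity g X q) := by
  let tL : Matrix ι ι 𝔽 ≃L[ℝ] Matrix ι ι 𝔽 :=
    (LinearEquiv.ofInvolutive t.toLinearMap ht.involutive).toContinuousLinearEquiv
  let sL : Matrix (ι ⊕ ι) (ι ⊕ ι) 𝔽 ≃L[ℝ] Matrix (ι ⊕ ι) (ι ⊕ ι) 𝔽 :=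
    (LinearEquiv.ofInvolutive (blockHom t).toLinearMap
      ht.blockHom_involutive).toContinuousLinearEquiv
  have hfun : (fun h => mobius h (t q)) ∘ sL = tL ∘ (fun h => mobius h q) :=
    funext fun h => ht.mobius_map h q
  have h1 := sL.comp_right_fderiv (f := fun h => mobius h (t q)) (x := g)
  rw [hfun, tL.comp_fderiv] at h1
  exact (congrArg (fun l => l X) h1).symm

theorem isometry (ht : IsMatrixInvolution t) : Isometry t := by
  refine AddMonoidHomClass.isometry_of_norm t fun A => ?_
  have := ht.inner_map A A
  rw [matrixInner_self, matrixInner_self] at this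
  exact (pow_left_inj₀ (norm_nonneg _) (norm_nonneg _) two_ne_zero).1 this

/-- The kinetic energy metric is invariant under the involution induced by an involution of `M`. -/
theorem kineticMetric_map (ht : IsMatrixInvolution t) {M : Set (Matrix ι ι 𝔽)}
    (hM : ∀ q ∈ M, t q ∈ M)
    (g X Y : Matrix (ι ⊕ ι) (ι ⊕ ι) 𝔽) :
    kineticMetric M (blockHom t g) (blockHom t X) (blockHom t Y) = kineticMetric M g X Y := by
  let _ : MeasurableSpace (Matrix ι ι 𝔽) := borel _
  have : BorelSpace (Matrix ι ι 𝔽) := ⟨rfl⟩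
  let e : Matrix ι ι 𝔽 ≃ᵢ Matrix ι ι 𝔽 := ⟨⟨t, t, ht.involutive, ht.involutive⟩, ht.isometry⟩
  have hpre : e ⁻¹' M = M := by
    ext q
    exact ⟨fun h => ht.involutive q ▸ hM _ h, fun h => hM q h⟩
  -- An isometry preserves the Hausdorff measure, so `q ↦ t q` is a measure-preserving change of
  -- variables on `M`.
  have h := (e.measurePreserving_euclideanHausdorffMeasure (unitaryDim ι 𝔽)).setIntegral_preimage_emb
    e.toHomeomorph.measurableEmbedding
    (fun q => matrixInner (mobiusVelocity (blockHom t g) (blockHom t X) q)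
      (mobiusVelocity (blockHom t g) (blockHom t Y) q)) M
  rw [hpre] at h
  refine h.symm.trans (congrArg (fun f => ∫ q in M, f q ∂μHE[unitaryDim ι 𝔽]) (funext fun q => ?_))
  change matrixInner (mobiusVelocity _ _ (t q)) (mobiusVelocity _ _ (t q)) = _
  rw [ht.mobiusVelocity_map, ht.mobiusVelocity_map, ht.inner_map]

end IsMatrixInvolution

variable [FiniteDimensional ℝ 𝔽] [StarInner 𝔽]

/-- The fixed points in `G` of an involution of the matrices that preserves `M` form a totally
geodesic submanifold for the kinetic energy metric, and so do unions of their components. -/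
theorem IsMatrixInvolution.isTotallyGeodesic {t : Matrix ι ι 𝔽 →ₐ[ℝ] Matrix ι ι 𝔽}
    (ht : IsMatrixInvolution t) {M : Set (Matrix ι ι 𝔽)} (htM : ∀ q ∈ M, t q ∈ M)
    {G N : Set (Matrix (ι ⊕ ι) (ι ⊕ ι) 𝔽)} {𝔤 : Submodule ℝ (Matrix (ι ⊕ ι) (ι ⊕ ι) 𝔽)}
    {S : Set (Matrix (ι ⊕ ι) (ι ⊕ ι) 𝔽 →ₐ[ℝ] Matrix (ι ⊕ ι) (ι ⊕ ι) 𝔽)}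
    (hG : IsLieSet G 𝔤) (hρ : IsRiemannianOn (kineticMetric M) G 𝔤)
    (hGS : G ⊆ adjointGroup (splitAdjoint ι 𝔽) S) (h𝔤S : 𝔤 ≤ adjointAlgebra (splitAdjoint ι 𝔽) S)
    (hσG : ∀ g ∈ G, blockHom t g ∈ G) (hσ𝔤 : ∀ X ∈ 𝔤, blockHom t X ∈ 𝔤) (hNG : N ⊆ G)
    (hN : IsComponentUnion (adjointGroup (splitAdjoint ι 𝔽) (insert (blockHom t) S)) N) :
    IsTotallyGeodesic (kineticMetric M) N G := by
  refine isTotallyGeodesic_of_involution (σ := blockHom t) hG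
    (isLieSet_of_isComponentUnion isAntiInvolution_splitAdjoint hN) hNG
    (isEmbeddedSubmanifold_of_isComponentUnion isAntiInvolution_splitAdjoint hN) hρ
    ht.blockHom_involutive (ht.kineticMetric_map htM) hσG
    (fun x hx => (hN.1 hx).2 _ (mem_insert _ _)) hσ𝔤 ?_ ?_
  · intro X hX hfix
    refine ⟨(h𝔤S hX).1, fun σ hσ => ?_⟩
    rcases hσ with rfl | hσ
    exacts [hfix, (h𝔤S hX).2 σ hσ]
  · intro T hTG hfix hT hTN
    refine hN.2 T (fun x hx => ⟨(hGS (hTG hx)).1, fun σ hσ => ?_⟩) hT hTN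
    rcases hσ with rfl | hσ
    exacts [hfix x hx, (hGS (hTG hx)).2 σ hσ]

end Invariance

/-! ### Connectedness of `U(n, n, 𝔽)` -/

section Connected

universe u

variable {E : Type u} [NormedRing E] [NormedAlgebra ℝ E] [CompleteSpace E]

theorem hasDerivAt_exp_smul (X : E) (t : ℝ) :
    HasDerivAt (fun t : ℝ => NormedSpace.exp (t • X)) (X * NormedSpace.exp (t • X)) t :=
  hasDerivAt_exp_smul_const' (𝕂 := ℝ) X t

theorem mul_exp_smul_of_mul_eq_zero {a X : E} (h : a * X = 0) (t : ℝ) :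
    a * NormedSpace.exp (t • X) = a := by
  have hd : ∀ t : ℝ, HasDerivAt (fun t : ℝ => a * NormedSpace.exp (t • X)) 0 t := fun t => by
    have := (hasDerivAt_exp_smul X t).const_mul a
    rwa [← mul_assoc, h, zero_mul] at this
  have := is_const_of_deriv_eq_zero (fun t => (hd t).differentiableAt) (fun t => (hd t).deriv) t 0
  simpa using this

theorem eq_zero_of_exp_smul_eq_one {X : E} (h : ∀ t : ℝ, NormedSpace.exp (t • X) = 1) : X = 0 := by
  have h1 := hasDerivAt_exp_smul X 0
  rw [funext h, h 0, mul_one] at h1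
  exact h1.unique (hasDerivAt_const _ _)

theorem isClosed_connectedComponentIn {X : Type*} [TopologicalSpace X] {F : Set X}
    (hF : IsClosed F) (x : X) : IsClosed (connectedComponentIn F x) := by
  by_cases hx : x ∈ F
  · refine isClosed_of_closure_subset ?_
    exact isPreconnected_connectedComponentIn.closure.subset_connectedComponentIn
      (subset_closure (mem_connectedComponentIn hx))
      (closure_minimal (connectedComponentIn_subset _ _) hF)
  · rw [connectedComponentIn_eq_empty hx]
    exact isClosed_empty

theorem isClosed_adjointGroup [FiniteDimensional ℝ E] (τ : E →ₗ[ℝ] E) (S : Set (E →ₐ[ℝ] E)) :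
    IsClosed (adjointGroup τ S) := by
  have h1 : IsClosed {a : E | τ a * a = 1} :=
    isClosed_eq (τ.continuous_of_finiteDimensional.mul continuous_id) continuous_const
  have h2 : IsClosed {a : E | ∀ σ ∈ S, σ a = a} := by
    simp only [ofPred_forall]
    exact isClosed_biInter fun σ _ =>
      isClosed_eq σ.toLinearMap.continuous_of_finiteDimensional continuous_id
  exact h1.inter h2

variable {ι : Type u} [Fintype ι] [DecidableEq ι]
  {𝔽 : Type u} [NormedDivisionRing 𝔽] [InnerProductSpace ℝ 𝔽] [StarRing 𝔽] [StarModule ℝ 𝔽]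
  [IsScalarTower ℝ 𝔽 𝔽] [SMulCommClass ℝ 𝔽 𝔽] [FiniteDimensional ℝ 𝔽] [StarInner 𝔽]

theorem matrixInner_sub_right (X Y Z : Matrix ι ι 𝔽) :
    matrixInner X (Y - Z) = matrixInner X Y - matrixInner X Z :=
  map_sub (matrixInnerL X) Y Z

theorem matrixInner_sub_left (X Y Z : Matrix ι ι 𝔽) :
    matrixInner (X - Y) Z = matrixInner X Z - matrixInner Y Z := by
  rw [matrixInner_comm, matrixInner_sub_right, matrixInner_comm, matrixInner_comm Z]

theorem matrixInner_neg_right (X Y : Matrix ι ι 𝔽) :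
    matrixInner X (-Y) = -matrixInner X Y :=
  map_neg (matrixInnerL X) Y

/-- If `g = g⁻¹` is of the form `bᴴ b` then it is the identity. -/
theorem conjTranspose_mul_self_eq_one {b : Matrix ι ι 𝔽} (h : bᴴ * b * (bᴴ * b) = 1) :
    bᴴ * b = 1 := by
  set y := bᴴ * b - 1 with hy
  have h1 : bᴴ * b * y = -y := by
    rw [hy, mul_sub, h, mul_one, neg_sub]
  have h2 : matrixInner (b * y) (b * y) = -matrixInner y y := by
    rw [matrixInner_mul_left, ← mul_assoc, h1, matrixInner_neg_right]
  rw [matrixInner_self, matrixInner_self] at h2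
  have h3 : ‖y‖ ^ 2 = 0 := by nlinarith [sq_nonneg ‖b * y‖, sq_nonneg ‖y‖]
  exact sub_eq_zero.1 (norm_eq_zero.1 (pow_eq_zero_iff two_ne_zero |>.1 h3))

theorem hasDerivAt_matrixInner_mul_exp (c b X : Matrix ι ι 𝔽) :
    HasDerivAt (fun t : ℝ => matrixInner c (b * NormedSpace.exp (t • X)))
      (matrixInner c (b * X)) 0 := by
  have h1 := (hasDerivAt_exp_smul X 0).const_mul b
  rw [zero_smul, NormedSpace.exp_zero, mul_one] at h1
  exact (matrixInnerL c).hasFDerivAt.comp_hasDerivAt (0 : ℝ) h1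

theorem hasDerivAt_matrixInner_self_mul_exp (b X : Matrix ι ι 𝔽) :
    HasDerivAt (fun t : ℝ => matrixInner (b * NormedSpace.exp (t • X))
      (b * NormedSpace.exp (t • X))) (2 * matrixInner (bᴴ * b) X) 0 := by
  have h1 := (hasDerivAt_exp_smul X 0).const_mul b
  rw [zero_smul, NormedSpace.exp_zero, mul_one] at h1
  have h2 := ContinuousLinearMap.hasDerivAt_of_bilinear
    (B := matrixInnerL (ι := ι) (𝔽 := 𝔽)) (fun _ => h1) (fun _ => h1)
  have h3 : matrixInner (b * X) b = matrixInner (bᴴ * b) X := by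
    rw [matrixInner_mul_left, matrixInner_comm]
  simp only [zero_smul, NormedSpace.exp_zero, mul_one, matrixInnerL_apply] at h2
  rwa [matrixInner_comm b, h3, ← two_mul] at h2

/-- Expand the square, with `u` and `1` of equal norm. The real trace of a unitary matrix is thus
strictly largest at the identity. -/
theorem matrixInner_one_le {u : Matrix ι ι 𝔽} (hu : uᴴ * u = 1) :
    matrixInner 1 u = matrixInner (1 : Matrix ι ι 𝔽) 1 - ‖1 - u‖ ^ 2 / 2 := by
  have h1 : matrixInner u u = matrixInner (1 : Matrix ι ι 𝔽) 1 := by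
    conv_lhs => rw [← mul_one u, matrixInner_mul_left, mul_one, hu]
  rw [← matrixInner_self, matrixInner_sub_left, matrixInner_sub_right, matrixInner_sub_right, h1,
    matrixInner_comm u 1]
  ring

theorem splitForm_mul_splitForm_mul (A : Matrix (ι ⊕ ι) (ι ⊕ ι) 𝔽) :
    splitForm ι 𝔽 * (splitForm ι 𝔽 * A) = A := by
  rw [← mul_assoc, splitForm_mul_self, one_mul]

theorem matrixInner_splitForm_conj (A B : Matrix (ι ⊕ ι) (ι ⊕ ι) 𝔽) :
    matrixInner (splitForm ι 𝔽 * A * splitForm ι 𝔽) B =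
      matrixInner A (splitForm ι 𝔽 * B * splitForm ι 𝔽) := by
  rw [matrixInner_mul_right, matrixInner_mul_left, splitForm_conjTranspose, mul_assoc]

/-- On each component of `U(n, n, 𝔽)` there is a unitary matrix. -/
theorem exists_unitary_mem_component {C : Set (Matrix (ι ⊕ ι) (ι ⊕ ι) 𝔽)} (hC : IsClosed C)
    (hCc : IsComponentUnion (adjointGroup (splitAdjoint ι 𝔽) ∅) C) (hne : C.Nonempty) :
    ∃ b ∈ C, bᴴ * b = 1 := by
  have : ProperSpace (Matrix (ι ⊕ ι) (ι ⊕ ι) 𝔽) := FiniteDimensional.proper_real _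
  -- A matrix of least norm in the closed set `C`; it turns out to be unitary.
  obtain ⟨b, hb, hmin⟩ := hC.exists_infDist_eq_dist hne 0
  have hmin' : ∀ c ∈ C, ‖b‖ ≤ ‖c‖ := fun c hc => by
    have := Metric.infDist_le_dist_of_mem (x := 0) hc
    rwa [hmin, dist_zero_left, dist_zero_left] at this
  refine ⟨b, hb, ?_⟩
  have hbS : splitForm ι 𝔽 * bᴴ * splitForm ι 𝔽 * b = 1 := (hCc.1 hb).1
  have hbS' : b * (splitForm ι 𝔽 * bᴴ * splitForm ι 𝔽) = 1 :=
    mul_map_of_mem_adjointGroup (hCc.1 hb)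
  set s := bᴴ * b with hs
  have hsH : sᴴ = s := by rw [hs, Matrix.conjTranspose_mul, Matrix.conjTranspose_conjTranspose]
  -- Twice the projection of `s = bᴴ b` to the Lie algebra. Stationarity of the norm at `b` in this
  -- direction reads `⟨s, X⟩ = 0`, which is half of `⟨X, X⟩`.
  set X := s - splitForm ι 𝔽 * s * splitForm ι 𝔽 with hX
  have hX𝔤 : X ∈ adjointAlgebra (splitAdjoint ι 𝔽) ∅ := by
    refine ⟨?_, by simp⟩
    rw [hX, map_sub, splitAdjoint_apply, hsH, show splitForm ι 𝔽 * s * splitForm ι 𝔽 =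
      splitAdjoint ι 𝔽 s by rw [splitAdjoint_apply, hsH], isAntiInvolution_splitAdjoint.involutive,
      neg_sub]
  have hd : 2 * matrixInner s X = 0 := by
    refine IsLocalMin.hasDerivAt_eq_zero (Filter.Eventually.of_forall fun t => ?_)
      (hasDerivAt_matrixInner_self_mul_exp b X)
    simp only [zero_smul, NormedSpace.exp_zero, mul_one, matrixInner_self]
    exact pow_le_pow_left₀ (norm_nonneg _) (hmin' _
      ((isLieSet_of_isComponentUnion isAntiInvolution_splitAdjoint hCc).mul_exp b hb _
        (Submodule.smul_mem _ t hX𝔤))) 2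
  have hX0 : X = 0 := by
    rw [← matrixInner_self_eq_zero]
    nth_rewrite 1 [hX]
    have h1 : splitForm ι 𝔽 * X * splitForm ι 𝔽 = -X := by
      rw [hX, mul_sub, sub_mul, neg_sub]
      congr 1
      simp only [mul_assoc, splitForm_mul_self, mul_one, splitForm_mul_splitForm_mul]
    rw [matrixInner_sub_left, matrixInner_splitForm_conj, h1, matrixInner_neg_right]
    linarith
  -- This holds throughout the group. As `X = 0` says that `s` commutes with the form matrix, it
  -- becomes `s * s = 1`.
  have hinv : splitForm ι 𝔽 * s * splitForm ι 𝔽 * s = 1 := by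
    calc _ = (splitForm ι 𝔽 * bᴴ) * (b * (splitForm ι 𝔽 * bᴴ * splitForm ι 𝔽)) *
          (splitForm ι 𝔽 * b) := by
          simp only [hs, mul_assoc, splitForm_mul_splitForm_mul]
      _ = _ := by rw [hbS', mul_one, ← hbS]; simp only [mul_assoc]
  refine conjTranspose_mul_self_eq_one ?_
  rw [← hs]
  nth_rewrite 1 [sub_eq_zero.1 (hX.symm.trans hX0)]
  exact hinv

/-- `U(n, n, 𝔽)` is connected if `𝔽` contains an imaginary unit. -/
theorem one_mem_component {I : 𝔽} (hI : star I = -I) (hI0 : I ≠ 0)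
    {C : Set (Matrix (ι ⊕ ι) (ι ⊕ ι) 𝔽)} (hC : IsClosed C)
    (hCc : IsComponentUnion (adjointGroup (splitAdjoint ι 𝔽) ∅) C) (hne : C.Nonempty) :
    (1 : Matrix (ι ⊕ ι) (ι ⊕ ι) 𝔽) ∈ C := by
  obtain ⟨b₀, hb₀, hb₀u⟩ := exists_unitary_mem_component hC hCc hne
  have hKu : C ∩ adjointGroup (conjTransposeL (ι ⊕ ι) 𝔽) ∅ ⊆ compactU (ι ⊕ ι) 𝔽 := by
    rw [compactU_eq_adjointGroup]
    exact inter_subset_right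
  have hK : IsCompact (C ∩ adjointGroup (conjTransposeL (ι ⊕ ι) 𝔽) ∅) :=
    isCompact_of_subset_compactU (hC.inter (isClosed_adjointGroup _ _)) hKu
  -- The unitary elements of `C` form a compact set; `b` has the largest real trace among them and
  -- will be shown to be `1`.
  obtain ⟨b, ⟨hb, hbu⟩, hmax⟩ := hK.exists_isMaxOn ⟨b₀, hb₀, hb₀u, by simp⟩
    (f := fun b => matrixInner 1 b) (matrixInnerL 1).continuous.continuousOn
  have hbu1 : bᴴ * b = 1 := hbu.1
  have hbu2 : b * bᴴ = 1 := mul_map_of_mem_adjointGroup hbu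
  have hmove : ∀ X : Matrix (ι ⊕ ι) (ι ⊕ ι) 𝔽, Xᴴ = -X → splitForm ι 𝔽 * X = X * splitForm ι 𝔽 →
      ∀ t : ℝ, b * NormedSpace.exp (t • X) ∈ C ∩ adjointGroup (conjTransposeL (ι ⊕ ι) 𝔽) ∅ ∧
        NormedSpace.exp (t • X) ∈ adjointGroup (conjTransposeL (ι ⊕ ι) 𝔽) ∅ := by
    intro X hX hXJ t
    have h1 : X ∈ adjointAlgebra (conjTransposeL (ι ⊕ ι) 𝔽) ∅ := ⟨hX, by simp⟩
    have h2 : X ∈ adjointAlgebra (splitAdjoint ι 𝔽) ∅ := by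
      refine ⟨?_, by simp⟩
      rw [splitAdjoint_apply, hX, mul_neg, neg_mul, hXJ, mul_assoc, splitForm_mul_self, mul_one]
    have h3 := exp_mem_adjointGroup isAntiInvolution_conjTransposeL (Submodule.smul_mem _ t h1)
    exact ⟨⟨(isLieSet_of_isComponentUnion isAntiInvolution_splitAdjoint hCc).mul_exp b hb _
        (Submodule.smul_mem _ t h2),
      mul_mem_adjointGroup isAntiInvolution_conjTransposeL hbu h3⟩, h3⟩
  have hbJ' : splitForm ι 𝔽 * bᴴ * splitForm ι 𝔽 = bᴴ := by
    have h1 : splitForm ι 𝔽 * bᴴ * splitForm ι 𝔽 * b = 1 := (hCc.1 hb).1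
    calc _ = splitForm ι 𝔽 * bᴴ * splitForm ι 𝔽 * (b * bᴴ) := by rw [hbu2, mul_one]
      _ = _ := by rw [← mul_assoc, h1, one_mul]
  have hbJH : splitForm ι 𝔽 * bᴴ = bᴴ * splitForm ι 𝔽 := by
    nth_rewrite 2 [← hbJ']
    rw [mul_assoc, splitForm_mul_self, mul_one]
  have hbJ : splitForm ι 𝔽 * b = b * splitForm ι 𝔽 := by
    have := congrArg Matrix.conjTranspose hbJH
    rw [Matrix.conjTranspose_mul, Matrix.conjTranspose_mul, Matrix.conjTranspose_conjTranspose,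
      splitForm_conjTranspose] at this
    exact this.symm
  -- Stationarity of the real trace in the admissible direction `bᴴ - b` makes this direction zero.
  have hbH : bᴴ = b := by
    have hXH : (bᴴ - b)ᴴ = -(bᴴ - b) := by
      rw [Matrix.conjTranspose_sub, Matrix.conjTranspose_conjTranspose, neg_sub]
    have hd : matrixInner 1 (b * (bᴴ - b)) = 0 := by
      refine IsLocalMax.hasDerivAt_eq_zero (Filter.Eventually.of_forall fun t => ?_)
        (hasDerivAt_matrixInner_mul_exp 1 b (bᴴ - b))
      simp only [zero_smul, NormedSpace.exp_zero, mul_one]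
      exact hmax (hmove _ hXH (by rw [mul_sub, sub_mul, hbJH, hbJ]) t).1
    rw [matrixInner_comm, matrixInner_mul_left, mul_one, matrixInner_comm] at hd
    have h2 : matrixInner b (bᴴ - b) = -matrixInner bᴴ (bᴴ - b) := by
      rw [← matrixInner_conjTranspose, hXH, matrixInner_neg_right]
    rw [← sub_eq_zero, ← matrixInner_self_eq_zero, matrixInner_sub_left, h2, hd]
    simp
  have hbb : b * b = 1 := by rw [← hbu1, hbH]
  -- Now `b` is a Hermitian reflection, and `1 - b` is twice the projection to its eigenspace for
  -- `-1`. This matrix generates unitary motions `u` of that eigenspace, for which `b u = b + 1 -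
  -- u`. These do not decrease the real trace and increase it unless `u = 1`, so maximality forces
  -- the generator to vanish.
  have hQ : ∀ k, (1 - b) * Matrix.single k k I * (1 - b) = 0 := by
    intro k
    set X := (1 - b) * Matrix.single k k I * (1 - b) with hX
    have hXH : Xᴴ = -X := by
      rw [hX, Matrix.conjTranspose_mul, Matrix.conjTranspose_mul, Matrix.conjTranspose_sub, hbH,
        Matrix.conjTranspose_one, Matrix.conjTranspose_single, hI, ← Matrix.single_neg, mul_assoc]
      simp
    have hJk : splitForm ι 𝔽 * Matrix.single k k I = Matrix.single k k I * splitForm ι 𝔽 := by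
      have : splitForm ι 𝔽 = Matrix.diagonal (Sum.elim 1 (-1)) := by
        ext i j
        rcases i with i | i <;> rcases j with j | j <;>
          simp [splitForm, Matrix.diagonal_apply, Matrix.one_apply, apply_ite]
      ext i j
      rw [this, Matrix.diagonal_mul, Matrix.mul_diagonal, Matrix.single_apply]
      split_ifs with h
      · rw [← h.1, ← h.2]
        rcases k with k | k <;> simp
      · simp
    have hJb : splitForm ι 𝔽 * (1 - b) = (1 - b) * splitForm ι 𝔽 := by
      rw [mul_sub, sub_mul, hbJ, one_mul, mul_one]
    have hXJ : splitForm ι 𝔽 * X = X * splitForm ι 𝔽 := by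
      rw [hX, ← mul_assoc, ← mul_assoc, hJb, mul_assoc (1 - b) (splitForm ι 𝔽), hJk]
      simp only [mul_assoc]
      rw [hJb]
    have hbX : (b + 1) * X = 0 := by
      rw [hX, ← mul_assoc, ← mul_assoc, add_mul, mul_sub b 1 b, hbb]
      simp
    refine eq_zero_of_exp_smul_eq_one fun t => ?_
    obtain ⟨h1, h2⟩ := hmove X hXH hXJ t
    have h3 := mul_exp_smul_of_mul_eq_zero hbX t
    set u := NormedSpace.exp (t • X)
    have h4 : b * u = b + 1 - u := by rw [← h3, add_mul, one_mul, add_sub_cancel_right]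
    have h5 : matrixInner 1 (b * u) ≤ matrixInner 1 b := hmax h1
    rw [h4, matrixInner_sub_right, matrixInner_add_right, matrixInner_one_le h2.1] at h5
    have h6 : ‖1 - u‖ ^ 2 = 0 := le_antisymm (by linarith) (sq_nonneg _)
    exact (sub_eq_zero.1 (norm_eq_zero.1 (pow_eq_zero_iff two_ne_zero |>.1 h6))).symm
  -- The diagonal entry at `a` of the vanishing matrix is `x I (star x)`, where `x` is the entry
  -- `(a, k)` of `1 - b`.
  have hone : 1 - b = 0 := by
    ext a k
    by_contra hak
    have h1 := congrFun (congrFun (hQ k) a) a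
    have h2 : ((1 - b) * Matrix.single k k I * (1 - b)) a a = (1 - b) a k * I * (1 - b) k a := by
      rw [Matrix.mul_apply, Finset.sum_eq_single k]
      · simp
      · intro l _ hl
        rw [Matrix.mul_single_apply_of_ne _ _ _ _ _ hl, zero_mul]
      · simp
    have h3 : (1 - b) k a = star ((1 - b) a k) := by
      rw [← Matrix.conjTranspose_apply, Matrix.conjTranspose_sub, hbH, Matrix.conjTranspose_one]
    rw [h2, h3] at h1
    exact mul_ne_zero (mul_ne_zero hak hI0) (star_ne_zero.2 hak) h1
  rw [sub_eq_zero.1 hone]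
  exact hb

theorem isPreconnected_splitUnitary {I : 𝔽} (hI : star I = -I) (hI0 : I ≠ 0) :
    IsPreconnected (splitUnitary ι 𝔽) := by
  rw [splitUnitary_eq_adjointGroup]
  refine isPreconnected_of_forall 1 fun A hA => ?_
  refine ⟨connectedComponentIn _ A, connectedComponentIn_subset _ _, ?_,
    mem_connectedComponentIn hA, isPreconnected_connectedComponentIn⟩
  exact one_mem_component hI hI0 (isClosed_connectedComponentIn (isClosed_adjointGroup _ _) A)
    (isComponentUnion_connectedComponentIn _ A) ⟨A, mem_connectedComponentIn hA⟩

end Connected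

/-! ### The action is almost effective -/

section Nondegenerate

universe u

variable {ι : Type u} [Fintype ι] [DecidableEq ι]
  {𝔽 : Type u} [NormedDivisionRing 𝔽] [InnerProductSpace ℝ 𝔽] [StarRing 𝔽] [StarModule ℝ 𝔽]
  [IsScalarTower ℝ 𝔽 𝔽] [SMulCommClass ℝ 𝔽 𝔽]

/-- Comparing `q` with `-q` separates the terms of odd and even degree in `q`; the case `q = 1` then
identifies the blocks in pairs. -/
theorem infinitesimal_blocks {M : Set (Matrix ι ι 𝔽)} (h1 : 1 ∈ M) (hneg : ∀ q ∈ M, -q ∈ M)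
    {ξ : Matrix (ι ⊕ ι) (ι ⊕ ι) 𝔽} (h : ∀ q ∈ M, ξ.toBlocks₁₁ * q + ξ.toBlocks₁₂ =
      q * (ξ.toBlocks₂₁ * q + ξ.toBlocks₂₂)) :
    ξ.toBlocks₂₂ = ξ.toBlocks₁₁ ∧ ξ.toBlocks₂₁ = ξ.toBlocks₁₂ ∧
      ∀ q ∈ M, ξ.toBlocks₁₁ * q = q * ξ.toBlocks₁₁ ∧ ξ.toBlocks₁₂ = q * ξ.toBlocks₁₂ * q := by
  have key : ∀ q ∈ M, ξ.toBlocks₁₁ * q = q * ξ.toBlocks₂₂ ∧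
      ξ.toBlocks₁₂ = q * ξ.toBlocks₂₁ * q := by
    intro q hq
    have e1 := h q hq
    have e2 := h (-q) (hneg q hq)
    rw [mul_add, ← mul_assoc] at e1 e2
    simp only [mul_neg, neg_mul, neg_neg] at e2
    have h2 : (2 : ℝ) ≠ 0 := two_ne_zero
    constructor
    · refine smul_right_injective _ h2 ?_
      simp only [two_smul]
      calc _ = ξ.toBlocks₁₁ * q + ξ.toBlocks₁₂ - (-(ξ.toBlocks₁₁ * q) + ξ.toBlocks₁₂) := by abel
        _ = _ := by rw [e1, e2]; abel
    · refine smul_right_injective _ h2 ?_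
      simp only [two_smul]
      calc _ = ξ.toBlocks₁₁ * q + ξ.toBlocks₁₂ + (-(ξ.toBlocks₁₁ * q) + ξ.toBlocks₁₂) := by abel
        _ = _ := by rw [e1, e2]; abel
  have k1 := key 1 h1
  rw [mul_one, one_mul, mul_one, one_mul] at k1
  refine ⟨k1.1.symm, k1.2.symm, fun q hq => ?_⟩
  have := key q hq
  rwa [← k1.1, ← k1.2] at this

theorem blocks_of_mem_adjointAlgebra {S : Set (Matrix (ι ⊕ ι) (ι ⊕ ι) 𝔽 →ₐ[ℝ]
      Matrix (ι ⊕ ι) (ι ⊕ ι) 𝔽)} {ξ : Matrix (ι ⊕ ι) (ι ⊕ ι) 𝔽}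
    (hξ : ξ ∈ adjointAlgebra (splitAdjoint ι 𝔽) S) : (ξ.toBlocks₁₁)ᴴ = -ξ.toBlocks₁₁ := by
  have h := hξ.1
  rw [splitAdjoint_apply, ← Matrix.fromBlocks_toBlocks ξ, splitForm,
    Matrix.fromBlocks_conjTranspose, Matrix.fromBlocks_multiply, Matrix.fromBlocks_multiply,
    Matrix.fromBlocks_neg] at h
  simpa using (Matrix.fromBlocks_inj.1 h).1

theorem eq_zero_of_blocks {ξ : Matrix (ι ⊕ ι) (ι ⊕ ι) 𝔽} (h1 : ξ.toBlocks₂₂ = ξ.toBlocks₁₁)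
    (h2 : ξ.toBlocks₂₁ = ξ.toBlocks₁₂) (h3 : ξ.toBlocks₁₁ = 0) (h4 : ξ.toBlocks₁₂ = 0) : ξ = 0 := by
  rw [← Matrix.fromBlocks_toBlocks ξ, h1, h2, h3, h4, Matrix.fromBlocks_zero]

theorem eq_zero_of_eq_neg {x : 𝔽} (h : x = -x) : x = 0 := by
  have h2 : (2 : ℝ) • x = 0 := by
    rw [two_smul]
    nth_rewrite 1 [h]
    exact neg_add_cancel x
  exact (smul_eq_zero.1 h2).resolve_left two_ne_zero

variable [FiniteDimensional ℝ 𝔽]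

theorem mem_compactU_iff {q : Matrix ι ι 𝔽} : q ∈ compactU ι 𝔽 ↔ qᴴ * q = 1 := by
  rw [compactU_eq_adjointGroup]
  simp [adjointGroup, conjTransposeL_apply]

theorem diagonal_mem_compactU {v : ι → 𝔽} (hv : ∀ i, star (v i) * v i = 1) :
    Matrix.diagonal v ∈ compactU ι 𝔽 := by
  rw [mem_compactU_iff, Matrix.diagonal_conjTranspose, Matrix.diagonal_mul_diagonal,
    ← Matrix.diagonal_one]
  exact congrArg _ (funext hv)

theorem neg_mem_compactU {q : Matrix ι ι 𝔽} (hq : q ∈ compactU ι 𝔽) : -q ∈ compactU ι 𝔽 := by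
  rw [mem_compactU_iff] at hq ⊢
  simpa using hq

theorem one_mem_compactU : (1 : Matrix ι ι 𝔽) ∈ compactU ι 𝔽 := by
  simp [mem_compactU_iff]

/-- The reflection in a coordinate. -/
theorem apply_eq_zero_of_commute_compactU {a : Matrix ι ι 𝔽}
    (h : ∀ q ∈ compactU ι 𝔽, a * q = q * a) {r s : ι} (hrs : r ≠ s) : a r s = 0 := by
  have hq := h (Matrix.diagonal (Function.update 1 r (-1))) (diagonal_mem_compactU fun i => by
    by_cases hi : i = r
    · subst hi; simp
    · simp [hi])
  have := congrFun (congrFun hq r) s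
  rw [Matrix.mul_diagonal, Matrix.diagonal_mul, Function.update_of_ne hrs.symm,
    Function.update_self] at this
  simp only [Pi.one_apply, mul_one, neg_mul, one_mul] at this
  exact eq_zero_of_eq_neg this

/-- Test against the permutation matrix of the transposition of `r` and `s`. -/
theorem diag_eq_of_commute_compactU {a : Matrix ι ι 𝔽}
    (h : ∀ q ∈ compactU ι 𝔽, a * q = q * a) (r s : ι) : a r r = a s s := by
  have hq := h ((Equiv.swap r s).permMatrix 𝔽) (by
    rw [mem_compactU_iff, Matrix.conjTranspose_permMatrix, ← Matrix.permMatrix_mul]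
    simp)
  have := congrFun (congrFun hq r) s
  rw [Equiv.Perm.permMatrix, PEquiv.mul_toMatrix_toPEquiv, PEquiv.toMatrix_toPEquiv_mul] at this
  simpa using this

end Nondegenerate

/-! ### Definiteness of the metrics over ℍ, ℂ and ℝ -/

section Classical

variable {ι : Type} [Fintype ι] [DecidableEq ι]

theorem isClosed_compactU {𝔽 : Type} [NormedDivisionRing 𝔽] [InnerProductSpace ℝ 𝔽] [StarRing 𝔽]
    [StarModule ℝ 𝔽] [IsScalarTower ℝ 𝔽 𝔽] [SMulCommClass ℝ 𝔽 𝔽] [FiniteDimensional ℝ 𝔽] :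
    IsClosed (compactU ι 𝔽) := by
  rw [compactU_eq_adjointGroup]
  exact isClosed_adjointGroup _ _

theorem isComponentUnion_compactU {𝔽 : Type} [NormedDivisionRing 𝔽] [InnerProductSpace ℝ 𝔽]
    [StarRing 𝔽] [StarModule ℝ 𝔽] [IsScalarTower ℝ 𝔽 𝔽] [SMulCommClass ℝ 𝔽 𝔽]
    [FiniteDimensional ℝ 𝔽] :
    IsComponentUnion (adjointGroup (conjTransposeL ι 𝔽) ∅) (compactU ι 𝔽) := by
  rw [compactU_eq_adjointGroup]
  exact isComponentUnion_self _

/-- The quaternion `i`. -/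
def quatI : ℍ[ℝ] := ⟨0, 1, 0, 0⟩

/-- The quaternion `j`. -/
def quatJ : ℍ[ℝ] := ⟨0, 0, 1, 0⟩

/-- The quaternion `k`. -/
def quatK : ℍ[ℝ] := ⟨0, 0, 0, 1⟩

@[simp] theorem quatI_re : quatI.re = 0 := rfl
@[simp] theorem quatI_imI : quatI.imI = 1 := rfl
@[simp] theorem quatI_imJ : quatI.imJ = 0 := rfl
@[simp] theorem quatI_imK : quatI.imK = 0 := rfl

@[simp] theorem quatJ_re : quatJ.re = 0 := rfl
@[simp] theorem quatJ_imI : quatJ.imI = 0 := rfl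
@[simp] theorem quatJ_imJ : quatJ.imJ = 1 := rfl
@[simp] theorem quatJ_imK : quatJ.imK = 0 := rfl

@[simp] theorem quatK_re : quatK.re = 0 := rfl
@[simp] theorem quatK_imI : quatK.imI = 0 := rfl
@[simp] theorem quatK_imJ : quatK.imJ = 0 := rfl
@[simp] theorem quatK_imK : quatK.imK = 1 := rfl

/-- Commuting with i and j makes `x` real, and a skew real number is zero. -/
theorem quaternion_eq_zero_of_commute_of_skew {x : ℍ[ℝ]}
    (hi : x * quatI = quatI * x) (hj : x * quatJ = quatJ * x)
    (hx : star x = -x) : x = 0 := by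
  simp [Quaternion.ext_iff] at hi hj hx
  ext <;> simp <;> linarith

/-- For an imaginary unit `u` of the basis, `x ↦ u x u` negates the components along `1` and `u`. -/
theorem quaternion_eq_zero_of_eq_mul_mul {x : ℍ[ℝ]}
    (hi : x = quatI * x * quatI) (hj : x = quatJ * x * quatJ)
    (hk : x = quatK * x * quatK) : x = 0 := by
  simp [Quaternion.ext_iff] at hi hj hk
  ext <;> simp <;> linarith

/-- No nonzero element of the Lie algebra of `Sp(n, n)` acts trivially on `Sp_n`. -/
theorem eq_zero_of_infinitesimal_quaternion {ξ : Matrix (ι ⊕ ι) (ι ⊕ ι) ℍ[ℝ]}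
    (hξ : ξ ∈ adjointAlgebra (splitAdjoint ι ℍ[ℝ]) ∅)
    (h : ∀ q ∈ compactU ι ℍ[ℝ], ξ.toBlocks₁₁ * q + ξ.toBlocks₁₂ =
      q * (ξ.toBlocks₂₁ * q + ξ.toBlocks₂₂)) : ξ = 0 := by
  obtain ⟨h1, h2, h3⟩ := infinitesimal_blocks one_mem_compactU (fun _ => neg_mem_compactU) h
  have hskew := blocks_of_mem_adjointAlgebra hξ
  have hscalar : ∀ u : ℍ[ℝ], star u * u = 1 → ∀ r s,
      ξ.toBlocks₁₁ r s * u = u * ξ.toBlocks₁₁ r s ∧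
        ξ.toBlocks₁₂ r s = u * ξ.toBlocks₁₂ r s * u := by
    intro u hu r s
    obtain ⟨e1, e2⟩ := h3 _ (diagonal_mem_compactU (v := fun _ => u) fun _ => hu)
    have e1 := congrFun (congrFun e1 r) s
    have e2 := congrFun (congrFun e2 r) s
    rw [Matrix.mul_diagonal, Matrix.diagonal_mul] at e1 e2
    exact ⟨e1, e2⟩
  have hi : star quatI * quatI = 1 := by ext <;> simp
  have hj : star quatJ * quatJ = 1 := by ext <;> simp
  have hk : star quatK * quatK = 1 := by ext <;> simp
  refine eq_zero_of_blocks h1 h2 (Matrix.ext fun r s => ?_) (Matrix.ext fun r s => ?_)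
  · rcases ne_or_eq r s with hrs | rfl
    · exact apply_eq_zero_of_commute_compactU (fun q hq => (h3 q hq).1) hrs
    exact quaternion_eq_zero_of_commute_of_skew (hscalar _ hi r r).1 (hscalar _ hj r r).1
      (congrFun (congrFun hskew r) r)
  · exact quaternion_eq_zero_of_eq_mul_mul (hscalar _ hi r s).2 (hscalar _ hj r s).2
      (hscalar _ hk r s).2

/-- No nonzero element of the Lie algebra of `SU(n, n)` acts trivially on `U_n`. -/
theorem eq_zero_of_infinitesimal_complex {ξ : Matrix (ι ⊕ ι) (ι ⊕ ι) ℂ} (htr : ξ.trace = 0)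
    (h : ∀ q ∈ compactU ι ℂ, ξ.toBlocks₁₁ * q + ξ.toBlocks₁₂ =
      q * (ξ.toBlocks₂₁ * q + ξ.toBlocks₂₂)) : ξ = 0 := by
  obtain ⟨h1, h2, h3⟩ := infinitesimal_blocks one_mem_compactU (fun _ => neg_mem_compactU) h
  refine eq_zero_of_blocks h1 h2 ?_ ?_
  · ext r s
    rcases ne_or_eq r s with hrs | rfl
    · exact apply_eq_zero_of_commute_compactU (fun q hq => (h3 q hq).1) hrs
    -- The two diagonal blocks are the same scalar matrix. Imaginary scalars do act trivially, and
    -- only the trace condition of SU(n, n) excludes them.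
    have hsum : ξ.trace = (ξ.toBlocks₁₁).trace + (ξ.toBlocks₂₂).trace := by
      rw [Matrix.trace, Fintype.sum_sum_type]
      rfl
    rw [hsum, h1, ← two_mul] at htr
    have h4 : (ξ.toBlocks₁₁).trace = Fintype.card ι * ξ.toBlocks₁₁ r r := by
      have h5 : ∀ s ∈ Finset.univ, (ξ.toBlocks₁₁).diag s = ξ.toBlocks₁₁ r r := fun s _ =>
        diag_eq_of_commute_compactU (fun q hq => (h3 q hq).1) s r
      rw [Matrix.trace, Finset.sum_congr rfl h5, Finset.sum_const, nsmul_eq_mul, Finset.card_univ]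
    rw [h4] at htr
    have : Nonempty ι := ⟨r⟩
    simpa [Fintype.card_ne_zero] using htr
  · ext r s
    -- For `q = i` the equation `B = q B q` reads `B = -B`.
    have e := (h3 _ (diagonal_mem_compactU (v := fun _ => Complex.I) fun _ => by simp)).2
    have e := congrFun (congrFun e r) s
    rw [Matrix.mul_diagonal, Matrix.diagonal_mul, mul_right_comm, Complex.I_mul_I, neg_one_mul] at e
    exact eq_zero_of_eq_neg e

theorem diagonal_mem_compactSO {v : ι → ℝ} (hv : ∀ i, v i * v i = 1) (hd : ∏ i, v i = 1) :
    Matrix.diagonal v ∈ compactSO ι := by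
  change _ ∈ Matrix.specialOrthogonalGroup ι ℝ
  rw [Matrix.mem_specialOrthogonalGroup_iff]
  exact ⟨diagonal_mem_compactU (by simpa using hv), by rw [Matrix.det_diagonal, hd]⟩

/-- The diagonal matrix with entries `-1` at two places and `1` elsewhere. -/
theorem doubleReflection_mem_compactSO {r s : ι} (hrs : r ≠ s) :
    Matrix.diagonal (fun i => if i = r ∨ i = s then (-1 : ℝ) else 1) ∈ compactSO ι := by
  refine diagonal_mem_compactSO (fun i => by split_ifs <;> simp) ?_
  rw [Finset.prod_ite, Finset.prod_const, Finset.prod_const_one, mul_one,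
    show Finset.univ.filter (fun i => i = r ∨ i = s) = {r, s} by ext; simp,
    Finset.card_pair hrs]
  norm_num

/-- The rotation by a right angle in a coordinate plane. -/
theorem rotation_mem_compactSO {r s : ι} (hrs : r ≠ s) :
    (Equiv.swap r s).permMatrix ℝ * Matrix.diagonal (Function.update 1 r (-1)) ∈ compactSO ι := by
  change _ ∈ Matrix.specialOrthogonalGroup ι ℝ
  rw [Matrix.mem_specialOrthogonalGroup_iff]
  constructor
  · refine mul_mem (?_ : _ ∈ compactU ι ℝ) (diagonal_mem_compactU fun i => ?_)
    · rw [mem_compactU_iff, Matrix.conjTranspose_permMatrix, ← Matrix.permMatrix_mul]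
      simp
    · by_cases hi : i = r
      · subst hi; simp
      · simp [hi]
  · rw [Matrix.det_mul, Matrix.det_permutation, Equiv.Perm.sign_swap hrs, Matrix.det_diagonal,
      Finset.prod_update_of_mem (Finset.mem_univ r)]
    simp

/-- No nonzero element of the Lie algebra of `O(m, m)` acts trivially on `SO_m` if `m > 2` is
even. -/
theorem eq_zero_of_infinitesimal_real (hι : Even (Fintype.card ι)) (hι2 : 2 < Fintype.card ι)
    {ξ : Matrix (ι ⊕ ι) (ι ⊕ ι) ℝ} (hξ : ξ ∈ adjointAlgebra (splitAdjoint ι ℝ) ∅)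
    (h : ∀ q ∈ compactSO ι, ξ.toBlocks₁₁ * q + ξ.toBlocks₁₂ =
      q * (ξ.toBlocks₂₁ * q + ξ.toBlocks₂₂)) : ξ = 0 := by
  obtain ⟨h1, h2, h3⟩ := infinitesimal_blocks (one_mem (Matrix.specialOrthogonalGroup ι ℝ))
    (fun q hq => by
      rw [SetLike.mem_coe, Matrix.mem_specialOrthogonalGroup_iff] at hq ⊢
      exact ⟨neg_mem_compactU hq.1, by rw [Matrix.det_neg, hι.neg_one_pow, one_mul, hq.2]⟩) h
  have hskew := blocks_of_mem_adjointAlgebra hξ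
  -- A third index makes it possible to change the sign of coordinate `r` but not of `s` with
  -- determinant one, by also reversing `t`. With two indices this fails. That the number of indices
  -- is even served above to have `-1` in the group.
  have hthird : ∀ r s : ι, ∃ t, t ≠ r ∧ t ≠ s := by
    intro r s
    have : ({r, s} : Finset ι).card < (Finset.univ : Finset ι).card :=
      (Finset.card_le_two).trans_lt hι2
    obtain ⟨t, -, ht⟩ := Finset.exists_mem_notMem_of_card_lt_card this
    exact ⟨t, by simpa using ht⟩
  have hb : ∀ r s, r ≠ s → ξ.toBlocks₁₂ r s = 0 := by
    intro r s hrs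
    obtain ⟨t, htr, hts⟩ := hthird r s
    have e := congrFun (congrFun (h3 _ (doubleReflection_mem_compactSO htr.symm)).2 r) s
    rw [Matrix.mul_diagonal, Matrix.diagonal_mul] at e
    simp only [true_or, if_true, hrs.symm, hts.symm, or_self, if_false] at e
    linarith
  -- A quarter turn in the plane of `r` and `s` makes the two diagonal entries opposite; entries
  -- that are pairwise opposite at three places vanish.
  have hd : ∀ r s, r ≠ s → ξ.toBlocks₁₂ r r = -ξ.toBlocks₁₂ s s := by
    intro r s hrs
    have e := congrFun (congrFun (h3 _ (rotation_mem_compactSO hrs)).2 r) r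
    have hdiag : ξ.toBlocks₁₂ = Matrix.diagonal (fun i => ξ.toBlocks₁₂ i i) := by
      ext i j
      rcases ne_or_eq i j with hij | rfl
      · rw [hb i j hij, Matrix.diagonal_apply_ne _ hij]
      · simp
    nth_rewrite 2 [hdiag] at e
    rw [Equiv.Perm.permMatrix, PEquiv.toMatrix_toPEquiv_mul, Matrix.mul_apply,
      Finset.sum_eq_single s] at e
    · simpa [hrs, hrs.symm] using e
    · intro l _ hl
      simp only [Matrix.mul_diagonal, Matrix.submatrix_apply, id, Equiv.swap_apply_left]
      rw [Matrix.diagonal_apply_ne _ hl.symm]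
      simp
    · simp
  refine eq_zero_of_blocks h1 h2 ?_ ?_
  · ext r s
    rcases ne_or_eq r s with hrs | rfl
    · obtain ⟨t, htr, hts⟩ := hthird r s
      have e := congrFun (congrFun (h3 _ (doubleReflection_mem_compactSO htr.symm)).1 r) s
      rw [Matrix.mul_diagonal, Matrix.diagonal_mul] at e
      simp only [true_or, if_true, hrs.symm, hts.symm, or_self, if_false] at e
      rw [Matrix.zero_apply]
      linarith
    · have e := congrFun (congrFun hskew r) r
      rw [Matrix.conjTranspose_apply, Matrix.neg_apply, star_trivial] at e
      rw [Matrix.zero_apply]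
      linarith
  · ext r s
    rcases ne_or_eq r s with hrs | rfl
    · exact hb r s hrs
    · obtain ⟨s, hs, -⟩ := hthird r r
      obtain ⟨t, htr, hts⟩ := hthird r s
      rw [Matrix.zero_apply]
      linarith [hd r s hs.symm, hd r t htr.symm, hd s t hts.symm]

/-- A continuous function with values `±1` is constant on a connected set. Hence determinant one
cuts a union of components out of an orthogonal group. -/
theorem eq_one_of_isPreconnected {X : Type*} [TopologicalSpace X] {T : Set X}
    (hT : IsPreconnected T) {f : X → ℝ} (hf : ContinuousOn f T)
    (h : ∀ x ∈ T, f x * f x = 1) {x y : X} (hx : x ∈ T) (hfx : f x = 1) (hy : y ∈ T) :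
    f y = 1 := by
  rcases mul_self_eq_one_iff.1 (h y hy) with h1 | h1
  · exact h1
  · obtain ⟨z, hz, hz0⟩ := hT.intermediate_value hy hx hf
      (show (0 : ℝ) ∈ Icc (f y) (f x) by rw [h1, hfx]; constructor <;> norm_num)
    have := h z hz
    rw [hz0] at this
    norm_num at this

theorem continuous_det {𝔽 : Type} [NormedField 𝔽] :
    Continuous (fun A : Matrix ι ι 𝔽 => A.det) :=
  Continuous.matrix_det (A := fun A : Matrix ι ι 𝔽 => A) continuous_id

theorem compactSO_eq : compactSO ι = {q | q ∈ adjointGroup (conjTransposeL ι ℝ) ∅ ∧ q.det = 1} := by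
  rw [← compactU_eq_adjointGroup]
  ext q
  exact Matrix.mem_specialOrthogonalGroup_iff

theorem isClosed_compactSO : IsClosed (compactSO ι) := by
  rw [compactSO_eq]
  exact (isClosed_adjointGroup _ _).inter (isClosed_eq continuous_det continuous_const)

theorem isComponentUnion_compactSO :
    IsComponentUnion (adjointGroup (conjTransposeL ι ℝ) ∅) (compactSO ι) := by
  rw [compactSO_eq]
  refine ⟨fun q hq => hq.1, fun T hT hTc ⟨x, hx, hxM⟩ y hy => ⟨hT hy, ?_⟩⟩
  refine eq_one_of_isPreconnected hTc continuous_det.continuousOn (fun z hz => ?_) hx hxM.2 hy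
  have h1 : zᴴ * z = 1 := (hT hz).1
  have h2 := congrArg Matrix.det h1
  rwa [Matrix.det_mul, Matrix.det_conjTranspose, star_trivial, Matrix.det_one] at h2

end Classical

/-! ### Involutions given by conjugation -/

section Involutions

universe u

variable {ι : Type u} [Fintype ι] [DecidableEq ι]
  {𝔽 : Type u} [NormedDivisionRing 𝔽] [InnerProductSpace ℝ 𝔽] [StarRing 𝔽] [StarModule ℝ 𝔽]
  [IsScalarTower ℝ 𝔽 𝔽] [SMulCommClass ℝ 𝔽 𝔽]

variable (ι 𝔽) in
/-- The endomorphisms of the real algebra of matrices. -/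
abbrev MatrixEnd : Type u := Matrix ι ι 𝔽 →ₐ[ℝ] Matrix ι ι 𝔽

variable (ι) in
/-- The endomorphism of the algebra of matrices that applies `f` to each entry. -/
def entrywiseHom (f : 𝔽 →+* 𝔽) (hf : ∀ (r : ℝ) x, f (r • x) = r • f x) :
    Matrix ι ι 𝔽 →ₐ[ℝ] Matrix ι ι 𝔽 :=
  AlgHom.ofLinearMap
    { toFun := fun A => A.map f
      map_add' := fun A B => Matrix.map_add f (map_add f) A B
      map_smul' := fun r A => Matrix.map_smul f r (hf r) A }
    (Matrix.map_one f (map_zero f) (map_one f))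
    (fun _ _ => Matrix.map_mul)

variable {f : 𝔽 →+* 𝔽} {hf : ∀ (r : ℝ) x, f (r • x) = r • f x}

theorem entrywiseHom_apply (A : Matrix ι ι 𝔽) : entrywiseHom ι f hf A = A.map f := rfl

theorem blockHom_entrywiseHom (A : Matrix (ι ⊕ ι) (ι ⊕ ι) 𝔽) :
    blockHom (entrywiseHom ι f hf) A = A.map f := by
  ext i j
  rcases i with i | i <;> rcases j with j | j <;> rfl

theorem isMatrixInvolution_entrywiseHom (hff : ∀ x, f (f x) = x)
    (hstar : ∀ x, f (star x) = star (f x))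
    (hinner : ∀ x y, inner ℝ (f x) (f y) = inner ℝ x y) :
    IsMatrixInvolution (entrywiseHom ι f hf) where
  involutive A := by
    ext i j
    exact hff _
  map_conjTranspose A := by
    ext i j
    exact hstar _
  inner_map A B := by
    simp only [matrixInner, entrywiseHom_apply, Matrix.map_apply, hinner]

theorem IsMatrixInvolution.map_mem_compactU [FiniteDimensional ℝ 𝔽]
    {t : Matrix ι ι 𝔽 →ₐ[ℝ] Matrix ι ι 𝔽} (ht : IsMatrixInvolution t) {q : Matrix ι ι 𝔽}
    (hq : q ∈ compactU ι 𝔽) : t q ∈ compactU ι 𝔽 := by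
  rw [mem_compactU_iff] at hq ⊢
  rw [← ht.map_conjTranspose, ← map_mul, hq, map_one]

/-- Conjugation by a unitary matrix. -/
def conjugationHom (R : Matrix ι ι 𝔽) (h : Rᴴ * R = 1) (h' : R * Rᴴ = 1) :
    Matrix ι ι 𝔽 →ₐ[ℝ] Matrix ι ι 𝔽 :=
  AlgHom.ofLinearMap
    { toFun := fun A => R * A * Rᴴ
      map_add' := fun A B => by rw [mul_add, add_mul]
      map_smul' := fun r A => by simp }
    (by simp [h'])
    (fun A B => by
      change R * (A * B) * Rᴴ = R * A * Rᴴ * (R * B * Rᴴ)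
      rw [show R * A * Rᴴ * (R * B * Rᴴ) = R * A * (Rᴴ * R) * B * Rᴴ by simp only [mul_assoc], h]
      simp only [mul_assoc, one_mul])

variable {R : Matrix ι ι 𝔽} {h : Rᴴ * R = 1} {h' : R * Rᴴ = 1}

theorem conjugationHom_apply (A : Matrix ι ι 𝔽) : conjugationHom R h h' A = R * A * Rᴴ := rfl

/-- A unitary skew `R` has square `-1`, which is central, so conjugating twice is the identity. -/
theorem isMatrixInvolution_conjugationHom [StarInner 𝔽] (hR : Rᴴ = -R) :
    IsMatrixInvolution (conjugationHom R h h') where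
  involutive A := by
    rw [conjugationHom_apply, conjugationHom_apply]
    have hRR : R * R = -1 := by
      rw [← h', hR, mul_neg, neg_neg]
    rw [show R * (R * A * Rᴴ) * Rᴴ = (R * R) * A * (Rᴴ * Rᴴ) by simp only [mul_assoc], hR,
      neg_mul_neg, hRR]
    simp
  map_conjTranspose A := by
    rw [conjugationHom_apply, conjugationHom_apply, Matrix.conjTranspose_mul,
      Matrix.conjTranspose_mul, Matrix.conjTranspose_conjTranspose, mul_assoc]
  inner_map A B := by
    rw [conjugationHom_apply, conjugationHom_apply, matrixInner_mul_right, matrixInner_mul_left,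
      Matrix.conjTranspose_conjTranspose]
    congr 1
    rw [show Rᴴ * (R * B * Rᴴ * R) = (Rᴴ * R) * B * (Rᴴ * R) by simp only [mul_assoc], h, one_mul,
      mul_one]

end Involutions

/-! ### Images of unions of components -/

section ComponentImage

variable {X Y : Type*} [TopologicalSpace X] [TopologicalSpace Y]

/-- The continuous left inverse carries a connected subset of the image back to a connected subset
of `A`. -/
theorem IsComponentUnion.image {A N : Set X} (h : IsComponentUnion A N) {f : X → Y} {r : Y → X}
    (hr : Continuous r) (hrf : Function.LeftInverse r f) : IsComponentUnion (f '' A) (f '' N) := by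
  refine ⟨image_mono h.1, fun T hTA hT ⟨y, hyT, x, hx, hxy⟩ z hz => ?_⟩
  have hrT : r '' T ⊆ N := by
    refine h.2 _ ?_ (hT.image r hr.continuousOn) ⟨x, ⟨y, hyT, by rw [← hxy, hrf]⟩, hx⟩
    rintro _ ⟨w, hw, rfl⟩
    obtain ⟨a, ha, rfl⟩ := hTA hw
    rwa [hrf]
  obtain ⟨a, -, rfl⟩ := hTA hz
  refine ⟨a, ?_, rfl⟩
  have := hrT ⟨f a, hz, rfl⟩
  rwa [hrf] at this

theorem map_connectedComponentIn_subset {A : Set X} {x : X} {f : X → X} (hf : Continuous f)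
    (hfA : ∀ a ∈ A, f a ∈ A) (hfx : f x = x) {a : X} (ha : a ∈ connectedComponentIn A x) :
    f a ∈ connectedComponentIn A x := by
  have hx : x ∈ A := connectedComponentIn_nonempty_iff.1 ⟨a, ha⟩
  refine (isPreconnected_connectedComponentIn.image f hf.continuousOn).subset_connectedComponentIn
    ⟨x, mem_connectedComponentIn hx, hfx⟩ ?_ ⟨a, ha, rfl⟩
  rintro _ ⟨b, hb, rfl⟩
  exact hfA b (connectedComponentIn_subset _ _ hb)

end ComponentImage

/-! ### Extension of scalars -/

section ExtendScalars

variable {ι : Type*} [Fintype ι] [DecidableEq ι] {𝔽₀ 𝔽 : Type*} [Ring 𝔽₀] [StarRing 𝔽₀]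
  [Ring 𝔽] [StarRing 𝔽]

theorem map_mem_splitUnitary_iff {φ : 𝔽₀ →+* 𝔽} (hφ : Function.Injective φ)
    (hstar : ∀ x, φ (star x) = star (φ x)) {A : Matrix (ι ⊕ ι) (ι ⊕ ι) 𝔽₀} :
    A.map φ ∈ splitUnitary ι 𝔽 ↔ A ∈ splitUnitary ι 𝔽₀ := by
  have h1 : (A.map φ)ᴴ = Aᴴ.map φ := by
    ext i j
    exact (hstar _).symm
  have h2 : (Matrix.fromBlocks 1 0 0 (-1) : Matrix (ι ⊕ ι) (ι ⊕ ι) 𝔽) =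
      (Matrix.fromBlocks 1 0 0 (-1) : Matrix (ι ⊕ ι) (ι ⊕ ι) 𝔽₀).map φ := by
    rw [Matrix.fromBlocks_map, Matrix.map_one φ (map_zero φ) (map_one φ),
      Matrix.map_zero φ (map_zero φ)]
    congr 1
    rw [Matrix.map_neg φ (map_neg φ), Matrix.map_one φ (map_zero φ) (map_one φ)]
  change (A.map φ)ᴴ * Matrix.fromBlocks 1 0 0 (-1) * A.map φ = Matrix.fromBlocks 1 0 0 (-1) ↔
    Aᴴ * Matrix.fromBlocks 1 0 0 (-1) * A = Matrix.fromBlocks 1 0 0 (-1)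
  rw [h1, h2, ← Matrix.map_mul, ← Matrix.map_mul]
  exact (Matrix.map_injective hφ).eq_iff

theorem image_map_splitUnitary {φ : 𝔽₀ →+* 𝔽} (hφ : Function.Injective φ)
    (hstar : ∀ x, φ (star x) = star (φ x)) :
    (fun A => A.map φ) '' splitUnitary ι 𝔽₀ =
      {A | A ∈ splitUnitary ι 𝔽 ∧ ∀ i j, A i j ∈ range φ} := by
  ext A
  constructor
  · rintro ⟨B, hB, rfl⟩
    exact ⟨(map_mem_splitUnitary_iff hφ hstar).2 hB, fun i j => ⟨B i j, rfl⟩⟩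
  · rintro ⟨hA, h⟩
    choose B hB using h
    have e : (Matrix.of B).map φ = A := Matrix.ext hB
    exact ⟨Matrix.of B, (map_mem_splitUnitary_iff hφ hstar).1 (e.symm ▸ hA), e⟩

end ExtendScalars

/-! ### The special unitary group -/

section SpecialUnitary

variable {m : Type} [Fintype m] [DecidableEq m]

theorem differentiable_det : Differentiable ℝ (fun A : Matrix m m ℂ => A.det) := by
  have hentry : ∀ i j, Differentiable ℝ (fun A : Matrix m m ℂ => A i j) := fun i j =>
    (LinearMap.toContinuousLinearMap
      { toFun := fun A : Matrix m m ℂ => A i j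
        map_add' := fun _ _ => rfl
        map_smul' := fun _ _ => rfl } : Matrix m m ℂ →L[ℝ] ℂ).differentiable
  simp only [Matrix.det_apply']
  refine Differentiable.fun_sum fun σ _ => ?_
  refine (differentiable_const _).mul ?_
  exact fun A => (HasFDerivAt.finsetProd (u := Finset.univ) fun i _ =>
    (hentry (σ i) i A).hasFDerivAt).differentiableAt

theorem fderiv_det_one (M : Matrix m m ℂ) :
    fderiv ℝ (fun A : Matrix m m ℂ => A.det) 1 M = M.trace := by
  have h1 : HasDerivAt (fun r : ℝ => (1 : Matrix m m ℂ) + r • M) M 0 := by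
    simpa using ((hasDerivAt_id (0 : ℝ)).smul_const M).const_add 1
  have h2 : HasDerivAt (fun r : ℝ => ((1 : Matrix m m ℂ) + r • M).det)
      (fderiv ℝ (fun A : Matrix m m ℂ => A.det) 1 M) 0 := by
    have := (differentiable_det (m := m) ((1 : Matrix m m ℂ) + (0 : ℝ) • M)).hasFDerivAt.comp_hasDerivAt
      (0 : ℝ) h1
    rwa [zero_smul, add_zero] at this
  have h3 : HasDerivAt (fun r : ℝ => ((1 : Matrix m m ℂ) + r • M).det) M.trace 0 := by
    -- The determinant is a polynomial in `r` with constant term 1 and linear coefficient the trace;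
    -- the rest is a multiple of `r ^ 2` and does not affect the derivative at 0.
    have e : (fun r : ℝ => ((1 : Matrix m m ℂ) + r • M).det) = fun r : ℝ =>
        1 + M.trace * (r : ℂ) +
          (Matrix.det (1 + (Polynomial.X : Polynomial ℂ) • M.map Polynomial.C)).divX.divX.eval (r : ℂ)
            * (r : ℂ) ^ 2 := by
      funext r
      rw [← Matrix.det_one_add_smul]
      congr 2
    rw [e]
    generalize (Matrix.det (1 + (Polynomial.X : Polynomial ℂ) • M.map Polynomial.C)).divX.divX = p
    have hp := (((hasDerivAt_id (0 : ℂ)).const_mul M.trace).const_add 1).add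
      ((p.hasDerivAt (0 : ℂ)).mul ((hasDerivAt_id (0 : ℂ)).pow 2))
    have := hp.comp_ofReal (z := 0)
    simpa using this
  exact h2.unique h3

/-- A curve of matrices of determinant one has velocity of trace zero at the identity. -/
theorem trace_eq_zero_of_hasDerivAt {k : ℝ → Matrix m m ℂ} {X : Matrix m m ℂ} {t : ℝ} {I : Set ℝ}
    (hI : I ∈ nhds t) (hk : ∀ s ∈ I, (k s).det = 1) (hkt : k t = 1) (hX : HasDerivAt k X t) :
    X.trace = 0 := by
  have h1 := (differentiable_det (m := m) (k t)).hasFDerivAt.comp_hasDerivAt t hX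
  rw [hkt, fderiv_det_one] at h1
  refine h1.unique ((hasDerivAt_const t (1 : ℂ)).congr_of_eventuallyEq ?_)
  filter_upwards [hI] with s hs using hk s hs

/-- The function `t ↦ det (exp (tX))` is multiplicative with derivative `tr X = 0` at 0, so its
derivative vanishes everywhere. -/
theorem det_exp_of_trace_eq_zero {X : Matrix m m ℂ} (hX : X.trace = 0) :
    (NormedSpace.exp X).det = 1 := by
  let _ : NormedAlgebra ℚ (Matrix m m ℂ) := NormedAlgebra.restrictScalars ℚ ℝ _
  have hadd : ∀ s t : ℝ, NormedSpace.exp ((s + t) • X) =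
      NormedSpace.exp (s • X) * NormedSpace.exp (t • X) := fun s t => by
    rw [add_smul]
    exact NormedSpace.exp_add_of_commute (((Commute.refl X).smul_left s).smul_right t)
  have hd0 : HasDerivAt (fun s : ℝ => (NormedSpace.exp (s • X)).det) 0 0 := by
    have h1 := hasDerivAt_exp_smul X 0
    have h2 := (differentiable_det (m := m)
      (NormedSpace.exp ((0 : ℝ) • X))).hasFDerivAt.comp_hasDerivAt (0 : ℝ) h1
    rw [zero_smul, NormedSpace.exp_zero, mul_one, fderiv_det_one, hX] at h2
    exact h2
  have hd : ∀ t : ℝ, HasDerivAt (fun s : ℝ => (NormedSpace.exp (s • X)).det) 0 t := by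
    intro t
    have e : (fun s : ℝ => (NormedSpace.exp (s • X)).det) = fun s : ℝ =>
        (NormedSpace.exp (t • X)).det * (NormedSpace.exp ((s - t) • X)).det := by
      funext s
      rw [← Matrix.det_mul, ← hadd, add_sub_cancel]
    rw [e]
    have h1 : HasDerivAt (fun s : ℝ => (NormedSpace.exp ((s - t) • X)).det) 0 t :=
      HasDerivAt.comp_sub_const t t (by rwa [sub_self])
    simpa using h1.const_mul ((NormedSpace.exp (t • X)).det)
  have := is_const_of_deriv_eq_zero (fun t => (hd t).differentiableAt) (fun t => (hd t).deriv) 1 0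
  simpa using this

variable (ι : Type) [Fintype ι] [DecidableEq ι]

/-- The Lie algebra of `SU(n, n)`. -/
def specialAlgebra : Submodule ℝ (Matrix (ι ⊕ ι) (ι ⊕ ι) ℂ) :=
  adjointAlgebra (splitAdjoint ι ℂ) ∅ ⊓ LinearMap.ker (Matrix.traceLinearMap (ι ⊕ ι) ℝ ℂ)

/-- The determinant condition is not of the form "fixed by endomorphisms", so this group is not
covered by `adjointGroup` and is treated directly, with the trace as the infinitesimal condition. -/
theorem isLieSet_splitSpecialUnitary :
    IsLieSet (splitSpecialUnitary ι) (specialAlgebra ι) := by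
  have hU : IsLieSet (splitUnitary ι ℂ) (adjointAlgebra (splitAdjoint ι ℂ) ∅) := by
    rw [splitUnitary_eq_adjointGroup]
    exact isLieSet_of_isComponentUnion isAntiInvolution_splitAdjoint (isComponentUnion_self _)
  refine ⟨fun g hg => hU.isUnit g hg.1, fun g hg X hX => ⟨hU.mul_exp g hg.1 X hX.1, ?_⟩, ?_⟩
  · rw [Matrix.det_mul, hg.2, det_exp_of_trace_eq_zero hX.2, one_mul]
  · intro c I hI hc hcG t ht
    refine ⟨hU.velocity c I hI hc (fun s hs => (hcG hs).1) t ht, ?_⟩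
    have hcd : HasDerivAt c (deriv c t) t :=
      ((hc.contDiffAt (hI.mem_nhds ht)).differentiableAt (by simp)).hasDerivAt
    have hunit := hU.isUnit _ (hcG ht).1
    have hinv : (Ring.inverse (c t)).det = 1 := by
      have := congrArg Matrix.det (Ring.inverse_mul_cancel _ hunit)
      rwa [Matrix.det_mul, (hcG ht).2, mul_one, Matrix.det_one] at this
    refine trace_eq_zero_of_hasDerivAt (k := fun s => Ring.inverse (c t) * c s) (hI.mem_nhds ht)
      (fun s hs => ?_) (Ring.inverse_mul_cancel _ hunit) (hcd.const_mul _)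
    rw [Matrix.det_mul, hinv, (hcG hs).2, one_mul]

end SpecialUnitary

/-! ### The inclusions given by `ℝ ⊂ ℂ ⊂ ℍ` -/

section Tower

universe u

variable {ι : Type u} [Fintype ι] [DecidableEq ι]
  {𝔽 : Type u} [NormedDivisionRing 𝔽] [InnerProductSpace ℝ 𝔽] [StarRing 𝔽] [StarModule ℝ 𝔽]
  [IsScalarTower ℝ 𝔽 𝔽] [SMulCommClass ℝ 𝔽 𝔽]
  {S : Set (Matrix (ι ⊕ ι) (ι ⊕ ι) 𝔽 →ₐ[ℝ] Matrix (ι ⊕ ι) (ι ⊕ ι) 𝔽)}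
  {t : Matrix ι ι 𝔽 →ₐ[ℝ] Matrix ι ι 𝔽}

theorem IsMatrixInvolution.blockHom_mem_adjointAlgebra (ht : IsMatrixInvolution t)
    (hS : ∀ σ ∈ S, ∀ x, σ (blockHom t x) = blockHom t (σ x)) {X : Matrix (ι ⊕ ι) (ι ⊕ ι) 𝔽}
    (hX : X ∈ adjointAlgebra (splitAdjoint ι 𝔽) S) :
    blockHom t X ∈ adjointAlgebra (splitAdjoint ι 𝔽) S :=
  ⟨by rw [ht.splitAdjoint_blockHom, hX.1, map_neg], fun σ hσ => by rw [hS σ hσ, hX.2 σ hσ]⟩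

theorem IsMatrixInvolution.blockHom_mem_adjointGroup (ht : IsMatrixInvolution t)
    (hS : ∀ σ ∈ S, ∀ x, σ (blockHom t x) = blockHom t (σ x)) {X : Matrix (ι ⊕ ι) (ι ⊕ ι) 𝔽}
    (hX : X ∈ adjointGroup (splitAdjoint ι 𝔽) S) :
    blockHom t X ∈ adjointGroup (splitAdjoint ι 𝔽) S :=
  ⟨by rw [ht.splitAdjoint_blockHom, ← map_mul, hX.1, map_one],
    fun σ hσ => by rw [hS σ hσ, hX.2 σ hσ]⟩

variable [FiniteDimensional ℝ 𝔽] [StarInner 𝔽]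

/-- The fixed points of an involution in a union of components of a group defined by involutions
form a totally geodesic submanifold. -/
theorem IsMatrixInvolution.isTotallyGeodesic_of_isComponentUnion (ht : IsMatrixInvolution t)
    {M : Set (Matrix ι ι 𝔽)} (htM : ∀ q ∈ M, t q ∈ M)
    {G N : Set (Matrix (ι ⊕ ι) (ι ⊕ ι) 𝔽)}
    (hG : IsComponentUnion (adjointGroup (splitAdjoint ι 𝔽) S) G)
    (hρ : IsRiemannianOn (kineticMetric M) G (adjointAlgebra (splitAdjoint ι 𝔽) S))
    (hS : ∀ σ ∈ S, ∀ x, σ (blockHom t x) = blockHom t (σ x))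
    (hσG : ∀ g ∈ G, blockHom t g ∈ G) (hNG : N ⊆ G)
    (hN : IsComponentUnion (adjointGroup (splitAdjoint ι 𝔽) (insert (blockHom t) S)) N) :
    IsTotallyGeodesic (kineticMetric M) N G :=
  ht.isTotallyGeodesic htM (isLieSet_of_isComponentUnion isAntiInvolution_splitAdjoint hG) hρ hG.1
    le_rfl hσG (fun _ hX => ht.blockHom_mem_adjointAlgebra hS hX) hNG hN

end Tower

section RealComplexQuaternion

variable {ι : Type} [Fintype ι] [DecidableEq ι]

theorem isComponentUnion_splitOrthogonalO :
    IsComponentUnion (splitUnitary ι ℝ) (splitOrthogonalO ι) :=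
  isComponentUnion_connectedComponentIn _ _

theorem isPreconnected_splitOrthogonalO : IsPreconnected (splitOrthogonalO ι) :=
  isPreconnected_connectedComponentIn

theorem one_mem_splitUnitary {𝔽 : Type} [Ring 𝔽] [StarRing 𝔽] :
    (1 : Matrix (ι ⊕ ι) (ι ⊕ ι) 𝔽) ∈ splitUnitary ι 𝔽 := by
  simp [splitUnitary]

theorem one_mem_splitOrthogonalO :
    (1 : Matrix (ι ⊕ ι) (ι ⊕ ι) ℝ) ∈ splitOrthogonalO ι :=
  mem_connectedComponentIn one_mem_splitUnitary

theorem det_eq_one_of_mem_splitOrthogonalO {A : Matrix (ι ⊕ ι) (ι ⊕ ι) ℝ}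
    (hA : A ∈ splitOrthogonalO ι) : A.det = 1 := by
  refine eq_one_of_isPreconnected isPreconnected_splitOrthogonalO continuous_det.continuousOn
    (fun B hB => ?_) one_mem_splitOrthogonalO Matrix.det_one hA
  have h1 := mem_splitUnitary_iff.1 (isComponentUnion_splitOrthogonalO.1 hB)
  have h2 := congrArg Matrix.det h1
  have h3 := congrArg Matrix.det (splitForm_mul_self (ι := ι) (𝔽 := ℝ))
  rw [splitAdjoint_apply, Matrix.det_mul, Matrix.det_mul, Matrix.det_mul,
    Matrix.det_conjTranspose, star_trivial, Matrix.det_one] at h2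
  rw [Matrix.det_mul, Matrix.det_one] at h3
  linear_combination h2 - B.det * B.det * h3

theorem continuous_matrix_map {m 𝔽 𝔽₀ : Type} [Fintype m] [NormedDivisionRing 𝔽]
    [NormedDivisionRing 𝔽₀] {f : 𝔽 → 𝔽₀} (hf : Continuous f) :
    Continuous (fun A : Matrix m m 𝔽 => A.map f) :=
  Continuous.matrix_map (A := fun A : Matrix m m 𝔽 => A) continuous_id hf

variable (ι) in
/-- Entrywise complex conjugation. -/
def complexConjHom : MatrixEnd ι ℂ :=
  entrywiseHom ι (starRingEnd ℂ) fun r x => by simp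

theorem blockHom_complexConjHom (A : Matrix (ι ⊕ ι) (ι ⊕ ι) ℂ) :
    blockHom (complexConjHom ι) A = A.map (starRingEnd ℂ) :=
  blockHom_entrywiseHom A

theorem isMatrixInvolution_complexConjHom : IsMatrixInvolution (complexConjHom ι) :=
  isMatrixInvolution_entrywiseHom (fun x => by simp) (fun x => by simp)
    (fun x y => by simp [Complex.inner])

theorem adjointGroup_complexConjHom :
    adjointGroup (splitAdjoint ι ℂ) {blockHom (complexConjHom ι)} =
      (fun A => A.map (fun x : ℝ => (x : ℂ))) '' splitUnitary ι ℝ := by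
  refine Eq.trans ?_ (image_map_splitUnitary (φ := Complex.ofRealHom) Complex.ofReal_injective
    fun x => by simp).symm
  ext A
  simp only [adjointGroup, mem_singleton_iff, forall_eq, mem_ofPred_eq, mem_splitUnitary_iff,
    blockHom_complexConjHom]
  refine and_congr_right fun _ => ?_
  rw [← Matrix.ext_iff]
  refine forall_congr' fun i => forall_congr' fun j => ?_
  rw [Matrix.map_apply, Complex.conj_eq_iff_real]
  exact exists_congr fun _ => eq_comm

theorem isTotallyGeodesic_splitOrthogonalO_splitSpecialUnitary :
    IsTotallyGeodesic (kineticMetric (compactU ι ℂ))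
      ((fun A => A.map (fun x : ℝ => (x : ℂ))) '' splitOrthogonalO ι) (splitSpecialUnitary ι) := by
  refine isMatrixInvolution_complexConjHom.isTotallyGeodesic (S := ∅)
    (fun q hq => isMatrixInvolution_complexConjHom.map_mem_compactU hq)
    (isLieSet_splitSpecialUnitary ι)
    (isRiemannianOn_kineticMetric isClosed_compactU isComponentUnion_compactU (fun g hg => hg.1)
      fun ξ hξ h => eq_zero_of_infinitesimal_complex hξ.2 h)
    (fun g hg => splitUnitary_eq_adjointGroup (ι := ι) (𝔽 := ℂ) ▸ hg.1) inf_le_left ?_ ?_ ?_ ?_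
  · intro g hg
    refine ⟨isMatrixInvolution_complexConjHom.blockHom_mem_splitUnitary hg.1, ?_⟩
    rw [blockHom_complexConjHom]
    have := RingHom.map_det (starRingEnd ℂ) g
    rw [hg.2, map_one] at this
    exact this.symm
  · intro X hX
    refine ⟨isMatrixInvolution_complexConjHom.blockHom_mem_adjointAlgebra (by simp) hX.1, ?_⟩
    have h1 : X.trace = 0 := hX.2
    change Matrix.trace _ = 0
    rw [blockHom_complexConjHom]
    have := AddMonoidHom.map_trace (starRingEnd ℂ).toAddMonoidHom X
    rw [h1, map_zero] at this
    exact this.symm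
  · rintro _ ⟨A, hA, rfl⟩
    refine ⟨(map_mem_splitUnitary_iff (φ := Complex.ofRealHom) Complex.ofReal_injective
      fun x => by simp).2 (isComponentUnion_splitOrthogonalO.1 hA), ?_⟩
    have := RingHom.map_det Complex.ofRealHom A
    rw [det_eq_one_of_mem_splitOrthogonalO hA, map_one] at this
    exact this.symm
  · rw [insert_empty_eq, adjointGroup_complexConjHom]
    exact isComponentUnion_splitOrthogonalO.image (r := fun A => A.map Complex.re)
      (continuous_matrix_map Complex.continuous_re) fun A => by ext; simp

/-- Conjugation by a unit quaternion. -/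
def quaternionConj (u : ℍ[ℝ]) (hu : star u * u = 1) (hu' : u * star u = 1) : ℍ[ℝ] →+* ℍ[ℝ] where
  toFun x := u * x * star u
  map_one' := by rw [mul_one, hu']
  map_zero' := by simp
  map_add' x y := by rw [mul_add, add_mul]
  map_mul' x y := by
    rw [show u * x * star u * (u * y * star u) = u * x * (star u * u) * y * star u by
      simp only [mul_assoc], hu, mul_one, mul_assoc u x y]

variable (ι) in
/-- Entrywise conjugation by a unit quaternion. -/
def quaternionConjHom (u : ℍ[ℝ]) (hu : star u * u = 1) (hu' : u * star u = 1) :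
    MatrixEnd ι ℍ[ℝ] :=
  entrywiseHom ι (quaternionConj u hu hu') fun r x => by simp [quaternionConj]

theorem quatI_mul : star quatI * quatI = 1 ∧ quatI * star quatI = 1 := by
  constructor <;> ext <;> simp

theorem quatJ_mul : star quatJ * quatJ = 1 ∧ quatJ * star quatJ = 1 := by
  constructor <;> ext <;> simp

/-- A unit imaginary quaternion has square `-1`, so conjugation by it is involutive. -/
theorem isMatrixInvolution_quaternionConjHom {u : ℍ[ℝ]} (hu : star u * u = 1)
    (hu' : u * star u = 1) (hstar : star u = -u) :
    IsMatrixInvolution (quaternionConjHom ι u hu hu') := by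
  have huu : u * u = -1 := by rw [← hu', hstar, mul_neg, neg_neg]
  refine isMatrixInvolution_entrywiseHom (fun x => ?_) (fun x => ?_) (fun x y => ?_)
  · change u * (u * x * star u) * star u = x
    rw [show u * (u * x * star u) * star u = (u * u) * x * (star u * star u) by
      simp only [mul_assoc], hstar, neg_mul_neg, huu]
    simp
  · change u * star x * star u = star (u * x * star u)
    rw [star_mul, star_mul, star_star, mul_assoc]
  · change inner ℝ (u * x * star u) (u * y * star u) = inner ℝ x y
    rw [StarInner.inner_mul_right, StarInner.inner_mul_left, star_star]
    congr 1
    rw [show star u * (u * y * star u * u) = (star u * u) * y * (star u * u) by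
      simp only [mul_assoc], hu, one_mul, mul_one]

theorem quatI_conj_eq_iff (x : ℍ[ℝ]) : quatI * x * star quatI = x ↔ x.imJ = 0 ∧ x.imK = 0 := by
  rw [Quaternion.ext_iff]
  simp
  constructor
  · rintro ⟨h1, h2⟩
    constructor <;> linarith
  · rintro ⟨h1, h2⟩
    constructor <;> linarith

theorem quatJ_conj_eq_iff (x : ℍ[ℝ]) : quatJ * x * star quatJ = x ↔ x.imI = 0 ∧ x.imK = 0 := by
  rw [Quaternion.ext_iff]
  simp
  constructor
  · rintro ⟨h1, h2⟩
    constructor <;> linarith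
  · rintro ⟨h1, h2⟩
    constructor <;> linarith

variable (ι) in
/-- Entrywise conjugation by `i`. -/
abbrev conjIHom : MatrixEnd ι ℍ[ℝ] :=
  quaternionConjHom ι quatI quatI_mul.1 quatI_mul.2

variable (ι) in
/-- Entrywise conjugation by `j`. -/
abbrev conjJHom : MatrixEnd ι ℍ[ℝ] :=
  quaternionConjHom ι quatJ quatJ_mul.1 quatJ_mul.2

theorem isMatrixInvolution_conjIHom : IsMatrixInvolution (conjIHom ι) :=
  isMatrixInvolution_quaternionConjHom _ _ (by ext <;> simp)

theorem isMatrixInvolution_conjJHom : IsMatrixInvolution (conjJHom ι) :=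
  isMatrixInvolution_quaternionConjHom _ _ (by ext <;> simp)

theorem blockHom_quaternionConjHom {u : ℍ[ℝ]} {hu : star u * u = 1} {hu' : u * star u = 1}
    (A : Matrix (ι ⊕ ι) (ι ⊕ ι) ℍ[ℝ]) :
    blockHom (quaternionConjHom ι u hu hu') A = A.map fun x => u * x * star u :=
  blockHom_entrywiseHom A

theorem blockHom_quaternionConjHom_eq_iff {u : ℍ[ℝ]} {hu : star u * u = 1} {hu' : u * star u = 1}
    {A : Matrix (ι ⊕ ι) (ι ⊕ ι) ℍ[ℝ]} :
    blockHom (quaternionConjHom ι u hu hu') A = A ↔ ∀ i j, u * A i j * star u = A i j := by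
  rw [blockHom_quaternionConjHom, ← Matrix.ext_iff]
  rfl

theorem adjointGroup_conjIHom :
    adjointGroup (splitAdjoint ι ℍ[ℝ]) {blockHom (conjIHom ι)} =
      (fun A => A.map (fun z : ℂ => (z : ℍ[ℝ]))) '' splitUnitary ι ℂ := by
  refine Eq.trans ?_ (image_map_splitUnitary (φ := Quaternion.ofComplex.toRingHom)
    Quaternion.ofComplex.toRingHom.injective fun x => by ext <;> simp).symm
  ext A
  simp only [adjointGroup, mem_singleton_iff, forall_eq, mem_ofPred_eq, mem_splitUnitary_iff,
    blockHom_quaternionConjHom_eq_iff, quatI_conj_eq_iff]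
  refine and_congr_right fun _ => forall_congr' fun i => forall_congr' fun j => ?_
  constructor
  · rintro ⟨h1, h2⟩
    exact ⟨⟨(A i j).re, (A i j).imI⟩, by ext <;> simp [h1, h2]⟩
  · rintro ⟨z, hz⟩
    rw [← hz]
    simp

/-- Commuting with i leaves the span of 1 and i, and commuting with j as well leaves the reals. -/
theorem adjointGroup_conjJHom_conjIHom :
    adjointGroup (splitAdjoint ι ℍ[ℝ]) {blockHom (conjJHom ι), blockHom (conjIHom ι)} =
      (fun A => A.map (fun x : ℝ => (x : ℍ[ℝ]))) '' splitUnitary ι ℝ := by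
  refine Eq.trans ?_ (image_map_splitUnitary (φ := algebraMap ℝ ℍ[ℝ])
    (algebraMap ℝ ℍ[ℝ]).injective fun x => by simp).symm
  ext A
  simp only [adjointGroup, mem_insert_iff, mem_singleton_iff, forall_eq_or_imp, forall_eq,
    mem_ofPred_eq, mem_splitUnitary_iff, blockHom_quaternionConjHom_eq_iff, quatI_conj_eq_iff,
    quatJ_conj_eq_iff]
  refine and_congr_right fun _ => ?_
  constructor
  · rintro ⟨h1, h2⟩ i j
    refine ⟨(A i j).re, ?_⟩
    ext <;> simp [(h1 i j).1, (h2 i j).1, (h2 i j).2]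
  · intro h
    constructor <;> intro i j <;> obtain ⟨z, hz⟩ := h i j <;> rw [← hz] <;> simp

theorem isRiemannianOn_kineticMetric_quaternion :
    IsRiemannianOn (kineticMetric (compactU ι ℍ[ℝ])) (splitUnitary ι ℍ[ℝ])
      (adjointAlgebra (splitAdjoint ι ℍ[ℝ]) ∅) :=
  isRiemannianOn_kineticMetric isClosed_compactU isComponentUnion_compactU subset_rfl
    fun _ hξ h => eq_zero_of_infinitesimal_quaternion hξ h

theorem isTotallyGeodesic_splitUnitary_quaternion :
    IsTotallyGeodesic (kineticMetric (compactU ι ℍ[ℝ]))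
      ((fun A => A.map (fun z : ℂ => (z : ℍ[ℝ]))) '' splitUnitary ι ℂ) (splitUnitary ι ℍ[ℝ]) := by
  rw [← adjointGroup_conjIHom]
  refine isMatrixInvolution_conjIHom.isTotallyGeodesic_of_isComponentUnion (S := ∅)
    (fun q hq => isMatrixInvolution_conjIHom.map_mem_compactU hq) ?_
    isRiemannianOn_kineticMetric_quaternion (by simp)
    (fun g hg => isMatrixInvolution_conjIHom.blockHom_mem_splitUnitary hg)
    (fun g hg => mem_splitUnitary_iff.2 hg.1) ?_
  · rw [splitUnitary_eq_adjointGroup]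
    exact isComponentUnion_self _
  · rw [insert_empty_eq]
    exact isComponentUnion_self _

/-- Inside U(n, n), the fixed group of conjugation by i, the real matrices are fixed by conjugation
by j. The intermediate U(n, n) carries the metric induced from Sp(n, n), not its own kinetic energy
metric. -/
theorem isTotallyGeodesic_splitOrthogonalO_quaternion :
    IsTotallyGeodesic (kineticMetric (compactU ι ℍ[ℝ]))
      ((fun A => A.map (fun x : ℝ => (x : ℍ[ℝ]))) '' splitOrthogonalO ι)
      (splitUnitary ι ℍ[ℝ]) := by
  refine IsTotallyGeodesic.trans ?_ isTotallyGeodesic_splitUnitary_quaternion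
  have hN : IsComponentUnion
      (adjointGroup (splitAdjoint ι ℍ[ℝ]) {blockHom (conjJHom ι), blockHom (conjIHom ι)})
      ((fun A => A.map (fun x : ℝ => (x : ℍ[ℝ]))) '' splitOrthogonalO ι) := by
    rw [adjointGroup_conjJHom_conjIHom]
    exact isComponentUnion_splitOrthogonalO.image (r := fun A => A.map (fun x : ℍ[ℝ] => x.re))
      (continuous_matrix_map Quaternion.continuous_re) fun A => by ext; simp
  -- The units i and j anticommute, and the signs cancel in the conjugations.
  have hcomm : ∀ σ ∈ ({blockHom (conjIHom ι)} : Set (MatrixEnd (ι ⊕ ι) ℍ[ℝ])), ∀ x,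
      σ (blockHom (conjJHom ι) x) =
        blockHom (conjJHom ι) (σ x) := by
    rintro _ rfl x
    rw [blockHom_quaternionConjHom, blockHom_quaternionConjHom, blockHom_quaternionConjHom,
      blockHom_quaternionConjHom]
    refine Matrix.ext fun i j => ?_
    change quatI * (quatJ * x i j * star quatJ) * star quatI =
      quatJ * (quatI * x i j * star quatI) * star quatJ
    generalize x i j = y
    ext <;> simp
  rw [← adjointGroup_conjIHom]
  refine isMatrixInvolution_conjJHom.isTotallyGeodesic_of_isComponentUnion
    (fun q hq => isMatrixInvolution_conjJHom.map_mem_compactU hq) (isComponentUnion_self _)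
    (isRiemannianOn_kineticMetric_quaternion.mono (fun g hg => mem_splitUnitary_iff.2 hg.1)
      fun X hX => ⟨hX.1, by simp⟩) hcomm
    (fun g hg => isMatrixInvolution_conjJHom.blockHom_mem_adjointGroup hcomm hg)
    (fun g hg => ⟨(hN.1 hg).1, fun σ hσ => (hN.1 hg).2 σ (mem_insert_of_mem _ hσ)⟩) hN

end RealComplexQuaternion

/-! ### Restriction of scalars -/

section RealBlocks

variable {ι κ : Type*} [Fintype ι] [DecidableEq ι] [Fintype κ] [DecidableEq κ]

/-- The coordinate `a` of the entry with index `x`. -/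
def blockIndex (x : ι ⊕ ι) (a : κ) : (ι × κ) ⊕ (ι × κ) := Equiv.sumProdDistrib ι ι κ (x, a)

/-- A real matrix seen as a matrix with entries in the square matrices of size `κ`. -/
def realBlocks (A : Matrix ((ι × κ) ⊕ (ι × κ)) ((ι × κ) ⊕ (ι × κ)) ℝ) :
    Matrix (ι ⊕ ι) (ι ⊕ ι) (Matrix κ κ ℝ) :=
  Matrix.of fun x y => Matrix.of fun a c => A (blockIndex x a) (blockIndex y c)

theorem realBlocks_injective : Function.Injective (realBlocks (ι := ι) (κ := κ)) := by
  intro A B h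
  ext p q
  obtain ⟨⟨x, a⟩, rfl⟩ := (Equiv.sumProdDistrib ι ι κ).surjective p
  obtain ⟨⟨y, c⟩, rfl⟩ := (Equiv.sumProdDistrib ι ι κ).surjective q
  exact congrFun (congrFun (congrFun (congrFun h x) y) a) c

theorem realBlocks_mul (A B : Matrix ((ι × κ) ⊕ (ι × κ)) ((ι × κ) ⊕ (ι × κ)) ℝ) :
    realBlocks (A * B) = realBlocks A * realBlocks B := by
  refine Matrix.ext fun x y => Matrix.ext fun a c => ?_
  rw [Matrix.mul_apply, Matrix.sum_apply]
  change (A * B) _ _ = ∑ z, ∑ d, A (blockIndex x a) (blockIndex z d) *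
    B (blockIndex z d) (blockIndex y c)
  rw [Matrix.mul_apply, ← (Equiv.sumProdDistrib ι ι κ).sum_comp, Fintype.sum_prod_type]
  rfl

theorem realBlocks_conjTranspose (A : Matrix ((ι × κ) ⊕ (ι × κ)) ((ι × κ) ⊕ (ι × κ)) ℝ) :
    realBlocks Aᴴ = (realBlocks A)ᴴ := rfl

theorem realBlocks_form :
    realBlocks (Matrix.fromBlocks 1 0 0 (-1) : Matrix ((ι × κ) ⊕ (ι × κ)) ((ι × κ) ⊕ (ι × κ)) ℝ) =
      Matrix.fromBlocks 1 0 0 (-1) := by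
  refine Matrix.ext fun x y => Matrix.ext fun a c => ?_
  rcases x with x | x <;> rcases y with y | y
  · change (1 : Matrix (ι × κ) (ι × κ) ℝ) (x, a) (y, c) = (1 : Matrix ι ι (Matrix κ κ ℝ)) x y a c
    rcases eq_or_ne x y with rfl | hxy
    · simp [Matrix.one_apply]
    · simp [hxy]
  · rfl
  · rfl
  · change -(1 : Matrix (ι × κ) (ι × κ) ℝ) (x, a) (y, c) =
      -(1 : Matrix ι ι (Matrix κ κ ℝ)) x y a c
    rcases eq_or_ne x y with rfl | hxy
    · simp [Matrix.one_apply]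
    · simp [hxy]

theorem realBlocks_mem_splitUnitary_iff
    {A : Matrix ((ι × κ) ⊕ (ι × κ)) ((ι × κ) ⊕ (ι × κ)) ℝ} :
    realBlocks A ∈ splitUnitary ι (Matrix κ κ ℝ) ↔ A ∈ splitUnitary (ι × κ) ℝ := by
  change (realBlocks A)ᴴ * Matrix.fromBlocks 1 0 0 (-1) * realBlocks A =
    Matrix.fromBlocks 1 0 0 (-1) ↔
    Aᴴ * Matrix.fromBlocks 1 0 0 (-1) * A = Matrix.fromBlocks 1 0 0 (-1)
  rw [← realBlocks_form, ← realBlocks_conjTranspose, ← realBlocks_mul, ← realBlocks_mul]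
  exact realBlocks_injective.eq_iff

variable {𝔽 : Type*} [Ring 𝔽] [Algebra ℝ 𝔽] [StarRing 𝔽]

theorem realBlocks_realify (b : Module.Basis κ ℝ 𝔽) (A : Matrix (ι ⊕ ι) (ι ⊕ ι) 𝔽) :
    realBlocks (realify b A) = A.map (Algebra.leftMulMatrix b).toRingHom := by
  refine Matrix.ext fun x y => Matrix.ext fun a c => ?_
  rcases x with x | x <;> rcases y with y | y <;> rfl

/-- Once `star` becomes transposition of the left multiplication matrices, restriction of scalars is
the entrywise embedding of `𝔽` in the ring of real `κ × κ` matrices, and the description of images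
under extension of scalars applies. -/
theorem realify_image_splitUnitary {b : Module.Basis κ ℝ 𝔽}
    (hb : ∀ x, Algebra.leftMulMatrix b (star x) = (Algebra.leftMulMatrix b x)ᴴ) :
    realify b '' splitUnitary ι 𝔽 = {A | A ∈ splitUnitary (ι × κ) ℝ ∧
      ∀ x y, realBlocks A x y ∈ range (Algebra.leftMulMatrix b)} := by
  have h := image_map_splitUnitary (ι := ι) (φ := (Algebra.leftMulMatrix b).toRingHom)
    (Algebra.leftMulMatrix_injective b) hb
  ext A
  rw [mem_ofPred_eq, ← realBlocks_mem_splitUnitary_iff]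
  have h2 := Set.ext_iff.1 h (realBlocks A)
  refine Iff.trans ?_ h2
  constructor
  · rintro ⟨B, hB, rfl⟩
    exact ⟨B, hB, (realBlocks_realify b B).symm⟩
  · rintro ⟨B, hB, hBA⟩
    exact ⟨B, hB, realBlocks_injective ((realBlocks_realify b B).trans hBA)⟩

theorem realify_one (b : Module.Basis κ ℝ 𝔽) :
    realify b (1 : Matrix (ι ⊕ ι) (ι ⊕ ι) 𝔽) = 1 := by
  refine realBlocks_injective ?_
  rw [realBlocks_realify, Matrix.map_one _ (map_zero _) (map_one _)]
  refine Matrix.ext fun x y => Matrix.ext fun a c => ?_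
  change _ = (1 : Matrix ((ι × κ) ⊕ (ι × κ)) ((ι × κ) ⊕ (ι × κ)) ℝ) _ _
  rcases eq_or_ne x y with rfl | hxy
  · simp [Matrix.one_apply, blockIndex, -Equiv.sumProdDistrib_apply_left,
      -Equiv.sumProdDistrib_apply_right]
  · simp [Matrix.one_apply, blockIndex, hxy]

/-- The matrix of the right multiplication by `u`. -/
def rightMulMatrix (b : Module.Basis κ ℝ 𝔽) (u : 𝔽) : Matrix κ κ ℝ :=
  LinearMap.toMatrix b b (LinearMap.mulRight ℝ u)

theorem rightMulMatrix_mul (b : Module.Basis κ ℝ 𝔽) (u v : 𝔽) :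
    rightMulMatrix b u * rightMulMatrix b v = rightMulMatrix b (v * u) := by
  rw [rightMulMatrix, rightMulMatrix, ← LinearMap.toMatrix_comp, rightMulMatrix,
    LinearMap.mulRight_mul]

theorem rightMulMatrix_one (b : Module.Basis κ ℝ 𝔽) : rightMulMatrix b (1 : 𝔽) = 1 := by
  rw [rightMulMatrix, LinearMap.mulRight_one, LinearMap.toMatrix_id]

theorem rightMulMatrix_neg (b : Module.Basis κ ℝ 𝔽) (u : 𝔽) :
    rightMulMatrix b (-u) = -rightMulMatrix b u := by
  rw [rightMulMatrix, rightMulMatrix, ← map_neg]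
  congr 1
  ext
  simp

/-- The matrices of the left multiplications are those that commute with sufficiently many right
multiplications. -/
theorem mem_range_leftMulMatrix_iff {b : Module.Basis κ ℝ 𝔽} {T : Set 𝔽}
    (hT : ∀ W : Submodule ℝ 𝔽, 1 ∈ W → (∀ x ∈ W, ∀ u ∈ T, x * u ∈ W) → W = ⊤)
    {L : Matrix κ κ ℝ} :
    L ∈ range (Algebra.leftMulMatrix b) ↔
      ∀ u ∈ T, rightMulMatrix b u * L = L * rightMulMatrix b u := by
  constructor
  · rintro ⟨x, rfl⟩ u -
    rw [rightMulMatrix, Algebra.leftMulMatrix_apply, ← LinearMap.toMatrix_comp,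
      ← LinearMap.toMatrix_comp]
    congr 1
    ext y
    simp [mul_assoc]
  · intro h
    let l : 𝔽 →ₗ[ℝ] 𝔽 := Matrix.toLin b b L
    have hl : ∀ u ∈ T, ∀ x, l (x * u) = l x * u := by
      intro u hu x
      have h1 := congrArg (Matrix.toLin b b) (h u hu)
      rw [Matrix.toLin_mul b b b, Matrix.toLin_mul b b b, rightMulMatrix,
        Matrix.toLin_toMatrix] at h1
      exact (LinearMap.congr_fun h1 x).symm
    -- A map commuting with the right multiplications agrees with left multiplication by `l 1` on a
    -- subspace that contains 1 and is stable under them, hence everywhere.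
    let W : Submodule ℝ 𝔽 := LinearMap.eqLocus l (LinearMap.mulLeft ℝ (l 1))
    have hW : W = ⊤ := by
      refine hT W ?_ fun x hx u hu => ?_
      · change l 1 = l 1 * 1
        rw [mul_one]
      · have hx' : l x = l 1 * x := hx
        change l (x * u) = l 1 * (x * u)
        rw [hl u hu, hx', mul_assoc]
    refine ⟨l 1, ?_⟩
    have h2 : LinearMap.mulLeft ℝ (l 1) = l := by
      ext x
      exact (hW ▸ Submodule.mem_top : x ∈ W).symm
    rw [Algebra.leftMulMatrix_apply]
    change LinearMap.toMatrix b b (LinearMap.mulLeft ℝ (l 1)) = L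
    rw [h2, LinearMap.toMatrix_toLin]

end RealBlocks

/-! ### The inclusions in the real groups -/

section Continuity

universe u

variable {ι : Type u} [Fintype ι] [DecidableEq ι]
  {𝔽 : Type u} [NormedDivisionRing 𝔽] [InnerProductSpace ℝ 𝔽] [StarRing 𝔽] [StarModule ℝ 𝔽]
  [IsScalarTower ℝ 𝔽 𝔽] [SMulCommClass ℝ 𝔽 𝔽] [FiniteDimensional ℝ 𝔽]

theorem continuous_blockHom (t : MatrixEnd ι 𝔽) : Continuous (blockHom t) :=
  (blockHom t).toLinearMap.continuous_of_finiteDimensional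

end Continuity

/-! ### Conjugation by an orthogonal matrix in every block -/

section RightMultiplication

open scoped Kronecker

variable {ι κ : Type} [Fintype ι] [DecidableEq ι] [Fintype κ] [DecidableEq κ]

theorem kronecker_conj_apply (r : Matrix κ κ ℝ) (B : Matrix (ι × κ) (ι × κ) ℝ) (i j : ι) (a c : κ) :
    (((1 : Matrix ι ι ℝ) ⊗ₖ r) * B * ((1 : Matrix ι ι ℝ) ⊗ₖ r)ᴴ) (i, a) (j, c) =
      (r * (Matrix.of fun a c => B (i, a) (j, c)) * rᴴ) a c := by
  simp only [Matrix.mul_apply, Fintype.sum_prod_type, Matrix.kroneckerMap_apply,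
    Matrix.conjTranspose_apply, Matrix.one_apply, Matrix.of_apply, star_trivial, ite_mul, one_mul,
    zero_mul, mul_ite, mul_zero, Finset.sum_ite_irrel, Finset.sum_const_zero, Finset.sum_ite_eq,
    Finset.mem_univ, if_true]

variable (ι) in
theorem kronecker_conjTranspose_mul {r s : Matrix κ κ ℝ} (h : rᴴ * s = 1) :
    ((1 : Matrix ι ι ℝ) ⊗ₖ r)ᴴ * ((1 : Matrix ι ι ℝ) ⊗ₖ s) = 1 := by
  rw [Matrix.conjTranspose_kronecker, ← Matrix.mul_kronecker_mul, h, Matrix.conjTranspose_one,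
    mul_one, Matrix.one_kronecker_one]

variable (ι) in
theorem kronecker_mul_conjTranspose {r s : Matrix κ κ ℝ} (h : r * sᴴ = 1) :
    ((1 : Matrix ι ι ℝ) ⊗ₖ r) * ((1 : Matrix ι ι ℝ) ⊗ₖ s)ᴴ = 1 := by
  rw [Matrix.conjTranspose_kronecker, ← Matrix.mul_kronecker_mul, h, Matrix.conjTranspose_one,
    mul_one, Matrix.one_kronecker_one]

variable (ι) in
/-- Conjugation by an orthogonal matrix of size `κ` in each block. -/
def blockConjHom (r : Matrix κ κ ℝ) (h : rᴴ * r = 1) (h' : r * rᴴ = 1) : MatrixEnd (ι × κ) ℝ :=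
  conjugationHom ((1 : Matrix ι ι ℝ) ⊗ₖ r) (kronecker_conjTranspose_mul ι h)
    (kronecker_mul_conjTranspose ι h')

variable {r s : Matrix κ κ ℝ} {h : rᴴ * r = 1} {h' : r * rᴴ = 1} {k : sᴴ * s = 1} {k' : s * sᴴ = 1}

theorem isMatrixInvolution_blockConjHom (hr : rᴴ = -r) :
    IsMatrixInvolution (blockConjHom ι r h h') := by
  refine isMatrixInvolution_conjugationHom ?_
  rw [Matrix.conjTranspose_kronecker, hr, Matrix.conjTranspose_one]
  ext ⟨i, a⟩ ⟨j, c⟩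
  simp

theorem blockConjHom_mem_compactSO (hr : rᴴ = -r) {q : Matrix (ι × κ) (ι × κ) ℝ}
    (hq : q ∈ compactSO (ι × κ)) : blockConjHom ι r h h' q ∈ compactSO (ι × κ) := by
  have hq' := Matrix.mem_specialOrthogonalGroup_iff.1 hq
  refine Matrix.mem_specialOrthogonalGroup_iff.2
    ⟨(isMatrixInvolution_blockConjHom hr).map_mem_compactU hq'.1, ?_⟩
  change (((1 : Matrix ι ι ℝ) ⊗ₖ r) * q * ((1 : Matrix ι ι ℝ) ⊗ₖ r)ᴴ).det = 1
  rw [Matrix.det_mul_right_comm, kronecker_mul_conjTranspose ι h', one_mul, hq'.2]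

theorem realBlocks_blockHom (A : Matrix ((ι × κ) ⊕ (ι × κ)) ((ι × κ) ⊕ (ι × κ)) ℝ) (x y : ι ⊕ ι) :
    realBlocks (blockHom (blockConjHom ι r h h') A) x y = r * realBlocks A x y * rᴴ := by
  ext a c
  rcases x with x | x <;> rcases y with y | y <;> exact kronecker_conj_apply r _ x y a c

theorem blockHom_blockConjHom_eq_iff
    {A : Matrix ((ι × κ) ⊕ (ι × κ)) ((ι × κ) ⊕ (ι × κ)) ℝ} :
    blockHom (blockConjHom ι r h h') A = A ↔
      ∀ x y, r * realBlocks A x y = realBlocks A x y * r := by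
  rw [← realBlocks_injective.eq_iff, ← Matrix.ext_iff]
  refine forall_congr' fun x => forall_congr' fun y => ?_
  rw [realBlocks_blockHom]
  constructor
  · intro e
    nth_rewrite 2 [← e]
    rw [mul_assoc _ rᴴ, h, mul_one]
  · intro e
    rw [e, mul_assoc, h', mul_one]

/-- Anticommuting matrices give commuting conjugations, the two signs cancelling. -/
theorem blockHom_blockConjHom_comm (hrs : r * s = -(s * r))
    (A : Matrix ((ι × κ) ⊕ (ι × κ)) ((ι × κ) ⊕ (ι × κ)) ℝ) :
    blockHom (blockConjHom ι r h h') (blockHom (blockConjHom ι s k k') A) =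
      blockHom (blockConjHom ι s k k') (blockHom (blockConjHom ι r h h') A) := by
  refine realBlocks_injective (Matrix.ext fun x y => ?_)
  rw [realBlocks_blockHom, realBlocks_blockHom, realBlocks_blockHom, realBlocks_blockHom]
  have e1 : sᴴ * rᴴ = -(rᴴ * sᴴ) := by
    rw [← Matrix.conjTranspose_mul, hrs, Matrix.conjTranspose_neg, Matrix.conjTranspose_mul]
  rw [show r * (s * realBlocks A x y * sᴴ) * rᴴ = (r * s) * realBlocks A x y * (sᴴ * rᴴ) by
    simp only [mul_assoc], hrs, e1, neg_mul, neg_mul_neg]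
  simp only [mul_assoc]

theorem isRiemannianOn_kineticMetric_real (hι : Even (Fintype.card ι))
    (hι2 : 2 < Fintype.card ι) :
    IsRiemannianOn (kineticMetric (compactSO ι)) (splitOrthogonalO ι)
      (adjointAlgebra (splitAdjoint ι ℝ) ∅) :=
  isRiemannianOn_kineticMetric isClosed_compactSO isComponentUnion_compactSO
    isComponentUnion_splitOrthogonalO.1
    fun _ hξ h => eq_zero_of_infinitesimal_real hι hι2 hξ h

theorem subset_splitOrthogonalO {T : Set (Matrix (ι ⊕ ι) (ι ⊕ ι) ℝ)} (hT : IsPreconnected T)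
    (h1 : 1 ∈ T) (hTU : T ⊆ splitUnitary ι ℝ) : T ⊆ splitOrthogonalO ι :=
  isComponentUnion_splitOrthogonalO.2 T hTU hT ⟨1, h1, one_mem_splitOrthogonalO⟩

/-- A connected subgroup of `O(m, m)` that consists of the fixed points of an involution is totally
geodesic in `O_o(m, m)`. -/
theorem IsMatrixInvolution.isTotallyGeodesic_splitOrthogonalO {t : MatrixEnd ι ℝ}
    (ht : IsMatrixInvolution t) (htM : ∀ q ∈ compactSO ι, t q ∈ compactSO ι)
    (hι : Even (Fintype.card ι)) (hι2 : 2 < Fintype.card ι)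
    {N : Set (Matrix (ι ⊕ ι) (ι ⊕ ι) ℝ)} (hN1 : 1 ∈ N) (hNc : IsPreconnected N)
    (hN : IsComponentUnion (adjointGroup (splitAdjoint ι ℝ) {blockHom t}) N) :
    IsTotallyGeodesic (kineticMetric (compactSO ι)) N (splitOrthogonalO ι) := by
  refine ht.isTotallyGeodesic_of_isComponentUnion (S := ∅) htM ?_
    (isRiemannianOn_kineticMetric_real hι hι2) (by simp) ?_
    (subset_splitOrthogonalO hNc hN1 fun A hA => mem_splitUnitary_iff.2 (hN.1 hA).1) ?_
  · rw [← splitUnitary_eq_adjointGroup]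
    exact isComponentUnion_splitOrthogonalO
  · intro g hg
    exact map_connectedComponentIn_subset (continuous_blockHom t)
      (fun a ha => ht.blockHom_mem_splitUnitary ha) (map_one _) hg
  · rwa [insert_empty_eq]

/-- A connected subgroup of `O(m, m)` that consists of the common fixed points of two commuting
involutions is totally geodesic in `O_o(m, m)`. -/
theorem IsMatrixInvolution.isTotallyGeodesic_splitOrthogonalO_of_commute {t t' : MatrixEnd ι ℝ}
    (ht : IsMatrixInvolution t) (htM : ∀ q ∈ compactSO ι, t q ∈ compactSO ι)
    (ht' : IsMatrixInvolution t') (htM' : ∀ q ∈ compactSO ι, t' q ∈ compactSO ι)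
    (hcomm : ∀ A, blockHom t (blockHom t' A) = blockHom t' (blockHom t A))
    (hι : Even (Fintype.card ι)) (hι2 : 2 < Fintype.card ι)
    {N : Set (Matrix (ι ⊕ ι) (ι ⊕ ι) ℝ)} (hN1 : 1 ∈ N) (hNc : IsPreconnected N)
    (hN : IsComponentUnion (adjointGroup (splitAdjoint ι ℝ) {blockHom t', blockHom t}) N) :
    IsTotallyGeodesic (kineticMetric (compactSO ι)) N (splitOrthogonalO ι) := by
  have h1 : (1 : Matrix (ι ⊕ ι) (ι ⊕ ι) ℝ) ∈
      adjointGroup (splitAdjoint ι ℝ) {blockHom t} :=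
    ⟨mem_splitUnitary_iff.1 one_mem_splitUnitary, fun σ _ => map_one σ⟩
  have hS : ∀ σ ∈ ({blockHom t} : Set (MatrixEnd (ι ⊕ ι) ℝ)), ∀ x,
      σ (blockHom t' x) = blockHom t' (σ x) := by
    rintro _ rfl x
    exact hcomm x
  -- The fixed group of the first involution may have several components; its identity component
  -- lies in the identity component of O(m, m), contains the connected `N`, and is preserved by the
  -- second involution.
  refine IsTotallyGeodesic.trans
    (N' := connectedComponentIn (adjointGroup (splitAdjoint ι ℝ) {blockHom t}) 1) ?_
    (ht.isTotallyGeodesic_splitOrthogonalO htM hι hι2 (mem_connectedComponentIn h1)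
      isPreconnected_connectedComponentIn (isComponentUnion_connectedComponentIn _ _))
  refine ht'.isTotallyGeodesic_of_isComponentUnion htM'
    (isComponentUnion_connectedComponentIn _ _)
    ((isRiemannianOn_kineticMetric_real hι hι2).mono ?_ fun X hX => ⟨hX.1, by simp⟩) hS ?_ ?_ hN
  · exact subset_splitOrthogonalO isPreconnected_connectedComponentIn (mem_connectedComponentIn h1)
      fun A hA => mem_splitUnitary_iff.2 (connectedComponentIn_subset _ _ hA).1
  · intro g hg
    exact map_connectedComponentIn_subset (continuous_blockHom t')
      (fun a ha => ht'.blockHom_mem_adjointGroup hS ha) (map_one _) hg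
  · exact hNc.subset_connectedComponentIn hN1 fun A hA =>
      ⟨(hN.1 hA).1, fun σ hσ => (hN.1 hA).2 σ (mem_insert_of_mem _ hσ)⟩

end RightMultiplication

/-! ### Continuity of realification and right multiplication by imaginary units -/

section Realify

variable {ι κ : Type} [Fintype ι] [DecidableEq ι] [Fintype κ] [DecidableEq κ]

theorem continuous_realify {𝔽 : Type} [NormedDivisionRing 𝔽] [NormedAlgebra ℝ 𝔽]
    [FiniteDimensional ℝ 𝔽] (b : Module.Basis κ ℝ 𝔽) :
    Continuous (realify (ι := ι) b) := by
  refine continuous_matrix fun p q => ?_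
  have h1 : Continuous fun x : 𝔽 => Algebra.leftMulMatrix b x
      (Sum.elim Prod.snd Prod.snd p) (Sum.elim Prod.snd Prod.snd q) :=
    LinearMap.continuous_of_finiteDimensional
      { toFun := fun x : 𝔽 => Algebra.leftMulMatrix b x
          (Sum.elim Prod.snd Prod.snd p) (Sum.elim Prod.snd Prod.snd q)
        map_add' := fun x y => by rw [map_add]; rfl
        map_smul' := fun c x => by rw [map_smul]; rfl }
  exact h1.comp (Continuous.matrix_elem (A := fun A : Matrix (ι ⊕ ι) (ι ⊕ ι) 𝔽 => A)
    continuous_id _ _)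

variable {𝔽 : Type} [Ring 𝔽] [Algebra ℝ 𝔽] [StarRing 𝔽] {b : Module.Basis κ ℝ 𝔽}

theorem rightMulMatrix_unitary
    (hb : ∀ x, rightMulMatrix b (star x) = (rightMulMatrix b x)ᴴ) {u : 𝔽} (hu : star u = -u)
    (huu : u * u = -1) : (rightMulMatrix b u)ᴴ = -rightMulMatrix b u ∧
      (rightMulMatrix b u)ᴴ * rightMulMatrix b u = 1 ∧
        rightMulMatrix b u * (rightMulMatrix b u)ᴴ = 1 := by
  rw [← hb, hu, rightMulMatrix_neg]
  refine ⟨rfl, ?_, ?_⟩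
  · rw [neg_mul, rightMulMatrix_mul, huu, rightMulMatrix_neg, neg_neg, rightMulMatrix_one]
  · rw [mul_neg, rightMulMatrix_mul, huu, rightMulMatrix_neg, neg_neg, rightMulMatrix_one]

end Realify

/-! ### The inclusions of U(n, n) and Sp(n, n) in real groups -/

section RealifyComplexQuaternion

variable {ι : Type} [Fintype ι] [DecidableEq ι]

theorem rightMulMatrix_apply {κ 𝔽 : Type} [Fintype κ] [DecidableEq κ] [Ring 𝔽] [Algebra ℝ 𝔽]
    (b : Module.Basis κ ℝ 𝔽) (u : 𝔽) (i j : κ) :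
    rightMulMatrix b u i j = b.repr (b j * u) i := by
  rw [rightMulMatrix, LinearMap.toMatrix_apply, LinearMap.mulRight_apply]

theorem complex_leftMulMatrix_star (x : ℂ) : Algebra.leftMulMatrix Complex.basisOneI (star x) =
    (Algebra.leftMulMatrix Complex.basisOneI x)ᴴ := by
  ext i j
  rw [Matrix.conjTranspose_apply, Algebra.leftMulMatrix_eq_repr_mul,
    Algebra.leftMulMatrix_eq_repr_mul]
  fin_cases i <;> fin_cases j <;> simp

theorem complex_rightMulMatrix_star (x : ℂ) : rightMulMatrix Complex.basisOneI (star x) =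
    (rightMulMatrix Complex.basisOneI x)ᴴ := by
  ext i j
  rw [Matrix.conjTranspose_apply, rightMulMatrix_apply, rightMulMatrix_apply]
  fin_cases i <;> fin_cases j <;> simp

theorem quaternionBasis_repr (x : ℍ[ℝ]) (i : Fin 4) :
    quaternionBasis.repr x i = ![x.re, x.imI, x.imJ, x.imK] i := rfl

theorem quaternionBasis_apply (i : Fin 4) :
    quaternionBasis i = ![1, quatI, quatJ, quatK] i := by
  refine quaternionBasis.repr.injective (Finsupp.ext fun j => ?_)
  rw [Module.Basis.repr_self, quaternionBasis_repr]
  fin_cases i <;> fin_cases j <;> simp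

theorem quaternion_leftMulMatrix_star (x : ℍ[ℝ]) : Algebra.leftMulMatrix quaternionBasis (star x) =
    (Algebra.leftMulMatrix quaternionBasis x)ᴴ := by
  ext i j
  rw [Matrix.conjTranspose_apply, Algebra.leftMulMatrix_eq_repr_mul,
    Algebra.leftMulMatrix_eq_repr_mul, quaternionBasis_repr, quaternionBasis_repr,
    quaternionBasis_apply, quaternionBasis_apply]
  fin_cases i <;> fin_cases j <;> simp

theorem quaternion_rightMulMatrix_star (x : ℍ[ℝ]) : rightMulMatrix quaternionBasis (star x) =
    (rightMulMatrix quaternionBasis x)ᴴ := by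
  ext i j
  rw [Matrix.conjTranspose_apply, rightMulMatrix_apply, rightMulMatrix_apply,
    quaternionBasis_repr, quaternionBasis_repr, quaternionBasis_apply, quaternionBasis_apply]
  fin_cases i <;> fin_cases j <;> simp

/-- Right multiplication by i alone detects complex linearity, since 1 and 1 · i span ℂ. -/
theorem complex_submodule_eq_top (W : Submodule ℝ ℂ) (h1 : 1 ∈ W)
    (h : ∀ x ∈ W, ∀ u ∈ ({Complex.I} : Set ℂ), x * u ∈ W) : W = ⊤ := by
  refine eq_top_iff.2 fun z _ => ?_
  have hI : Complex.I ∈ W := by simpa using h 1 h1 Complex.I rfl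
  have hz : z = z.re • (1 : ℂ) + z.im • Complex.I := by
    apply Complex.ext <;> simp
  rw [hz]
  exact W.add_mem (W.smul_mem _ h1) (W.smul_mem _ hI)

/-- Two units suffice over ℍ because the third is the product i · j. -/
theorem quaternion_submodule_eq_top (W : Submodule ℝ ℍ[ℝ]) (h1 : 1 ∈ W)
    (h : ∀ x ∈ W, ∀ u ∈ ({quatJ, quatI} : Set ℍ[ℝ]), x * u ∈ W) : W = ⊤ := by
  refine eq_top_iff.2 fun z _ => ?_
  have hI : quatI ∈ W := by simpa using h 1 h1 quatI (by simp)
  have hJ : quatJ ∈ W := by simpa using h 1 h1 quatJ (by simp)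
  have hK : quatI * quatJ ∈ W := h _ hI _ (by simp)
  have hz : z = z.re • (1 : ℍ[ℝ]) + z.imI • quatI + z.imJ • quatJ + z.imK • (quatI * quatJ) := by
    ext <;> simp
  rw [hz]
  exact W.add_mem (W.add_mem (W.add_mem (W.smul_mem _ h1) (W.smul_mem _ hI)) (W.smul_mem _ hJ))
    (W.smul_mem _ hK)

theorem isTotallyGeodesic_realify_complex (hι : 1 < Fintype.card ι) :
    IsTotallyGeodesic (kineticMetric (compactSO (ι × Fin 2)))
      (realify Complex.basisOneI '' splitUnitary ι ℂ) (splitOrthogonalO (ι × Fin 2)) := by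
  obtain ⟨hr, h, h'⟩ := rightMulMatrix_unitary complex_rightMulMatrix_star (u := Complex.I)
    (by simp) (by simp)
  refine (isMatrixInvolution_blockConjHom (h := h) (h' := h') hr).isTotallyGeodesic_splitOrthogonalO
    (fun q hq => blockConjHom_mem_compactSO hr hq) (by simp) (by simp; omega)
    ⟨1, one_mem_splitUnitary, realify_one _⟩ ?_ ?_
  -- Connectedness of U(n, n) is what places its image in the identity component.
  · exact (isPreconnected_splitUnitary (I := Complex.I) (by simp) (by simp)).image _
      (continuous_realify _).continuousOn
  · convert isComponentUnion_self _
    rw [realify_image_splitUnitary complex_leftMulMatrix_star]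
    ext A
    simp only [adjointGroup, mem_singleton_iff, forall_eq, mem_ofPred_eq, mem_splitUnitary_iff,
      blockHom_blockConjHom_eq_iff, mem_range_leftMulMatrix_iff complex_submodule_eq_top]

theorem isTotallyGeodesic_realify_quaternion (hι : 0 < Fintype.card ι) :
    IsTotallyGeodesic (kineticMetric (compactSO (ι × Fin 4)))
      (realify quaternionBasis '' splitUnitary ι ℍ[ℝ]) (splitOrthogonalO (ι × Fin 4)) := by
  obtain ⟨hr, h, h'⟩ := rightMulMatrix_unitary quaternion_rightMulMatrix_star (u := quatI)
    (by ext <;> simp) (by ext <;> simp)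
  obtain ⟨hs, k, k'⟩ := rightMulMatrix_unitary quaternion_rightMulMatrix_star (u := quatJ)
    (by ext <;> simp) (by ext <;> simp)
  -- Right multiplications by i and j anticommute, so the conjugations by them commute.
  have hrs : rightMulMatrix quaternionBasis quatI * rightMulMatrix quaternionBasis quatJ =
      -(rightMulMatrix quaternionBasis quatJ * rightMulMatrix quaternionBasis quatI) := by
    rw [rightMulMatrix_mul, rightMulMatrix_mul, ← rightMulMatrix_neg]
    congr 1
    ext <;> simp
  refine (isMatrixInvolution_blockConjHom (h := h) (h' := h')
    hr).isTotallyGeodesic_splitOrthogonalO_of_commute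
    (fun q hq => blockConjHom_mem_compactSO hr hq)
    (isMatrixInvolution_blockConjHom (h := k) (h' := k') hs)
    (fun q hq => blockConjHom_mem_compactSO hs hq) (blockHom_blockConjHom_comm hrs)
    (by simp [Nat.even_mul]; right; decide) (by simp; omega)
    ⟨1, one_mem_splitUnitary, realify_one _⟩ ?_ ?_
  · refine (isPreconnected_splitUnitary (I := quatI) (by ext <;> simp) ?_).image _
      (continuous_realify _).continuousOn
    intro h0
    have := congrArg (fun x : ℍ[ℝ] => x.imI) h0
    simp at this
  · convert isComponentUnion_self _
    rw [realify_image_splitUnitary quaternion_leftMulMatrix_star]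
    ext A
    simp only [adjointGroup, mem_insert_iff, mem_singleton_iff, forall_eq_or_imp, forall_eq,
      mem_ofPred_eq, mem_splitUnitary_iff, blockHom_blockConjHom_eq_iff,
      mem_range_leftMulMatrix_iff quaternion_submodule_eq_top]
    exact and_congr_right fun _ => ⟨fun e => ⟨fun x y => (e x y).1, fun x y => (e x y).2⟩,
      fun e x y => ⟨e.1 x y, e.2 x y⟩⟩

end RealifyComplexQuaternion

theorem theorem1p3 (n : ℕ) (hn : 1 ≤ n) :
    -- a) `O_o(n, n) ⊂ SU(n, n)`
    IsTotallyGeodesic (kineticMetric (compactU (Fin n) ℂ))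
      ((fun A => A.map (fun x : ℝ => (x : ℂ))) '' splitOrthogonalO (Fin n))
      (splitSpecialUnitary (Fin n)) ∧
    -- b) `U(n, n) ⊂ Sp(n, n)`
    IsTotallyGeodesic (kineticMetric (compactU (Fin n) ℍ[ℝ]))
      ((fun A => A.map (fun z : ℂ => (z : ℍ[ℝ]))) '' splitUnitary (Fin n) ℂ)
      (splitUnitary (Fin n) ℍ[ℝ]) ∧
    -- c) `O_o(n, n) ⊂ Sp(n, n)`
    IsTotallyGeodesic (kineticMetric (compactU (Fin n) ℍ[ℝ]))
      ((fun A => A.map (fun x : ℝ => (x : ℍ[ℝ]))) '' splitOrthogonalO (Fin n))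
      (splitUnitary (Fin n) ℍ[ℝ]) ∧
    -- d) `U(n, n) ⊂ O_o(2n, 2n)`, where `SO_2n` is required to have `2n > 2`
    (2 < 2 * n →
      IsTotallyGeodesic (kineticMetric (compactSO (Fin n × Fin 2)))
        (realify Complex.basisOneI '' splitUnitary (Fin n) ℂ)
        (splitOrthogonalO (Fin n × Fin 2))) ∧
    -- e) `Sp(n, n) ⊂ O_o(4n, 4n)`
    IsTotallyGeodesic (kineticMetric (compactSO (Fin n × Fin 4)))
      (realify quaternionBasis '' splitUnitary (Fin n) ℍ[ℝ])
      (splitOrthogonalO (Fin n × Fin 4)) := by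
  exact ⟨isTotallyGeodesic_splitOrthogonalO_splitSpecialUnitary,
    isTotallyGeodesic_splitUnitary_quaternion, isTotallyGeodesic_splitOrthogonalO_quaternion,
    fun h => isTotallyGeodesic_realify_complex (by simp; omega),
    isTotallyGeodesic_realify_quaternion (by simp; omega)⟩
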